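/- All graphs are finite and simple, and graph classes are closed under isomorphism. For a hereditary graph class $\Pi$ (one closed under induced subgraphs), a minimal forbidden induced subgraph of $\Pi$ is a graph $F\notin\Pi$ all of whose induced subgraphs other than $F$ itself belong to $\Pi$. A graph is chordal if it has no induced cycle of length greater than three. Theorem. For every natural number $\aleph$ there is a real number $\lambda<1$, depending only on $\aleph$, such that the following holds. Let $\Pi$ be a graph class with the following four properties. (1) $\Pi$ is hereditary and all graphs in $\Pi$ are chordal. (2) Every minimal forbidden induced subgraph of $\Pi$ is connected and contains no clique of size $\aleph+1$. (3) Membership of a graph in $\Pi$ can be decided in polynomial time. (4) There is a polynomial-time algorithm $\mathcal A$ that takes as input a graph $G$ together with a clique $S$ in $G$ and answers YES or NO, such that: (a) if $\mathcal A$ answers YES on $(G_1,S_1)$ and on $(G_2,S_2)$, where $|S_1|=|S_2|$, then for every bijection $S_1\to S_2$ the graph obtained from the disjoint union of $G_1$ and $G_2$ by identifying each vertex of $S_1$ with its image in $S_2$ belongs to $\Pi$; (b) for every $G\in\Pi$ there are a clique $S$ in $G$ and a partition of $V(G)\setminus S$ into two (possibly empty) sets $X_1,X_2$ such that $|X_1|,|X_2|\le\frac23|V(G)|$,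 there is no edge of $G$ between $X_1$ and $X_2$, and $\mathcal A$ answers YES on $(G[X_1\cup S],S)$ and on $(G[X_2\cup S],S)$. Then there exist an algorithm and a polynomial $q$ such that, given any $n$-vertex graph $G$, the algorithm returns the vertex set of an induced subgraph of $G$ that belongs to $\Pi$ and has the maximum number of vertices among all such induced subgraphs, in at most $q(n)\cdot 2^{\lambda n}$ steps, i.e. in time $\mathcal O^*(2^{\lambda n})$. (Algorithms are deterministic programs over binary trees built from $\mathrm{nil}$ and $\mathrm{cons}$, with composition, conditionals and while-loops, where each elementary operation costs one step. This model is equivalent to a random access machine up to a logarithmic factor in the running time. Input graphs have vertex set $\{0,\dots,n-1\}$ and are given by their adjacency matrices, vertex sets by their characteristic vectors; an induced subgraph is given to an algorithm with its vertices renumbered in increasing order.) -/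

import Mathlib

/-! ### The machine model

Programs compute on binary trees built from `nil` and `cons` (the data type of pure LISP).  Every
elementary operation (copying a pointer, taking the head or tail of a cell, creating a cell, testing
for `nil`, passing control) costs one step.  Subtrees are shared and never inspected below their
root, so one step is a constant number of pointer operations on a random access machine, and
conversely a random access machine is simulated with a logarithmic overhead, its memory being kept
in a balanced tree. -/

/-- The data of the machine: binary trees. -/
inductive Data : Type
  | nil : Data
  | cons : Data → Data → Data

namespace Data

/-- Head of a cell; the head of `nil` is `nil`. -/
def hd : Data → Data
  | nil => nil
  | cons x _ => x

/-- Tail of a cell; the tail of `nil` is `nil`. -/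
def tl : Data → Data
  | nil => nil
  | cons _ y => y

end Data

/-- Programs.  A program acts on one tree, which holds the whole state; `nil` plays the role of
"false" in tests, every other tree that of "true". -/
inductive Prog : Type
  /-- return `nil` -/
  | nil : Prog
  /-- return the state unchanged -/
  | skip : Prog
  /-- return the head of the state -/
  | hd : Prog
  /-- return the tail of the state -/
  | tl : Prog
  /-- run both programs on the state and build a cell from the two results -/
  | cons : Prog → Prog → Prog
  /-- run the first program, then run the second one on its result -/
  | seq : Prog → Prog → Prog
  /-- if the first program returns true on the state, run the second one, else the third one -/
  | cond : Prog → Prog → Prog → Prog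
  /-- while the first program returns true on the state, replace the state by the result of the
  second one -/
  | loop : Prog → Prog → Prog

namespace Prog

/-- `Runs p x y t`: the program `p`, started on `x`, halts with the result `y` after exactly `t`
elementary steps. -/
inductive Runs : Prog → Data → Data → ℕ → Prop
  | nil (x : Data) : Runs nil x Data.nil 1
  | skip (x : Data) : Runs skip x x 1
  | hd (x : Data) : Runs hd x x.hd 1
  | tl (x : Data) : Runs tl x x.tl 1
  | cons {p q : Prog} {x y z : Data} {s t : ℕ} (hp : Runs p x y s) (hq : Runs q x z t) :
      Runs (cons p q) x (Data.cons y z) (s + t + 1)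
  | seq {p q : Prog} {x y z : Data} {s t : ℕ} (hp : Runs p x y s) (hq : Runs q y z t) :
      Runs (seq p q) x z (s + t + 1)
  | cond_true {b p q : Prog} {x c y : Data} {s t : ℕ} (hb : Runs b x c s) (hc : c ≠ Data.nil)
      (hp : Runs p x y t) : Runs (cond b p q) x y (s + t + 1)
  | cond_false {b p q : Prog} {x y : Data} {s t : ℕ} (hb : Runs b x Data.nil s)
      (hq : Runs q x y t) : Runs (cond b p q) x y (s + t + 1)
  | loop_done {b p : Prog} {x : Data} {s : ℕ} (hb : Runs b x Data.nil s) :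
      Runs (loop b p) x x (s + 1)
  | loop_step {b p : Prog} {x c y z : Data} {s t u : ℕ} (hb : Runs b x c s) (hc : c ≠ Data.nil)
      (hp : Runs p x y t) (hl : Runs (loop b p) y z u) : Runs (loop b p) x z (s + t + u + 1)

/-- Programs are deterministic: the result and the number of steps are determined by the input. -/
theorem Runs.unique {p : Prog} {x y : Data} {t : ℕ} (h : Runs p x y t) :
    ∀ {y' : Data} {t' : ℕ}, Runs p x y' t' → y = y' ∧ t = t' := by
  induction h with
  | nil => intro _ _ h'; cases h'; simp
  | skip => intro _ _ h'; cases h'; simp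
  | hd => intro _ _ h'; cases h'; simp
  | tl => intro _ _ h'; cases h'; simp
  | cons _ _ ih₁ ih₂ =>
    intro _ _ h'
    cases h' with
    | cons h₁ h₂ =>
      obtain ⟨rfl, rfl⟩ := ih₁ h₁
      obtain ⟨rfl, rfl⟩ := ih₂ h₂
      simp
  | seq _ _ ih₁ ih₂ =>
    intro _ _ h'
    cases h' with
    | seq h₁ h₂ =>
      obtain ⟨rfl, rfl⟩ := ih₁ h₁
      obtain ⟨rfl, rfl⟩ := ih₂ h₂
      simp
  | cond_true _ hc _ ih₁ ih₂ =>
    intro _ _ h'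
    cases h' with
    | cond_true h₁ _ h₂ =>
      obtain ⟨rfl, rfl⟩ := ih₁ h₁
      obtain ⟨rfl, rfl⟩ := ih₂ h₂
      simp
    | cond_false h₁ _ => exact absurd (ih₁ h₁).1 hc
  | cond_false _ _ ih₁ ih₂ =>
    intro _ _ h'
    cases h' with
    | cond_true h₁ hc _ => exact absurd (ih₁ h₁).1.symm hc
    | cond_false h₁ h₂ =>
      obtain ⟨_, rfl⟩ := ih₁ h₁
      obtain ⟨rfl, rfl⟩ := ih₂ h₂
      simp
  | loop_done _ ih =>
    intro _ _ h'
    cases h' with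
    | loop_done h₁ => obtain ⟨_, rfl⟩ := ih h₁; simp
    | loop_step h₁ hc _ _ => exact absurd (ih h₁).1.symm hc
  | loop_step _ hc _ _ ih₁ ih₂ ih₃ =>
    intro _ _ h'
    cases h' with
    | loop_done h₁ => exact absurd (ih₁ h₁).1 hc
    | loop_step h₁ _ h₂ h₃ =>
      obtain ⟨rfl, rfl⟩ := ih₁ h₁
      obtain ⟨rfl, rfl⟩ := ih₂ h₂
      obtain ⟨rfl, rfl⟩ := ih₃ h₃
      simp

end Prog

/-! ### Encodings of the inputs and outputs

A graph on `0, …, n - 1` is written as its adjacency matrix and a set of vertices as its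
characteristic vector, so that the size of an input is polynomially related to `n`. -/

/-- Truth values. -/
def encBool : Bool → Data
  | false => Data.nil
  | true => Data.cons Data.nil Data.nil

/-- Lists of trees. -/
def encList : List Data → Data
  | [] => Data.nil
  | x :: l => Data.cons x (encList l)

open Classical in
/-- A set of vertices, as its characteristic vector. -/
noncomputable def encSet {n : ℕ} (S : Finset (Fin n)) : Data :=
  encList (List.ofFn fun i => encBool (decide (i ∈ S)))

open Classical in
/-- A graph, as its adjacency matrix. -/
noncomputable def encGraph {n : ℕ} (G : SimpleGraph (Fin n)) : Data :=
  encList (List.ofFn fun i => encList (List.ofFn fun j => encBool (decide (G.Adj i j))))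

/-- A graph with a distinguished set of vertices. -/
noncomputable def encGraphSet {n : ℕ} (G : SimpleGraph (Fin n)) (S : Finset (Fin n)) : Data :=
  Data.cons (encGraph G) (encSet S)

/-! ### Graph classes -/

/-- A class of finite simple graphs (closed under isomorphism, as every graph class). -/
structure GraphClass where
  /-- membership in the class -/
  Mem : ∀ {V : Type} [Finite V], SimpleGraph V → Prop
  /-- membership depends only on the isomorphism type -/
  mem_of_iso : ∀ {V W : Type} [Finite V] [Finite W] {G : SimpleGraph V} {H : SimpleGraph W},
    Nonempty (G ≃g H) → Mem G → Mem H

/-- A graph is chordal if it has no induced cycle of length more than three. -/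
def IsChordal {V : Type} (G : SimpleGraph V) : Prop :=
  ∀ m : ℕ, 3 < m → ¬ (SimpleGraph.cycleGraph m).IsIndContained G

/-- The graph obtained from the disjoint union of `G₁` and `G₂` by identifying every vertex `v` of
`S₁` with the vertex `e v` of `S₂`.  Its vertices are those of `G₁` and those of `G₂` outside `S₂`.
(It is used for cliques `S₁`, `S₂`, where identified pairs carry the same edges on both sides.) -/
def glue {V₁ V₂ : Type} (G₁ : SimpleGraph V₁) (G₂ : SimpleGraph V₂) {S₁ : Finset V₁}
    {S₂ : Finset V₂} (e : S₁ ≃ S₂) : SimpleGraph (V₁ ⊕ {v : V₂ // v ∉ S₂}) where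
  Adj x y := match x, y with
    | Sum.inl a, Sum.inl b => G₁.Adj a b
    | Sum.inr a, Sum.inr b => G₂.Adj a b
    | Sum.inl a, Sum.inr b => ∃ h : a ∈ S₁, G₂.Adj (e ⟨a, h⟩) b
    | Sum.inr a, Sum.inl b => ∃ h : b ∈ S₁, G₂.Adj a (e ⟨b, h⟩)
  symm := ⟨by
    rintro (a | a) (b | b) h
    · exact G₁.adj_symm h
    · exact ⟨h.1, G₂.adj_symm h.2⟩
    · exact ⟨h.1, G₂.adj_symm h.2⟩
    · exact G₂.adj_symm h⟩
  loopless := ⟨by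
    rintro (a | a) h
    · exact G₁.loopless.irrefl a h
    · exact G₂.loopless.irrefl a.1 h⟩

/-- The induced subgraph `G[W]` as the input of an algorithm: the vertices in `W` are renumbered
`0, …, |W| - 1` in increasing order. -/
def inducedOn {n : ℕ} (G : SimpleGraph (Fin n)) (W : Finset (Fin n)) :
    SimpleGraph (Fin W.card) :=
  G.comap (W.orderEmbOfFin rfl)

/-- The part of `S` in `W`, under the same renumbering of `W`. -/
def setOn {n : ℕ} (S W : Finset (Fin n)) : Finset (Fin W.card) :=
  Finset.univ.filter fun i => W.orderEmbOfFin rfl i ∈ S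

/-- The program `A` answers YES on the graph `G` with the distinguished set `S`. -/
def Prog.AnswersYes (A : Prog) {n : ℕ} (G : SimpleGraph (Fin n)) (S : Finset (Fin n)) : Prop :=
  ∃ t : ℕ, A.Runs (encGraphSet G S) (encBool true) t

namespace GraphClass

/-- The class is closed under induced subgraphs. -/
def Hereditary (P : GraphClass) : Prop :=
  ∀ {V : Type} [Finite V] (G : SimpleGraph V) (W : Set V), P.Mem G → P.Mem (G.induce W)

/-- All graphs of the class are chordal. -/
def SubclassOfChordal (P : GraphClass) : Prop :=
  ∀ {V : Type} [Finite V] (G : SimpleGraph V), P.Mem G → IsChordal G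

/-- `F` is a minimal forbidden induced subgraph of the class: it is not in the class, but all its
other induced subgraphs are. -/
def MinimalForbidden (P : GraphClass) {V : Type} [Finite V] (F : SimpleGraph V) : Prop :=
  ¬ P.Mem F ∧ ∀ W : Set V, W ≠ Set.univ → P.Mem (F.induce W)

/-- All minimal forbidden induced subgraphs are connected and have no clique of size `k + 1`. -/
def ForbiddenBound (P : GraphClass) (k : ℕ) : Prop :=
  ∀ {V : Type} [Finite V] (F : SimpleGraph V), P.MinimalForbidden F →
    F.Connected ∧ F.CliqueFree (k + 1)

open Classical in
/-- Membership in the class is decided in polynomial time. -/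
def PolyTimeRecognizable (P : GraphClass) : Prop :=
  ∃ (R : Prog) (p : Polynomial ℕ), ∀ (n : ℕ) (G : SimpleGraph (Fin n)),
    ∃ t : ℕ, t ≤ p.eval n ∧ R.Runs (encGraph G) (encBool (decide (P.Mem G))) t

/-- The test `A` is sound for gluing: whenever it answers YES on two graphs with distinguished
cliques of the same size, every graph obtained by identifying the two cliques is in the class. -/
def GluingSound (P : GraphClass) (A : Prog) : Prop :=
  ∀ (n₁ n₂ : ℕ) (G₁ : SimpleGraph (Fin n₁)) (G₂ : SimpleGraph (Fin n₂))
    (S₁ : Finset (Fin n₁)) (S₂ : Finset (Fin n₂)), G₁.IsClique S₁ → G₂.IsClique S₂ →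
    A.AnswersYes G₁ S₁ → A.AnswersYes G₂ S₂ → ∀ e : S₁ ≃ S₂, P.Mem (glue G₁ G₂ e)

/-- Every graph of the class has a `2/3`-balanced clique separator `S` such that the test `A`
answers YES on both sides. -/
def SeparatorComplete (P : GraphClass) (A : Prog) : Prop :=
  ∀ (n : ℕ) (G : SimpleGraph (Fin n)), P.Mem G →
    ∃ S X₁ X₂ : Finset (Fin n), G.IsClique S ∧
      Disjoint X₁ S ∧ Disjoint X₂ S ∧ Disjoint X₁ X₂ ∧ X₁ ∪ X₂ ∪ S = Finset.univ ∧
      3 * X₁.card ≤ 2 * n ∧ 3 * X₂.card ≤ 2 * n ∧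
      (∀ u ∈ X₁, ∀ v ∈ X₂, ¬ G.Adj u v) ∧
      A.AnswersYes (inducedOn G (X₁ ∪ S)) (setOn S (X₁ ∪ S)) ∧
      A.AnswersYes (inducedOn G (X₂ ∪ S)) (setOn S (X₂ ∪ S))

/-- There is a polynomial-time algorithm which, on a graph with a distinguished clique, answers YES
or NO so that the two preceding conditions hold. -/
def HasGluingTest (P : GraphClass) : Prop :=
  ∃ (A : Prog) (p : Polynomial ℕ),
    (∀ (n : ℕ) (G : SimpleGraph (Fin n)) (S : Finset (Fin n)), G.IsClique S →
      ∃ (t : ℕ) (b : Bool), t ≤ p.eval n ∧ A.Runs (encGraphSet G S) (encBool b) t) ∧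
    P.GluingSound A ∧ P.SeparatorComplete A

/-- `G[W]` is a maximum induced subgraph of `G` belonging to the class. -/
def IsMaximumInduced (P : GraphClass) {V : Type} [Finite V] (G : SimpleGraph V)
    (W : Finset V) : Prop :=
  P.Mem (G.induce (W : Set V)) ∧
    ∀ W' : Finset V, P.Mem (G.induce (W' : Set V)) → W'.card ≤ W.card

end GraphClass

/-! ### Verified programs with time bounds -/

/-! The algorithm lists candidate vertex sets, discards those outside the class and returns a
largest remaining one. Hence two facts suffice: some candidate is a maximum solution
(`exists_mem_allCands`), and for suitable constants the lists are produced in time `2^(λn)` up to a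
polynomial (`exists_parameters`). Let `F` be a maximum solution. If `|F| ≤ n/d`, exhaustive search
over small sets finds it.

Suppose there is a clique `K` of about `n/a` vertices. The part of `F` outside `K` is guessed
exhaustively. Inside `K` one branches on minimal forbidden sets: each contains no clique of size `ℵ
+ 1`, so it meets `K` in at most `ℵ` vertices, and the search costs `β^|K|` with `β < 2` instead of
`2^|K|` (`sum_hitBranches_le`).

Otherwise write `F = S ∪ X₁ ∪ X₂` with the clique separator `S`; now `|S| ≤ n/a`, so `S` can be
guessed, and `X₁`, `X₂` both have linear size. Scan the vertices outside `S`, branching only on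
those with at least `D` neighbours outside `S ∪ N[Y]`, where `Y` is the set chosen so far. Each
choice enlarges `N[Y]` by at least `D`, so `|Y| ≤ n/D` and there are few branches. The remaining
vertices are collected undecided in a set `C`. Put `R = C \ N[Y]`; all degrees inside `R` are less
than `D`.

Since minimal forbidden graphs are connected, an independent set in `R` that is not dominated by `X₁
∪ X₂` may be added to `X₁ ∪ X₂`; maximality of `F` bounds its size by `|S|`. So `X₁ ∪ X₂` leaves at
most `D|S|` vertices of `R` undominated (`card_undominated_le`). If `R` is large, it contains many
vertices whose closed neighbourhoods in `C` are bounded and disjoint, and only an exponentially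
small fraction of the subsets of `C` hits almost all of them (`exists_numSets_fewUndominated_le`).

If `R` is small, the sets `X₁ ∩ (Y ∪ R)` and `X₂ ∩ (Y ∪ R)` are guessed; they determine disjoint
sets `A₁ ⊇ X₁` and `A₂ ⊇ X₂` (`subset_side`). Either there is a linear matching between `A₁` and
`A₂`, and then exponentially few sets avoid all edges in between (`exists_numSets_splits_le`), or a
small set `Q` covers these edges. In the latter case the trace on `Q` is guessed as well, after
which no edges are left between the two sides, and the gluing test allows each side to be optimised
on its own, over at most `(1 - 1/b)n` vertices.

The constants are fixed in the order `d`, `b`, `q`, `z`, `D = r = 2z`, `a`: the bound `n/a` for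
`|S|` has to be negligible against the saving that depends on `D` and `r`. Programs are handled
through closure properties of `Comp` and `LComp`, which measure time up to polynomial factors. -/

namespace Prog

/-- `p` maps `x` to `y` within `T` steps. -/
def RunsIn (p : Prog) (x y : Data) (T : ℕ) : Prop := ∃ t, t ≤ T ∧ p.Runs x y t

theorem RunsIn.mono {p : Prog} {x y : Data} {S T : ℕ} (h : RunsIn p x y S) (hST : S ≤ T) :
    RunsIn p x y T := by
  obtain ⟨t, ht, hr⟩ := h
  exact ⟨t, ht.trans hST, hr⟩

theorem RunsIn.nil (x : Data) : RunsIn .nil x .nil 1 := ⟨1, le_rfl, .nil x⟩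
theorem RunsIn.skip (x : Data) : RunsIn .skip x x 1 := ⟨1, le_rfl, .skip x⟩
theorem RunsIn.hd (x : Data) : RunsIn .hd x x.hd 1 := ⟨1, le_rfl, .hd x⟩
theorem RunsIn.tl (x : Data) : RunsIn .tl x x.tl 1 := ⟨1, le_rfl, .tl x⟩

theorem RunsIn.cons {p q : Prog} {x y z : Data} {s t : ℕ} (hp : RunsIn p x y s)
    (hq : RunsIn q x z t) : RunsIn (.cons p q) x (.cons y z) (s + t + 1) := by
  obtain ⟨s', hs, hp⟩ := hp
  obtain ⟨t', ht, hq⟩ := hq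
  exact ⟨_, by omega, .cons hp hq⟩

theorem RunsIn.seq {p q : Prog} {x y z : Data} {s t : ℕ} (hp : RunsIn p x y s)
    (hq : RunsIn q y z t) : RunsIn (.seq p q) x z (s + t + 1) := by
  obtain ⟨s', hs, hp⟩ := hp
  obtain ⟨t', ht, hq⟩ := hq
  exact ⟨_, by omega, .seq hp hq⟩

theorem RunsIn.cond_true {b p q : Prog} {x c y : Data} {s t : ℕ} (hb : RunsIn b x c s)
    (hc : c ≠ .nil) (hp : RunsIn p x y t) : RunsIn (.cond b p q) x y (s + t + 1) := by
  obtain ⟨s', hs, hb⟩ := hb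
  obtain ⟨t', ht, hp⟩ := hp
  exact ⟨_, by omega, .cond_true hb hc hp⟩

theorem RunsIn.cond_false {b p q : Prog} {x y : Data} {s t : ℕ} (hb : RunsIn b x .nil s)
    (hq : RunsIn q x y t) : RunsIn (.cond b p q) x y (s + t + 1) := by
  obtain ⟨s', hs, hb⟩ := hb
  obtain ⟨t', ht, hq⟩ := hq
  exact ⟨_, by omega, .cond_false hb hq⟩

theorem RunsIn.loop_done {b p : Prog} {x : Data} {s : ℕ} (hb : RunsIn b x .nil s) :
    RunsIn (.loop b p) x x (s + 1) := by
  obtain ⟨s', hs, hb⟩ := hb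
  exact ⟨_, by omega, .loop_done hb⟩

theorem RunsIn.loop_step {b p : Prog} {x c y z : Data} {s t u : ℕ} (hb : RunsIn b x c s)
    (hc : c ≠ .nil) (hp : RunsIn p x y t) (hl : RunsIn (.loop b p) y z u) :
    RunsIn (.loop b p) x z (s + t + u + 1) := by
  obtain ⟨s', hs, hb⟩ := hb
  obtain ⟨t', ht, hp⟩ := hp
  obtain ⟨u', hu, hl⟩ := hl
  exact ⟨_, by omega, .loop_step hb hc hp hl⟩

end Prog

/-! ### Functions of an input graph that are computable within a time bound -/

open Prog

/-- An input graph. -/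
structure Inp where
  /-- number of vertices -/
  n : ℕ
  /-- the graph -/
  G : SimpleGraph (Fin n)

/-- A family of types indexed by the input graph, with an encoding as trees. -/
structure Ty where
  /-- the types -/
  C : Inp → Type
  /-- the encodings -/
  enc : ∀ x, C x → Data

namespace Ty

abbrev unit : Ty := ⟨fun _ => Unit, fun _ _ => .nil⟩
abbrev bool : Ty := ⟨fun _ => Bool, fun _ => encBool⟩
noncomputable abbrev set : Ty := ⟨fun x => Finset (Fin x.n), fun _ => encSet⟩
abbrev prod (A B : Ty) : Ty :=
  ⟨fun x => A.C x × B.C x, fun x a => .cons (A.enc x a.1) (B.enc x a.2)⟩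
abbrev list (A : Ty) : Ty := ⟨fun x => List (A.C x), fun x l => encList (l.map (A.enc x))⟩
abbrev nat : Ty := ⟨fun _ => ℕ, fun _ m => encList (List.replicate m .nil)⟩
/-- The elements of a family that satisfy a condition. -/
abbrev sub (A : Ty) (p : ∀ x, A.C x → Prop) : Ty :=
  ⟨fun x => {a : A.C x // p x a}, fun x a => A.enc x a.1⟩

end Ty

/-- The function `f` is computed, in the presence of the input graph, in a number of steps that is
at most `c` up to a polynomial factor. -/
def Comp (A B : Ty) (f : ∀ x, A.C x → B.C x) (c : ∀ x, A.C x → ℕ) : Prop :=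
  ∃ (p : Prog) (q : Polynomial ℕ), ∀ x a,
    p.RunsIn (.cons (encGraph x.G) (A.enc x a)) (B.enc x (f x a)) (q.eval x.n * (c x a + 1))

/-- The function `f` is computed in polynomial time, in the presence of the input graph. -/
abbrev PComp (A B : Ty) (f : ∀ x, A.C x → B.C x) : Prop := Comp A B f fun _ _ => 0

namespace Comp

variable {A B B' S : Ty} {f : ∀ x, A.C x → B.C x} {c c₁ c₂ c₃ : ∀ x, A.C x → ℕ}

theorem mono {c' : ∀ x, A.C x → ℕ} (h : Comp A B f c)
    (hc : ∃ r : Polynomial ℕ, ∀ x a, c x a ≤ r.eval x.n * (c' x a + 1)) : Comp A B f c' := by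
  obtain ⟨p, q, h⟩ := h
  obtain ⟨r, hr⟩ := hc
  refine ⟨p, q * (r + 1), fun x a => (h x a).mono ?_⟩
  have := hr x a
  simp only [Polynomial.eval_mul, Polynomial.eval_add, Polynomial.eval_one]
  calc q.eval x.n * (c x a + 1) ≤ q.eval x.n * (r.eval x.n * (c' x a + 1) + (c' x a + 1)) := by
        gcongr; omega
    _ = _ := by ring

theorem mono' {c' : ∀ x, A.C x → ℕ} (h : Comp A B f c) (hc : ∀ x a, c x a ≤ c' x a) :
    Comp A B f c' :=
  h.mono ⟨1, fun x a => by simpa using (hc x a).trans (Nat.le_succ _)⟩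

theorem to_poly (h : Comp A B f c) (r : Polynomial ℕ) (hr : ∀ x a, c x a ≤ r.eval x.n) :
    PComp A B f := h.mono ⟨r, fun x a => by simpa using hr x a⟩

theorem congr {f' : ∀ x, A.C x → B.C x} (h : Comp A B f c) (hf : ∀ x a, f x a = f' x a) :
    Comp A B f' c := by
  have : f = f' := by funext x a; exact hf x a
  exact this ▸ h

/-- Changing the type of the result without changing its encoding. -/
theorem recode {f' : ∀ x, A.C x → B'.C x} (h : Comp A B f c)
    (hf : ∀ x a, B.enc x (f x a) = B'.enc x (f' x a)) : Comp A B' f' c := by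
  obtain ⟨p, q, h⟩ := h
  exact ⟨p, q, fun x a => hf x a ▸ h x a⟩

theorem of_runsIn (p : Prog) (k : ℕ)
    (h : ∀ x a, p.RunsIn (.cons (encGraph x.G) (A.enc x a)) (B.enc x (f x a)) k) : PComp A B f :=
  ⟨p, Polynomial.C k, fun x a => (h x a).mono (by simp)⟩

theorem id : PComp A A fun _ a => a :=
  of_runsIn .tl 1 fun _ _ => RunsIn.tl _

theorem comp {g : ∀ x, B.C x → B'.C x} {cg : ∀ x, B.C x → ℕ} (hg : Comp B B' g cg)
    (hf : Comp A B f c) : Comp A B' (fun x a => g x (f x a)) fun x a => c x a + cg x (f x a) := by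
  obtain ⟨p, q, hf⟩ := hf
  obtain ⟨p', q', hg⟩ := hg
  -- The first program returns only its result, so the graph is copied next to it for the second
  -- one.
  refine ⟨.seq (.cons .hd p) p', q + q' + 3, fun x a => ?_⟩
  refine ((RunsIn.seq (.cons (.hd _) (hf x a)) (hg x _))).mono ?_
  simp only [Polynomial.eval_add, Polynomial.eval_ofNat]
  nlinarith [Nat.zero_le (q.eval x.n * cg x (f x a)), Nat.zero_le (q'.eval x.n * c x a)]

theorem pair {g : ∀ x, A.C x → B'.C x} (hf : Comp A B f c₁) (hg : Comp A B' g c₂) :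
    Comp A (B.prod B') (fun x a => (f x a, g x a)) fun x a => c₁ x a + c₂ x a := by
  obtain ⟨p, q, hf⟩ := hf
  obtain ⟨p', q', hg⟩ := hg
  refine ⟨.cons p p', q + q' + 1, fun x a => ((hf x a).cons (hg x a)).mono ?_⟩
  simp only [Polynomial.eval_add, Polynomial.eval_one]
  nlinarith [Nat.zero_le (q.eval x.n * c₂ x a), Nat.zero_le (q'.eval x.n * c₁ x a)]

/-- Postprocessing the tree that encodes a result by a fixed program of constant running time. -/
theorem post {g : ∀ x, A.C x → B'.C x} (hf : Comp A B f c) (p : Prog) (k : ℕ)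
    (hp : ∀ x a, p.RunsIn (B.enc x (f x a)) (B'.enc x (g x a)) k) : Comp A B' g c := by
  obtain ⟨p', q, hf⟩ := hf
  refine ⟨.seq p' p, q + Polynomial.C (k + 1), fun x a => ((hf x a).seq (hp x a)).mono ?_⟩
  simp only [Polynomial.eval_add, Polynomial.eval_C]
  nlinarith [Nat.zero_le (k * c x a)]

/-- Postprocessing by a program that does not need the input graph. -/
theorem post_poly {g : ∀ x, A.C x → B'.C x} (hf : Comp A B f c) (p : Prog) (r : Polynomial ℕ)
    (hp : ∀ x a, p.RunsIn (B.enc x (f x a)) (B'.enc x (g x a)) (r.eval x.n)) :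
    Comp A B' g c := by
  obtain ⟨p', q, hf⟩ := hf
  refine ⟨.seq p' p, q + r + 1, fun x a => ((hf x a).seq (hp x a)).mono ?_⟩
  simp only [Polynomial.eval_add, Polynomial.eval_one]
  nlinarith [Nat.zero_le (r.eval x.n * c x a)]

theorem fst {f : ∀ x, A.C x → (B.prod B').C x} (hf : Comp A (B.prod B') f c) :
    Comp A B (fun x a => (f x a).1) c :=
  hf.post .hd 1 fun _ _ => .hd _

theorem snd {f : ∀ x, A.C x → (B.prod B').C x} (hf : Comp A (B.prod B') f c) :
    Comp A B' (fun x a => (f x a).2) c :=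
  hf.post .tl 1 fun _ _ => .tl _

theorem nil : PComp A (.list B) fun _ _ => [] :=
  of_runsIn .nil 1 fun _ _ => RunsIn.nil _

theorem tt : PComp A .bool fun _ _ => true :=
  of_runsIn (.cons .nil .nil) 3 fun _ _ => (RunsIn.nil _).cons (RunsIn.nil _)

theorem ff : PComp A .bool fun _ _ => false :=
  of_runsIn .nil 1 fun _ _ => RunsIn.nil _

theorem cons {g : ∀ x, A.C x → (Ty.list B).C x} (hf : Comp A B f c₁)
    (hg : Comp A (.list B) g c₂) :
    Comp A (.list B) (fun x a => f x a :: g x a) fun x a => c₁ x a + c₂ x a :=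
  (hf.pair hg).recode fun _ _ => rfl

theorem singleton (hf : Comp A B f c) : Comp A (.list B) (fun x a => [f x a]) c :=
  (hf.cons nil).mono' fun _ _ => le_rfl

theorem tail {f : ∀ x, A.C x → (Ty.list B).C x} (hf : Comp A (.list B) f c) :
    Comp A (.list B) (fun x a => (f x a).tail) c :=
  hf.post .tl 1 fun x a => by
    have : ((Ty.list B).enc x (f x a)).tl = (Ty.list B).enc x (f x a).tail := by
      cases f x a <;> rfl
    exact this ▸ RunsIn.tl _

/-- The head of a list, for a type with an element encoded as `nil`. -/
theorem headD {f : ∀ x, A.C x → (Ty.list B).C x} {d : ∀ x, B.C x} (hd : ∀ x, B.enc x (d x) = .nil)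
    (hf : Comp A (.list B) f c) : Comp A B (fun x a => (f x a).headD (d x)) c :=
  hf.post .hd 1 fun x a => by
    have : ((Ty.list B).enc x (f x a)).hd = B.enc x ((f x a).headD (d x)) := by
      cases f x a
      · exact (hd x).symm
      · rfl
    exact this ▸ RunsIn.hd _

/-- The list of the first element, if any. -/
theorem take_one {f : ∀ x, A.C x → (Ty.list B).C x} (hf : Comp A (.list B) f c) :
    Comp A (.list B) (fun x a => (f x a).take 1) c :=
  hf.post (.cond .skip (.cons .hd .nil) .nil) 5 fun x a => by
    cases h : f x a with
    | nil => exact (RunsIn.cond_false (.skip _) (.nil _)).mono (by norm_num)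
    | cons b l =>
      exact (RunsIn.cond_true (.skip _) (by simp [encList]) ((RunsIn.hd _).cons (.nil _))).mono
        (by norm_num)

theorem isEmpty {f : ∀ x, A.C x → (Ty.list B).C x} (hf : Comp A (.list B) f c) :
    Comp A .bool (fun x a => (f x a).isEmpty) c :=
  hf.post (.cond .skip .nil (.cons .nil .nil)) 5 fun x a => by
    cases h : f x a with
    | nil => exact (RunsIn.cond_false (.skip _) ((RunsIn.nil _).cons (.nil _))).mono (by norm_num)
    | cons b l => exact (RunsIn.cond_true (.skip _) (by simp [encList]) (.nil _)).mono (by norm_num)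

/-- A conditional, both branches of which need to be computed only where they are taken. -/
theorem ite_sub {b : ∀ x, A.C x → Bool} {g : ∀ x, A.C x → B.C x} (hb : Comp A .bool b c₁)
    (hf : Comp (A.sub fun x a => b x a = true) B (fun x a => f x a.1) fun x a => c₂ x a.1)
    (hg : Comp (A.sub fun x a => b x a = false) B (fun x a => g x a.1) fun x a => c₃ x a.1) :
    Comp A B (fun x a => if b x a then f x a else g x a)
      fun x a => c₁ x a + if b x a then c₂ x a else c₃ x a := by
  obtain ⟨p₁, q₁, hb⟩ := hb
  obtain ⟨p₂, q₂, hf⟩ := hf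
  obtain ⟨p₃, q₃, hg⟩ := hg
  refine ⟨.cond p₁ p₂ p₃, q₁ + q₂ + q₃ + 1, fun x a => ?_⟩
  have hb := hb x a
  simp only [Polynomial.eval_add, Polynomial.eval_one]
  cases h : b x a with
  | true =>
    rw [h] at hb
    refine (hb.cond_true (by simp [encBool]) (hf x ⟨a, h⟩)).mono ?_
    simp only [if_true]
    nlinarith [Nat.zero_le (q₁.eval x.n * c₂ x a), Nat.zero_le (q₂.eval x.n * c₁ x a),
      Nat.zero_le (q₃.eval x.n * c₁ x a), Nat.zero_le (q₃.eval x.n * c₂ x a)]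
  | false =>
    rw [h] at hb
    refine (hb.cond_false (hg x ⟨a, h⟩)).mono ?_
    simp only [Bool.false_eq_true, if_false]
    nlinarith [Nat.zero_le (q₁.eval x.n * c₃ x a), Nat.zero_le (q₃.eval x.n * c₁ x a),
      Nat.zero_le (q₂.eval x.n * c₁ x a), Nat.zero_le (q₂.eval x.n * c₃ x a)]

theorem restrict (hf : Comp A B f c) (p : ∀ x, A.C x → Prop) :
    Comp (A.sub p) B (fun x a => f x a.1) fun x a => c x a.1 := by
  obtain ⟨p', q, hf⟩ := hf
  exact ⟨p', q, fun x a => hf x a.1⟩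

theorem ite {b : ∀ x, A.C x → Bool} {g : ∀ x, A.C x → B.C x} (hb : Comp A .bool b c₁)
    (hf : Comp A B f c₂) (hg : Comp A B g c₃) :
    Comp A B (fun x a => if b x a then f x a else g x a)
      fun x a => c₁ x a + if b x a then c₂ x a else c₃ x a :=
  ite_sub hb (hf.restrict _) (hg.restrict _)

theorem ite_poly {b : ∀ x, A.C x → Bool} {g : ∀ x, A.C x → B.C x} (hb : PComp A .bool b)
    (hf : PComp A B f) (hg : PComp A B g) :
    PComp A B (fun x a => if b x a then f x a else g x a) :=
  (ite hb hf hg).mono' fun x a => by split <;> simp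

theorem and {b b' : ∀ x, A.C x → Bool} (hb : PComp A .bool b) (hb' : PComp A .bool b') :
    PComp A .bool fun x a => b x a && b' x a :=
  (ite_poly hb hb' ff).congr fun x a => by cases b x a <;> rfl

theorem or {b b' : ∀ x, A.C x → Bool} (hb : PComp A .bool b) (hb' : PComp A .bool b') :
    PComp A .bool fun x a => b x a || b' x a :=
  (ite_poly hb tt hb').congr fun x a => by cases b x a <;> rfl

theorem not {b : ∀ x, A.C x → Bool} (hb : PComp A .bool b) : PComp A .bool fun x a => !b x a :=
  (ite_poly hb ff tt).congr fun x a => by cases b x a <;> rfl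

/-- A loop over a list. -/
def foldLoop (p : Prog) : Prog :=
  .loop (.seq .tl .tl)
      (.cons .hd (.cons
        (.seq (.cons (.seq .hd .hd)
          (.cons (.seq .hd .tl) (.cons (.seq .tl .hd) (.seq .tl (.seq .tl .hd))))) p)
        (.seq .tl (.seq .tl .tl))))

/-- The state is `((graph, parameter), (accumulator, remaining list))`, and the loop runs until the
remaining list is `nil`. The constant 32 absorbs the rearrangement of the state in each round. -/
theorem foldl_loop {p : Prog} {g : Data} {A S B : Type} {eA : A → Data} {eS : S → Data}
    {eB : B → Data} {F : A → S → B → S} {a : A} (T : S → B → ℕ)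
    (hp : ∀ s b, p.RunsIn (.cons g (.cons (eA a) (.cons (eS s) (eB b)))) (eS (F a s b)) (T s b))
    (w : B → ℕ) (l : List B) : ∀ s : S,
    (∀ l₁ b l₂, l = l₁ ++ b :: l₂ → T (l₁.foldl (F a) s) b ≤ w b) →
    RunsIn (foldLoop p)
      (.cons (.cons g (eA a)) (.cons (eS s) (encList (l.map eB))))
      (.cons (.cons g (eA a)) (.cons (eS (l.foldl (F a) s)) .nil))
      ((l.map fun b => w b + 32).sum + 4) := by
  induction l with
  | nil =>
    intro s _
    exact (RunsIn.loop_done ((RunsIn.tl _).seq (.tl _))).mono (by simp)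
  | cons b l ih =>
    intro s hw
    have h0 := hw [] b l rfl
    simp only [List.foldl_nil] at h0
    have ih' := ih (F a s b) fun l₁ b' l₂ h => hw (b :: l₁) b' l₂ (by simp [h])
    have h₁ : RunsIn (.cons (.seq .hd .hd)
        (.cons (.seq .hd .tl) (.cons (.seq .tl .hd) (.seq .tl (.seq .tl .hd)))))
        (.cons (.cons g (eA a)) (.cons (eS s) (encList ((b :: l).map eB))))
        (.cons g (.cons (eA a) (.cons (eS s) (eB b)))) 17 :=
      (((RunsIn.hd _).seq (.hd _)).cons (((RunsIn.hd _).seq (.tl _)).cons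
        (((RunsIn.tl _).seq (.hd _)).cons ((RunsIn.tl _).seq ((RunsIn.tl _).seq (.hd _)))))).mono
        (by norm_num)
    have h₂ := (RunsIn.hd _).cons ((h₁.seq ((hp s b).mono h0)).cons
      ((RunsIn.tl _).seq ((RunsIn.tl _).seq (.tl _))))
    refine (RunsIn.loop_step ((RunsIn.tl _).seq (.tl _)) (by simp [Data.tl, encList]) h₂
      ih').mono ?_
    simp only [List.map_cons, List.sum_cons]
    omega

/-- The step cost is bounded only at accumulators that arise from prefixes of the list. This admits
costs that grow with an intermediate list, as in `enumSets` and the search trees. -/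
theorem foldl {s₀ : ∀ x, A.C x → S.C x} {l : ∀ x, A.C x → List (B.C x)}
    {F : ∀ x, (A.prod (S.prod B)).C x → S.C x} {cs cl : ∀ x, A.C x → ℕ}
    {cF : ∀ x, (A.prod (S.prod B)).C x → ℕ} (w : ∀ x, A.C x → B.C x → ℕ)
    (hs : Comp A S s₀ cs) (hl : Comp A (.list B) l cl) (hF : Comp (A.prod (S.prod B)) S F cF)
    (hw : ∀ x a (l₁ : List (B.C x)) b l₂, l x a = l₁ ++ b :: l₂ →
      cF x (a, (l₁.foldl (fun s b => F x (a, (s, b))) (s₀ x a), b)) ≤ w x a b) :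
    Comp A S (fun x a => (l x a).foldl (fun s b => F x (a, (s, b))) (s₀ x a))
      fun x a => cs x a + cl x a + ((l x a).map fun b => w x a b + 1).sum := by
  obtain ⟨ps, qs, hs⟩ := hs
  obtain ⟨pl, ql, hl⟩ := hl
  obtain ⟨p, q, hF⟩ := hF
  refine ⟨.seq (.cons .skip (.cons ps pl)) (.seq (foldLoop p) (.seq .tl .hd)),
    qs + ql + q + 44, fun x a => ?_⟩
  have key := foldl_loop (p := p) (g := encGraph x.G) (a := a) (eA := A.enc x) (eS := S.enc x)
    (eB := B.enc x) (F := fun a s b => F x (a, (s, b)))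
    (fun s b => q.eval x.n * (cF x (a, (s, b)) + 1)) (fun s b => hF x (a, (s, b)))
    (fun b => q.eval x.n * (w x a b + 1)) (l x a) (s₀ x a)
    (fun l₁ b l₂ h => by gcongr; exact hw x a l₁ b l₂ h)
  refine (RunsIn.seq ((RunsIn.skip _).cons ((hs x a).cons (hl x a)))
    (key.seq ((RunsIn.tl _).seq (.hd _)))).mono ?_
  have hsum : ((l x a).map fun b => q.eval x.n * (w x a b + 1) + 32).sum ≤
      (q.eval x.n + 32) * ((l x a).map fun b => w x a b + 1).sum := by
    rw [← List.sum_map_mul_left]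
    apply List.sum_le_sum
    intro b _
    nlinarith
  simp only [Polynomial.eval_add, Polynomial.eval_ofNat]
  generalize ((l x a).map fun b => w x a b + 1).sum = σ at *
  generalize ((l x a).map fun b => q.eval x.n * (w x a b + 1) + 32).sum = σ' at *
  generalize q.eval x.n = Q at *
  generalize qs.eval x.n = Qs at *
  generalize ql.eval x.n = Ql at *
  generalize cs x a = u at *
  generalize cl x a = v at *
  nlinarith [Nat.zero_le (Q * u), Nat.zero_le (Q * v), Nat.zero_le (Qs * v), Nat.zero_le (Qs * σ),
    Nat.zero_le (Ql * u), Nat.zero_le (Ql * σ)]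

/-- A loop of polynomial length with steps of polynomial time. -/
theorem foldl_poly {s₀ : ∀ x, A.C x → S.C x} {l : ∀ x, A.C x → List (B.C x)}
    {F : ∀ x, (A.prod (S.prod B)).C x → S.C x} (hs : PComp A S s₀) (hl : PComp A (.list B) l)
    (hF : PComp (A.prod (S.prod B)) S F) (r : Polynomial ℕ)
    (hr : ∀ x a, (l x a).length ≤ r.eval x.n) :
    PComp A S (fun x a => (l x a).foldl (fun s b => F x (a, (s, b))) (s₀ x a)) :=
  (foldl (fun _ _ _ => 0) hs hl hF fun _ _ _ _ _ _ => le_rfl).to_poly r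
    fun x a => by simpa using hr x a

end Comp

namespace Comp

/-! ### Lists -/

section lists
variable {A B B' S : Ty} {c c₁ c₂ : ∀ x, A.C x → ℕ}

theorem foldl_cons_eq {α β : Type*} (g : α → β) (l : List α) :
    ∀ s : List β, l.foldl (fun s b => g b :: s) s = (l.map g).reverse ++ s := by
  induction l with
  | nil => simp
  | cons b l ih => intro s; simp [ih]

/-- Consing onto an accumulator reverses the order, so this is what a single loop yields; `append`,
`map` and `flatMap` come from one more reversal. -/
theorem reverse_append {f g : ∀ x, A.C x → List (B.C x)} (hf : Comp A (.list B) f c₁)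
    (hg : Comp A (.list B) g c₂) :
    Comp A (.list B) (fun x a => (f x a).reverse ++ g x a)
      fun x a => c₁ x a + c₂ x a + (f x a).length := by
  refine ((foldl (F := fun x p => p.2.2 :: p.2.1) (cF := fun _ _ => 0) (fun _ _ _ => 0) hg hf
    ((cons id.snd.snd id.snd.fst).mono' fun _ _ => le_rfl) ?_).congr ?_).mono' ?_
  · intros; rfl
  · intro x a; simp
  · intro x a; simp; omega

theorem reverse {f : ∀ x, A.C x → List (B.C x)} (hf : Comp A (.list B) f c) :
    Comp A (.list B) (fun x a => (f x a).reverse) fun x a => c x a + (f x a).length :=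
  ((reverse_append hf nil).congr fun x a => by simp).mono' fun x a => by simp

theorem append {f g : ∀ x, A.C x → List (B.C x)} (hf : Comp A (.list B) f c₁)
    (hg : Comp A (.list B) g c₂) :
    Comp A (.list B) (fun x a => f x a ++ g x a)
      fun x a => c₁ x a + c₂ x a + (f x a).length :=
  ((reverse_append hf.reverse hg).congr fun x a => by simp).mono
    ⟨2, fun x a => by simp; omega⟩

theorem map {l : ∀ x, A.C x → List (B.C x)} {F : ∀ x, (A.prod B).C x → B'.C x}
    {cF : ∀ x, (A.prod B).C x → ℕ} (hl : Comp A (.list B) l c) (hF : Comp (A.prod B) B' F cF) :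
    Comp A (.list B') (fun x a => (l x a).map fun b => F x (a, b))
      fun x a => c x a + ((l x a).map fun b => cF x (a, b) + 1).sum := by
  refine ((foldl (F := fun x p => F x (p.1, p.2.2) :: p.2.1) (fun x a b => cF x (a, b)) nil hl
    (cons (hF.comp (pair id.fst id.snd.snd)) id.snd.fst) ?_).reverse.congr ?_).mono ⟨2, ?_⟩
  · intro x a l₁ b l₂ _; simp
  · intro x a
    have := foldl_cons_eq (fun b => F x (a, b)) (l x a) []
    simp only [this]; simp
  · intro x a
    have := foldl_cons_eq (fun b => F x (a, b)) (l x a) []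
    have h2 : (l x a).length ≤ ((l x a).map fun b => cF x (a, b) + 1).sum := by
      calc (l x a).length = ((l x a).map fun b => 1).sum := by simp
        _ ≤ _ := List.sum_le_sum fun b _ => by omega
    simp only [this]; simp at h2 ⊢; omega

theorem foldl_flatMap_eq {α β : Type*} (g : α → List β) (l : List α) :
    ∀ s : List β, l.foldl (fun s b => (g b).reverse ++ s) s = (l.flatMap g).reverse ++ s := by
  induction l with
  | nil => simp
  | cons b l ih => intro s; simp [ih]

theorem flatMap {l : ∀ x, A.C x → List (B.C x)} {F : ∀ x, (A.prod B).C x → List (B'.C x)}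
    {cF : ∀ x, (A.prod B).C x → ℕ} (hl : Comp A (.list B) l c)
    (hF : Comp (A.prod B) (.list B') F cF) :
    Comp A (.list B') (fun x a => (l x a).flatMap fun b => F x (a, b))
      fun x a => c x a + ((l x a).map fun b => cF x (a, b) + (F x (a, b)).length + 1).sum := by
  refine ((foldl (F := fun x p => (F x (p.1, p.2.2)).reverse ++ p.2.1)
    (fun x a b => cF x (a, b) + (F x (a, b)).length) nil hl
    (reverse_append (hF.comp (pair id.fst id.snd.snd)) id.snd.fst) ?_).reverse.congr
    ?_).mono ⟨2, ?_⟩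
  · intro x a l₁ b l₂ _; simp
  · intro x a
    have := foldl_flatMap_eq (fun b => F x (a, b)) (l x a) []
    simp only [this]; simp
  · intro x a
    have := foldl_flatMap_eq (fun b => F x (a, b)) (l x a) []
    have h2 : ((l x a).flatMap fun b => F x (a, b)).length ≤
        ((l x a).map fun b => cF x (a, b) + (F x (a, b)).length + 1).sum := by
      rw [List.length_flatMap]
      exact List.sum_le_sum fun b _ => by omega
    simp only [this, List.append_nil, List.length_reverse, Polynomial.eval_ofNat]
    omega

theorem flatMap_singleton_eq_filter {α : Type*} (l : List α) (p : α → Bool) :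
    (l.flatMap fun b => if p b then [b] else []) = l.filter p := by
  induction l with
  | nil => rfl
  | cons b l ih => rw [List.flatMap_cons, ih, List.filter_cons]; split <;> simp

theorem filter {l : ∀ x, A.C x → List (B.C x)} {F : ∀ x, (A.prod B).C x → Bool}
    (hl : Comp A (.list B) l c) (hF : PComp (A.prod B) .bool F) :
    Comp A (.list B) (fun x a => (l x a).filter fun b => F x (a, b))
      fun x a => c x a + (l x a).length := by
  refine ((flatMap hl (F := fun x p => if F x p then [p.2] else []) (ite_poly hF
    id.snd.singleton nil)).congr ?_).mono ⟨2, ?_⟩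
  · intro x a; exact flatMap_singleton_eq_filter _ _
  · intro x a
    have : ((l x a).map fun b => 0 + (if F x (a, b) then [b] else []).length + 1).sum ≤
        ((l x a).map fun b => 2).sum :=
      List.sum_le_sum fun b _ => by split <;> simp
    simp at this ⊢
    omega

theorem all_poly {l : ∀ x, A.C x → List (B.C x)} {F : ∀ x, (A.prod B).C x → Bool}
    (hl : PComp A (.list B) l) (hF : PComp (A.prod B) .bool F) (r : Polynomial ℕ)
    (hr : ∀ x a, (l x a).length ≤ r.eval x.n) :
    PComp A .bool (fun x a => (l x a).all fun b => F x (a, b)) := by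
  refine (foldl_poly tt hl (F := fun x p => p.2.1 && F x (p.1, p.2.2))
    (and id.snd.fst ((hF.comp (pair id.fst id.snd.snd)).mono' fun _ _ => le_rfl)) r hr).congr ?_
  intro x a
  have : ∀ (l : List (B.C x)) (s : Bool),
      l.foldl (fun s b => s && F x (a, b)) s = (s && l.all fun b => F x (a, b)) := by
    intro l
    induction l with
    | nil => simp
    | cons b l ih => intro s; simp [ih, Bool.and_assoc]
  simpa using this (l x a) true

theorem any_poly {l : ∀ x, A.C x → List (B.C x)} {F : ∀ x, (A.prod B).C x → Bool}
    (hl : PComp A (.list B) l) (hF : PComp (A.prod B) .bool F) (r : Polynomial ℕ)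
    (hr : ∀ x a, (l x a).length ≤ r.eval x.n) :
    PComp A .bool (fun x a => (l x a).any fun b => F x (a, b)) :=
  (not (all_poly hl (not hF) r hr)).congr fun x a => by
    rw [List.not_all_eq_any_not]; simp

theorem map_poly {l : ∀ x, A.C x → List (B.C x)} {F : ∀ x, (A.prod B).C x → B'.C x}
    (hl : PComp A (.list B) l) (hF : PComp (A.prod B) B' F) (r : Polynomial ℕ)
    (hr : ∀ x a, (l x a).length ≤ r.eval x.n) :
    PComp A (.list B') (fun x a => (l x a).map fun b => F x (a, b)) :=
  (map hl hF).to_poly r fun x a => by simpa using hr x a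

/-- The second list travels in the accumulator and loses its head in every round; the length
hypothesis keeps the default `d` from ever being read. -/
theorem foldl_zip_eq {α β γ : Type*} (g : α → β → γ) (d : β) (l : List α) :
    ∀ (m : List β) (s : List γ), l.length ≤ m.length →
      (l.foldl (fun s b => (s.1.tail, g b (s.1.headD d) :: s.2)) (m, s)).2 =
        (List.zipWith g l m).reverse ++ s := by
  induction l with
  | nil => simp
  | cons b l ih =>
    intro m s h
    cases m with
    | nil => simp at h
    | cons b' m =>
      have := ih m (g b b' :: s) (by simpa using h)
      simpa [-List.headD_eq_head?_getD] using this

theorem zipWith_poly {B'' : Ty} {l : ∀ x, A.C x → List (B.C x)} {m : ∀ x, A.C x → List (B'.C x)}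
    {F : ∀ x, (A.prod (B.prod B')).C x → B''.C x} {d : ∀ x, B'.C x}
    (hd : ∀ x, B'.enc x (d x) = .nil)
    (hl : PComp A (.list B) l) (hm : PComp A (.list B') m)
    (hF : PComp (A.prod (B.prod B')) B'' F) (r : Polynomial ℕ)
    (hr : ∀ x a, (l x a).length ≤ r.eval x.n) (hlm : ∀ x a, (l x a).length ≤ (m x a).length) :
    PComp A (.list B'')
      (fun x a => List.zipWith (fun b b' => F x (a, (b, b'))) (l x a) (m x a)) := by
  have hs : PComp A ((Ty.list B').prod (Ty.list B'')) fun x a => (m x a, []) :=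
    (hm.pair nil).mono' fun _ _ => le_rfl
  have hstep : PComp (A.prod (((Ty.list B').prod (Ty.list B'')).prod B))
      ((Ty.list B').prod (Ty.list B''))
      fun x p => (p.2.1.1.tail, F x (p.1, (p.2.2, p.2.1.1.headD (d x))) :: p.2.1.2) :=
    (pair id.snd.fst.fst.tail (cons (hF.comp (pair id.fst (pair id.snd.snd
      (headD hd id.snd.fst.fst)))) id.snd.fst.snd)).mono' fun _ _ => le_rfl
  have hz : ∀ x a, ((l x a).foldl (fun s b =>
      (s.1.tail, F x (a, (b, s.1.headD (d x))) :: s.2)) (m x a, [])).2 =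
      (List.zipWith (fun b b' => F x (a, (b, b'))) (l x a) (m x a)).reverse := fun x a => by
    simpa using foldl_zip_eq (fun b b' => F x (a, (b, b'))) (d x) (l x a) (m x a) [] (hlm x a)
  have h := ((foldl_poly hs hl hstep r hr).snd.congr hz).reverse
  refine (h.congr fun x a => List.reverse_reverse _).to_poly r fun x a => ?_
  have := hr x a
  simp
  omega

theorem foldl_sel_eq {α : Type*} (l : List α) :
    ∀ (m : List Bool) (s : List α), l.length ≤ m.length →
      (l.foldl (fun s b => (s.1.tail, if s.1.headD false then b :: s.2 else s.2)) (m, s)).2 =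
        (((l.zip m).filter fun p => p.2).map Prod.fst).reverse ++ s := by
  induction l with
  | nil => simp
  | cons b l ih =>
    intro m s h
    cases m with
    | nil => simp at h
    | cons b' m =>
      have := fun s => ih m s (by simpa using h)
      cases b' <;> simp [-List.headD_eq_head?_getD, this]

/-- The elements of a list selected by a characteristic vector. -/
def sel {α : Type*} (l : List α) (m : List Bool) : List α :=
  ((l.zip m).filter fun p => p.2).map Prod.fst

theorem sel_poly {l : ∀ x, A.C x → List (B.C x)} {m : ∀ x, A.C x → List Bool}
    (hl : PComp A (.list B) l) (hm : PComp A (.list .bool) m) (r : Polynomial ℕ)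
    (hr : ∀ x a, (l x a).length ≤ r.eval x.n) (hlm : ∀ x a, (l x a).length ≤ (m x a).length) :
    PComp A (.list B) (fun x a => sel (l x a) (m x a)) := by
  have hs : PComp A ((Ty.list .bool).prod (Ty.list B)) fun x a => (m x a, []) :=
    (hm.pair nil).mono' fun _ _ => le_rfl
  have hstep : PComp (A.prod (((Ty.list .bool).prod (Ty.list B)).prod B))
      ((Ty.list .bool).prod (Ty.list B))
      fun x p => (p.2.1.1.tail, if p.2.1.1.headD false then p.2.2 :: p.2.1.2 else p.2.1.2) :=
    (pair id.snd.fst.fst.tail (ite_poly (headD (B := .bool) (d := fun _ => false) (fun _ => rfl)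
      id.snd.fst.fst) (cons id.snd.snd id.snd.fst.snd) id.snd.fst.snd)).mono' fun _ _ => le_rfl
  have hz : ∀ x a, ((l x a).foldl (fun s b =>
      (s.1.tail, if s.1.headD false then b :: s.2 else s.2)) (m x a, [])).2 =
      (sel (l x a) (m x a)).reverse := fun x a => by
    simpa [sel] using foldl_sel_eq (l x a) (m x a) [] (hlm x a)
  have h := ((foldl_poly hs hl hstep r hr).snd.congr hz).reverse
  refine (h.congr fun x a => List.reverse_reverse _).to_poly r fun x a => ?_
  have h1 := hr x a
  have h2 : (sel (l x a) (m x a)).length ≤ (l x a).length := by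
    unfold sel
    rw [List.length_map]
    refine (List.length_filter_le _ _).trans ?_
    simp
  simp only [List.length_reverse]
  omega

end lists

/-! ### Natural numbers in unary notation -/

section nat
variable {A : Ty} {f g : ∀ x, A.C x → ℕ}

theorem zero : PComp A .nat fun _ _ => 0 := of_runsIn .nil 1 fun _ _ => RunsIn.nil _

theorem succ (hf : PComp A .nat f) : PComp A .nat fun x a => f x a + 1 :=
  hf.post (.cons .nil .skip) 3 fun _ _ => (RunsIn.nil _).cons (.skip _)

theorem pred (hf : PComp A .nat f) : PComp A .nat fun x a => f x a - 1 :=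
  hf.post .tl 1 fun x a => by
    have : (Ty.nat.enc x (f x a)).tl = Ty.nat.enc x (f x a - 1) := by
      cases f x a <;> rfl
    exact this ▸ RunsIn.tl _

theorem isZero (hf : PComp A .nat f) : PComp A .bool fun x a => f x a == 0 :=
  hf.post (.cond .skip .nil (.cons .nil .nil)) 5 fun x a => by
    cases h : f x a with
    | zero => exact (RunsIn.cond_false (.skip _) ((RunsIn.nil _).cons (.nil _))).mono (by norm_num)
    | succ b => exact (RunsIn.cond_true (.skip _) (by simp [encList, List.replicate_succ])
        (.nil _)).mono (by norm_num)

theorem ticks (hf : PComp A .nat f) :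
    PComp A (.list .unit) fun x a => List.replicate (f x a) () :=
  hf.recode fun x a => by simp

theorem add (hf : PComp A .nat f) (hg : PComp A .nat g) (r : Polynomial ℕ)
    (hr : ∀ x a, g x a ≤ r.eval x.n) : PComp A .nat fun x a => f x a + g x a := by
  refine (foldl_poly hf hg.ticks (F := fun x p => p.2.1 + 1) (succ id.snd.fst) r
    (by simpa using hr)).congr fun x a => ?_
  induction g x a with
  | zero => rfl
  | succ m ih => rw [List.replicate_succ', List.foldl_append, ih]; rfl

theorem mul_const (hf : PComp A .nat f) (r : Polynomial ℕ)
    (hr : ∀ x a, f x a ≤ r.eval x.n) (k : ℕ) : PComp A .nat fun x a => k * f x a := by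
  induction k with
  | zero => exact zero.congr fun x a => by simp
  | succ k ih => exact (add ih hf r hr).congr fun x a => by ring

/-- Truncated subtraction, carried out by repeated predecessors, gives zero exactly in this case. -/
theorem le (hf : PComp A .nat f) (hg : PComp A .nat g) (r : Polynomial ℕ)
    (hr : ∀ x a, g x a ≤ r.eval x.n) : PComp A .bool fun x a => decide (f x a ≤ g x a) := by
  refine (isZero (foldl_poly hf hg.ticks (F := fun x p => p.2.1 - 1) (pred id.snd.fst) r
    (by simpa using hr))).congr fun x a => ?_
  have : ∀ m, (List.replicate m ()).foldl (fun s _ => s - 1) (f x a) = f x a - m := by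
    intro m
    induction m with
    | zero => rfl
    | succ m ih => rw [List.replicate_succ', List.foldl_append, ih]; simp; omega
  simp only [this, Bool.beq_eq_decide_eq, decide_eq_decide]
  omega

end nat

end Comp

/-! ### Sets of vertices -/

/-- The characteristic vector of a set. -/
def vecOf {n : ℕ} (S : Finset (Fin n)) : List Bool := List.ofFn fun i => decide (i ∈ S)

open Classical in
/-- The adjacency matrix. -/
noncomputable def adjM {n : ℕ} (G : SimpleGraph (Fin n)) : List (List Bool) :=
  List.ofFn fun i => List.ofFn fun j => decide (G.Adj i j)

open Classical in
/-- The vertices with a neighbor in `W`. -/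
noncomputable def nb {n : ℕ} (G : SimpleGraph (Fin n)) (W : Finset (Fin n)) : Finset (Fin n) :=
  Finset.univ.filter fun v => ∃ w ∈ W, G.Adj v w

theorem mem_nb {n : ℕ} {G : SimpleGraph (Fin n)} {W : Finset (Fin n)} {v : Fin n} :
    v ∈ nb G W ↔ ∃ w ∈ W, G.Adj v w := by
  simp [nb]

theorem encSet_eq {n : ℕ} (S : Finset (Fin n)) : encSet S = encList ((vecOf S).map encBool) := by
  simp only [encSet, vecOf, List.map_ofFn]
  congr 1

theorem encGraph_eq {n : ℕ} (G : SimpleGraph (Fin n)) :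
    encGraph G = encList ((adjM G).map fun r => encList (r.map encBool)) := by
  simp only [encGraph, adjM, List.map_ofFn]
  congr 2
  funext i
  simp [Function.comp_def, List.map_ofFn]

theorem length_vecOf {n : ℕ} (S : Finset (Fin n)) : (vecOf S).length = n := by simp [vecOf]

theorem length_adjM {n : ℕ} (G : SimpleGraph (Fin n)) : (adjM G).length = n := by simp [adjM]

theorem eval_mono (p : Polynomial ℕ) {m n : ℕ} (h : m ≤ n) : p.eval m ≤ p.eval n := by
  rw [Polynomial.eval_eq_sum_range, Polynomial.eval_eq_sum_range]
  gcongr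

/-- The identity matrix, and a zero vector, of the given size. -/
def idMatrix : ℕ → List (List Bool) × List Bool
  | 0 => ([], [])
  | m + 1 => ((true :: (idMatrix m).2) :: (idMatrix m).1.map (false :: ·), false :: (idMatrix m).2)

theorem idMatrix_snd (m : ℕ) : (idMatrix m).2 = List.ofFn fun _ : Fin m => false := by
  induction m with
  | zero => rfl
  | succ m ih => simp [idMatrix, ih]

theorem idMatrix_fst (m : ℕ) :
    (idMatrix m).1 = List.ofFn fun i : Fin m => List.ofFn fun j : Fin m => decide (j = i) := by
  induction m with
  | zero => rfl
  | succ m ih =>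
    rw [idMatrix, ih, idMatrix_snd, List.ofFn_succ, List.ofFn_succ, List.map_ofFn]
    simp [Function.comp_def, List.ofFn_succ, (Fin.succ_ne_zero _).symm]

/-- The singletons, in increasing order. -/
def singles (n : ℕ) : List (Finset (Fin n)) := List.ofFn fun i => {i}

theorem length_singles (n : ℕ) : (singles n).length = n := by simp [singles]

theorem mem_singles {n : ℕ} {W : Finset (Fin n)} : W ∈ singles n ↔ ∃ v, W = {v} := by
  simp [singles, List.mem_ofFn, eq_comm]

/-- Selection keeps the order of the list, so it performs exactly the increasing renumbering used by
`inducedOn` and `setOn`. -/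
theorem sel_ofFn {n : ℕ} {α : Type*} (f : Fin n → α) (W : Finset (Fin n)) :
    Comp.sel (List.ofFn f) (vecOf W) = List.ofFn fun i => f (W.orderEmbOfFin rfl i) := by
  have h1 : (List.finRange n).filter (fun i => decide (i ∈ W)) = W.sort := by
    rw [← List.toFinset_sort (· ≤ ·) ((List.nodup_finRange n).filter _)|>.mpr]
    · congr 1
      ext i
      simp
    · exact (List.pairwise_le_finRange n).filter _
  have h2 : ∀ l : List (Fin n), Comp.sel (l.map f) (l.map fun i => decide (i ∈ W)) =
      (l.filter fun i => decide (i ∈ W)).map f := by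
    intro l
    induction l with
    | nil => rfl
    | cons i l ih =>
      simp only [Comp.sel, List.map_cons, List.zip_cons_cons, List.filter_cons] at ih ⊢
      split <;> simp [ih]
  rw [vecOf, List.ofFn_eq_map, List.ofFn_eq_map, h2, h1, List.ofFn_eq_map,
    ← Finset.listMap_orderEmbOfFin_finRange W rfl, List.map_map]
  rfl

theorem card_eq_foldl {n : ℕ} (W : Finset (Fin n)) :
    (vecOf W).foldl (fun s b => if b then s + 1 else s) 0 = W.card := by
  have : ∀ (l : List (Fin n)) (s : ℕ), (l.map fun i => decide (i ∈ W)).foldl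
      (fun s b => if b then s + 1 else s) s = s + (l.filter fun i => decide (i ∈ W)).length := by
    intro l
    induction l with
    | nil => simp
    | cons i l ih =>
      intro s
      simp only [List.map_cons, List.foldl_cons, List.filter_cons, ih]
      by_cases h : i ∈ W <;> simp [h]
      omega
  rw [vecOf, List.ofFn_eq_map, this, zero_add]
  have : W = Finset.univ.filter fun i => i ∈ W := by simp
  conv_rhs => rw [this]
  rfl

namespace Comp

variable {A B : Ty} {f g : ∀ x, A.C x → Finset (Fin x.n)} {c : ∀ x, A.C x → ℕ}

theorem of_vec (h : Comp A (.list .bool) (fun x a => vecOf (f x a)) c) : Comp A .set f c :=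
  h.recode fun _ _ => (encSet_eq _).symm

theorem to_vec (h : Comp A .set f c) : Comp A (.list .bool) (fun x a => vecOf (f x a)) c :=
  h.recode fun _ _ => encSet_eq _

theorem matrix : PComp A (.list (.list .bool)) fun x _ => adjM x.G :=
  of_runsIn .hd 1 fun x a => by
    have : (Data.cons (encGraph x.G) (A.enc x a)).hd =
      (Ty.list (.list .bool)).enc x (adjM x.G) := encGraph_eq x.G
    exact this ▸ RunsIn.hd _

theorem set_op (op : Bool → Bool → Bool)
    (hop : PComp (A.prod (Ty.bool.prod .bool)) .bool fun _ p => op p.2.1 p.2.2)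
    (hf : PComp A .set f) (hg : PComp A .set g) {h : ∀ x, A.C x → Finset (Fin x.n)}
    (hh : ∀ x a i, decide (i ∈ h x a) = op (decide (i ∈ f x a)) (decide (i ∈ g x a))) :
    PComp A .set h := by
  refine of_vec ((zipWith_poly (B' := .bool) (d := fun _ => false) (fun _ => rfl) hf.to_vec
    hg.to_vec hop Polynomial.X ?_ ?_).congr fun x a => ?_)
  · simp [length_vecOf]
  · simp [length_vecOf]
  · refine List.ext_getElem (by simp [vecOf]) fun i h₁ h₂ => ?_
    simp [vecOf, hh]

theorem union (hf : PComp A .set f) (hg : PComp A .set g) : PComp A .set fun x a => f x a ∪ g x a :=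
  set_op (· || ·) (or id.snd.fst id.snd.snd) hf hg fun x a i => by simp

theorem inter (hf : PComp A .set f) (hg : PComp A .set g) : PComp A .set fun x a => f x a ∩ g x a :=
  set_op (· && ·) (and id.snd.fst id.snd.snd) hf hg fun x a i => by simp

theorem sdiff (hf : PComp A .set f) (hg : PComp A .set g) : PComp A .set fun x a => f x a \ g x a :=
  set_op (fun a b => a && !b) (and id.snd.fst (not id.snd.snd)) hf hg fun x a i => by simp

theorem empty : PComp A .set fun _ _ => ∅ :=
  of_vec ((map_poly matrix (F := fun _ _ => false) ff Polynomial.X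
    (by simp [length_adjM])).congr fun x a => by
      refine List.ext_getElem (by simp [vecOf, length_adjM]) fun i h₁ h₂ => ?_
      simp [vecOf])

theorem univ : PComp A .set fun _ _ => Finset.univ :=
  of_vec ((map_poly matrix (F := fun _ _ => true) tt Polynomial.X
    (by simp [length_adjM])).congr fun x a => by
      refine List.ext_getElem (by simp [vecOf, length_adjM]) fun i h₁ h₂ => ?_
      simp [vecOf])

theorem nb (hf : PComp A .set f) : PComp A .set fun x a => nb x.G (f x a) := by
  -- A vertex has a neighbour in the set iff its matrix row and the vector of the set share an entry
  -- `true`. The subtype remembers the row length, which bounds the inner loop.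
  have hrow : PComp (A.prod (.sub (.list .bool) fun x r => r.length = x.n)) .bool
      fun x p => (List.zipWith (· && ·) p.2.1 (vecOf (f x p.1))).any fun b => b := by
    have h1 : PComp (A.prod (.sub (.list .bool) fun x r => r.length = x.n)) (.list .bool)
        fun x p => p.2.1 := id.snd.recode fun _ _ => rfl
    have h2 : PComp (A.prod (.sub (.list .bool) fun x r => r.length = x.n)) (.list .bool)
        fun x p => List.zipWith (· && ·) p.2.1 (vecOf (f x p.1)) := by
      refine zipWith_poly (B := .bool) (B' := .bool) (B'' := .bool) (F := fun _ p => p.2.1 && p.2.2)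
        (d := fun _ => false) (fun _ => rfl) h1
        ((hf.comp id.fst).mono' fun _ _ => le_rfl).to_vec (and id.snd.fst id.snd.snd)
        Polynomial.X ?_ ?_
      · intro x p; simp [p.2.2]
      · intro x p; simp [p.2.2, length_vecOf]
    refine any_poly (B := .bool) (F := fun _ p => p.2) h2 id.snd Polynomial.X ?_
    intro x p; simp [p.2.2]
  have hm : PComp A (.list (.sub (.list .bool) fun x r => r.length = x.n))
      fun x _ => (adjM x.G).attach.map fun r => ⟨r.1, by
        have := r.2; simp only [adjM, List.mem_ofFn] at this
        obtain ⟨i, hi⟩ := this; rw [← hi]; simp⟩ :=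
    matrix.recode fun x a => by simp [List.map_map, Function.comp_def]
  refine of_vec ((map_poly hm hrow Polynomial.X (by simp [length_adjM])).congr fun x a => ?_)
  refine List.ext_getElem (by simp [vecOf, length_adjM]) fun i h₁ h₂ => ?_
  rw [Bool.eq_iff_iff]
  simp only [adjM, vecOf, List.getElem_map, List.getElem_ofFn, List.getElem_attach, mem_nb,
    List.any_eq_true, decide_eq_true_eq]
  constructor
  · rintro ⟨b, hb, hb'⟩
    obtain ⟨j, hj, rfl⟩ := List.getElem_of_mem hb
    simp at hb'
    exact ⟨_, hb'.2, hb'.1⟩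
  · rintro ⟨w, hw, hadj⟩
    refine ⟨true, ?_, rfl⟩
    rw [List.mem_iff_getElem]
    exact ⟨w, by simp, by simp [hw, hadj]⟩

theorem card (hf : PComp A .set f) : PComp A .nat fun x a => (f x a).card :=
  (foldl_poly (F := fun _ p => if p.2.2 then p.2.1 + 1 else p.2.1) zero hf.to_vec
    (ite_poly id.snd.snd (succ id.snd.fst) id.snd.fst) Polynomial.X
    (by simp [length_vecOf])).congr fun x a => card_eq_foldl _

theorem card_le (k l : ℕ) (hf : PComp A .set f) (hg : PComp A .set g) :
    PComp A .bool fun x a => decide (k * (f x a).card ≤ l * (g x a).card) := by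
  have h : ∀ (x : Inp) (W : Finset (Fin x.n)), W.card ≤ x.n := fun x W => by
    simpa using Finset.card_le_univ W
  refine le (mul_const (card hf) Polynomial.X (by simp [h]) k)
    (mul_const (card hg) Polynomial.X (by simp [h]) l) (Polynomial.C l * Polynomial.X) ?_
  intro x a
  simpa using Nat.mul_le_mul_left l (h x _)

theorem isEmpty_set (hf : PComp A .set f) : PComp A .bool fun x a => decide (f x a = ∅) :=
  (isZero (card hf)).congr fun x a => by rw [Bool.eq_iff_iff]; simp

theorem subset (hf : PComp A .set f) (hg : PComp A .set g) :
    PComp A .bool fun x a => decide (f x a ⊆ g x a) :=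
  (isEmpty_set (sdiff hf hg)).congr fun x a => by simp [Finset.sdiff_eq_empty_iff_subset]

/-- The singletons are encoded as the rows of the identity matrix. It is built by adding one row and
one column for every row of the adjacency matrix, so `n` itself is never needed as a number. -/
theorem singles : PComp A (.list .set) fun x _ => singles x.n := by
  have hz : ∀ (x : Inp) (l : List (List Bool)), l.foldl (fun (s : List (List Bool) × List Bool) _ =>
      ((true :: s.2) :: s.1.map (false :: ·), false :: s.2)) ([], []) = idMatrix l.length := by
    intro x l
    induction l using List.reverseRecOn with
    | nil => rfl
    | append_singleton l b ih => rw [List.foldl_append, ih]; simp [idMatrix]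
  have hs : PComp A ((Ty.list (.list .bool)).prod (.list .bool)) fun _ _ => ([], []) :=
    (pair nil nil).mono' fun _ _ => le_rfl
  have hF : Comp (A.prod (((Ty.list (.list .bool)).prod (.list .bool)).prod (.list .bool)))
      ((Ty.list (.list .bool)).prod (.list .bool))
      (fun x p => ((true :: p.2.1.2) :: p.2.1.1.map (false :: ·), false :: p.2.1.2))
      (fun x p => p.2.1.1.length) :=
    (pair (cons (cons tt id.snd.fst.snd) (map (B := .list .bool) (B' := .list .bool)
      (F := fun _ p => false :: p.2) id.snd.fst.fst (cons ff id.snd)))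
      (cons ff id.snd.fst.snd)).mono' fun x p => by simp
  have h := (foldl (fun x _ _ => x.n) hs matrix hF ?_).to_poly
    (Polynomial.X * (Polynomial.X + 1)) ?_
  · refine (h.congr fun x a => hz x _).fst.recode fun x a => ?_
    simp only [length_adjM, idMatrix_fst, _root_.singles, List.map_ofFn]
    congr 2
    funext i
    simp only [Function.comp_apply]
    rw [encSet_eq]
    simp [vecOf]
  · intro x a l₁ b l₂ h
    have h1 := length_adjM x.G
    rw [h, List.length_append, List.length_cons] at h1
    simp only [hz x]
    rw [idMatrix_fst, List.length_ofFn]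
    omega
  · intro x a
    simp [length_adjM]

/-- A universally quantified condition on vertices. -/
theorem all_single {F : ∀ x, (A.prod .set).C x → Bool} (hF : PComp (A.prod .set) .bool F) :
    PComp A .bool (fun x a => (_root_.singles x.n).all fun v => F x (a, v)) :=
  all_poly singles hF Polynomial.X (by simp [length_singles])

open Classical in
theorem isClique (hf : PComp A .set f) :
    PComp A .bool fun x a => decide (x.G.IsClique (f x a)) := by
  have h : PComp (A.prod .set) .bool fun x p => !decide (p.2 ⊆ f x p.1) ||
      decide (f x p.1 ⊆ p.2 ∪ _root_.nb x.G p.2) := by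
    have h1 : PComp (A.prod .set) .set fun x p => f x p.1 :=
      (hf.comp id.fst).mono' fun _ _ => le_rfl
    exact or (not (subset id.snd h1)) (subset h1 (union id.snd (nb id.snd)))
  refine (all_single h).congr fun x a => ?_
  rw [Bool.eq_iff_iff]
  simp only [List.all_eq_true, mem_singles, decide_eq_true_eq, Bool.or_eq_true, Bool.not_eq_true',
    decide_eq_false_iff_not]
  constructor
  · intro h u hu v hv huv
    have := (h _ ⟨u, rfl⟩).resolve_left (by simpa using hu) hv
    simp only [Finset.mem_union, Finset.mem_singleton, mem_nb, exists_eq_left] at this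
    exact (this.resolve_left (Ne.symm huv)).symm
  · rintro h _ ⟨v, rfl⟩
    rw [← imp_iff_not_or]
    intro hv u hu
    simp only [Finset.mem_union, Finset.mem_singleton, mem_nb, exists_eq_left]
    by_cases huv : u = v
    · exact .inl huv
    · exact .inr (h hu (by simpa using hv) huv)

/-- The induced subgraph on a set of vertices, as an adjacency matrix. -/
theorem inducedOn (hf : PComp A .set f) :
    PComp A ⟨fun x => Finset (Fin x.n), fun x W => encGraph (inducedOn x.G W)⟩ f := by
  -- The vector of the set selects the columns in each row, then the rows. Since the vertex type of
  -- the result varies with the set, the computed function is `f` itself and only the encoding of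
  -- its value is new.
  have hrow : PComp (A.prod (.sub (.list .bool) fun x r => r.length = x.n)) (.list .bool)
      fun x p => sel p.2.1 (vecOf (f x p.1)) := by
    have h1 : PComp (A.prod (.sub (.list .bool) fun x r => r.length = x.n)) (.list .bool)
        fun x p => p.2.1 := id.snd.recode fun _ _ => rfl
    refine sel_poly h1 ((hf.comp id.fst).mono' fun _ _ => le_rfl).to_vec Polynomial.X ?_ ?_
    · intro x p; simp [p.2.2]
    · intro x p; simp [p.2.2, length_vecOf]
  have hm : PComp A (.list (.sub (.list .bool) fun x r => r.length = x.n))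
      fun x _ => (adjM x.G).attach.map fun r => ⟨r.1, by
        have := r.2; simp only [adjM, List.mem_ofFn] at this
        obtain ⟨i, hi⟩ := this; rw [← hi]; simp⟩ :=
    matrix.recode fun x a => by simp [List.map_map, Function.comp_def]
  refine (sel_poly (map_poly hm hrow Polynomial.X (by simp [length_adjM])) hf.to_vec
    Polynomial.X (by simp [length_adjM]) (by simp [length_adjM, length_vecOf])).recode
    fun x a => ?_
  have h1 : ((adjM x.G).attach.map fun r => sel r.1 (vecOf (f x a))) =
      List.ofFn fun i => sel (List.ofFn fun j => by classical exact decide (x.G.Adj i j))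
        (vecOf (f x a)) := by
    rw [List.attach_map_val (f := fun r => sel r (vecOf (f x a))), adjM, List.map_ofFn]
    rfl
  simp only [List.map_map, Function.comp_def, h1]
  rw [sel_ofFn, encGraph_eq]
  simp only [sel_ofFn]
  rfl

theorem setOn (hf : PComp A .set f) (hg : PComp A .set g) :
    PComp A ⟨fun x => Finset (Fin x.n) × Finset (Fin x.n), fun _ p => encSet (setOn p.1 p.2)⟩
      fun x a => (f x a, g x a) := by
  refine (sel_poly hf.to_vec hg.to_vec Polynomial.X (by simp [length_vecOf])
    (by simp [length_vecOf])).recode fun x a => ?_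
  simp only [encSet_eq]
  conv_lhs => rw [vecOf, sel_ofFn]
  simp [vecOf, _root_.setOn]

end Comp

/-! ### Enumeration of hereditary families of sets -/

/-- One round of the enumeration: the vertex in `v` is added to the sets in `L` where possible. -/
def enumStep {n : ℕ} (ok : Finset (Fin n) → Bool) (L : List (Finset (Fin n))) (v : Finset (Fin n)) :
    List (Finset (Fin n)) :=
  L.flatMap fun W => if ok (W ∪ v) then [W ∪ v, W] else [W]

/-- The list of all members of a family of sets that is closed under subsets. -/
def enumSets {n : ℕ} (ok : Finset (Fin n) → Bool) : List (Finset (Fin n)) :=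
  (singles n).foldl (enumStep ok) [∅]

/-- The number of members of a family of sets. -/
def numSets {n : ℕ} (ok : Finset (Fin n) → Bool) : ℕ :=
  (Finset.univ.filter fun W => ok W = true).card

/-- Closure under subsets ensures that a member containing `i` arises from its part without `i`,
which is already listed. The empty set starts the list untested, hence the disjunct `W = ∅`. -/
theorem enum_invariant {n : ℕ} {ok : Finset (Fin n) → Bool}
    (hok : ∀ W W', W ⊆ W' → ok W' = true → ok W = true) (vs : List (Fin n)) (hvs : vs.Nodup) :
    ((vs.map fun i => {i}).foldl (enumStep ok) [∅]).Nodup ∧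
      ∀ W, W ∈ (vs.map fun i => {i}).foldl (enumStep ok) [∅] ↔
        (W = ∅ ∨ ok W = true) ∧ ∀ v ∈ W, v ∈ vs := by
  induction vs using List.reverseRecOn with
  | nil =>
    refine ⟨by simp, fun W => ?_⟩
    simp only [List.map_nil, List.foldl_nil, List.mem_singleton, List.not_mem_nil, imp_false]
    constructor
    · rintro rfl; simp
    · intro h; exact Finset.eq_empty_of_forall_notMem h.2
  | append_singleton vs i ih =>
    rw [List.nodup_append] at hvs
    obtain ⟨hnd, hmem⟩ := ih hvs.1
    have hi : i ∉ vs := fun h => hvs.2.2 i h i (by simp) rfl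
    rw [List.map_append, List.foldl_append]
    set L := (vs.map fun i => ({i} : Finset (Fin n))).foldl (enumStep ok) [∅] with hL
    have hiW : ∀ W ∈ L, i ∉ W := fun W hW h => hi (((hmem W).1 hW).2 i h)
    simp only [List.map_cons, List.map_nil, List.foldl_cons, List.foldl_nil, enumStep]
    constructor
    · rw [List.nodup_flatMap]
      refine ⟨fun W hW => ?_, hnd.imp_of_mem fun {W W'} hW hW' hne => ?_⟩
      · split
        · simp only [List.nodup_cons, List.mem_singleton, List.not_mem_nil, not_false_iff,
            List.nodup_nil, and_true]
          intro h
          exact hiW W hW (h ▸ by simp)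
        · simp
      -- The parent of a new set is recovered by erasing `i`, so different parents have disjoint
      -- offspring.
      · have h1 : ∀ (V : Finset (Fin n)) U,
            U ∈ (if ok (V ∪ {i}) = true then [V ∪ {i}, V] else [V]) →
            i ∉ V → U.erase i = V := by
          intro V U hU hV
          have : U = V ∪ {i} ∨ U = V := by split at hU <;> simp_all
          rcases this with rfl | rfl
          · rw [Finset.union_comm, ← Finset.insert_eq, Finset.erase_insert hV]
          · exact Finset.erase_eq_of_notMem hV
        intro U hU hU'
        exact hne ((h1 W U hU (hiW W hW)).symm.trans (h1 W' U hU' (hiW W' hW')))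
    · intro W
      rw [List.mem_flatMap]
      constructor
      · rintro ⟨V, hV, hW⟩
        have hV' := (hmem V).1 hV
        split at hW
        · rename_i h
          simp only [List.mem_cons, List.not_mem_nil, or_false] at hW
          rcases hW with rfl | rfl
          · refine ⟨.inr h, fun v hv => ?_⟩
            simp only [Finset.mem_union, Finset.mem_singleton] at hv
            simp only [List.mem_append, List.mem_singleton]
            exact hv.imp (hV'.2 v) (fun h => h)
          · exact ⟨hV'.1, fun v hv => List.mem_append_left _ (hV'.2 v hv)⟩
        · rw [List.mem_singleton] at hW
          subst hW
          exact ⟨hV'.1, fun v hv => List.mem_append_left _ (hV'.2 v hv)⟩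
      · rintro ⟨h1, h2⟩
        by_cases hiW : i ∈ W
        · have hokW : ok W = true := h1.resolve_left (by rintro rfl; simp at hiW)
          have hu : W.erase i ∪ {i} = W := by
            rw [Finset.union_comm, ← Finset.insert_eq, Finset.insert_erase hiW]
          refine ⟨W.erase i, (hmem _).2 ⟨.inr (hok _ _ (Finset.erase_subset _ _) hokW),
            fun v hv => ?_⟩, ?_⟩
          · have := h2 v (Finset.mem_of_mem_erase hv)
            rw [List.mem_append, List.mem_singleton] at this
            exact this.resolve_right (Finset.ne_of_mem_erase hv)
          · rw [hu, if_pos hokW]; simp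
        · refine ⟨W, (hmem _).2 ⟨h1, fun v hv => ?_⟩, by split <;> simp⟩
          have := h2 v hv
          rw [List.mem_append, List.mem_singleton] at this
          exact this.resolve_right (by rintro rfl; exact hiW hv)

theorem singles_eq (n : ℕ) : singles n = (List.finRange n).map fun i => {i} := by
  rw [singles, List.ofFn_eq_map]

theorem mem_enumSets {n : ℕ} {ok : Finset (Fin n) → Bool}
    (hok : ∀ W W', W ⊆ W' → ok W' = true → ok W = true) {W : Finset (Fin n)} :
    W ∈ enumSets ok ↔ W = ∅ ∨ ok W = true := by
  rw [enumSets, singles_eq, (enum_invariant hok _ (List.nodup_finRange n)).2 W]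
  simp

/-- There are no dead ends: every intermediate list also consists of distinct members of the family,
apart from `∅`. So the time of the enumeration is governed by the number of members. -/
theorem length_enum_prefix {n : ℕ} {ok : Finset (Fin n) → Bool}
    (hok : ∀ W W', W ⊆ W' → ok W' = true → ok W = true) (l₁ l₂ : List (Finset (Fin n)))
    (h : singles n = l₁ ++ l₂) : (l₁.foldl (enumStep ok) [∅]).length ≤ numSets ok + 1 := by
  rw [singles_eq] at h
  obtain ⟨vs, ws, h1, rfl, rfl⟩ := List.map_eq_append_iff.1 h
  have hnd := List.nodup_finRange n
  rw [h1, List.nodup_append] at hnd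
  obtain ⟨h2, h3⟩ := enum_invariant hok vs hnd.1
  rw [← List.toFinset_card_of_nodup h2]
  refine (Finset.card_le_card (t := insert ∅ (Finset.univ.filter fun W => ok W = true)) ?_).trans
    (Finset.card_insert_le _ _)
  intro W hW
  have := (h3 W).1 (by simpa using hW)
  simpa using this.1

theorem length_enumSets {n : ℕ} {ok : Finset (Fin n) → Bool}
    (hok : ∀ W W', W ⊆ W' → ok W' = true → ok W = true) :
    (enumSets ok).length ≤ numSets ok + 1 :=
  length_enum_prefix hok _ [] (by simp)

/-- A set of maximum size in a list. -/
def largest {n : ℕ} (l : List (Finset (Fin n))) : Finset (Fin n) :=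
  l.foldl (fun b W => if decide (b.card ≤ W.card) then W else b) ∅

theorem largest_spec {n : ℕ} (l : List (Finset (Fin n))) :
    (l = [] ∨ largest l ∈ l) ∧ ∀ W ∈ l, W.card ≤ (largest l).card := by
  induction l using List.reverseRecOn with
  | nil => simp
  | append_singleton l V ih =>
    rw [largest, List.foldl_append, ← largest]
    simp only [List.foldl_cons, List.foldl_nil, decide_eq_true_eq]
    split
    · rename_i h
      refine ⟨by simp, fun W hW => ?_⟩
      rw [List.mem_append, List.mem_singleton] at hW
      rcases hW with hW | rfl
      · exact (ih.2 W hW).trans h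
      · exact le_rfl
    · rename_i h
      have hl : l ≠ [] := by rintro rfl; simp [largest] at h
      refine ⟨.inr (by simp [ih.1.resolve_left hl]), fun W hW => ?_⟩
      rw [List.mem_append, List.mem_singleton] at hW
      rcases hW with hW | rfl
      · exact ih.2 W hW
      · omega

/-! ### Programs for these functions -/

/-- On a graph with a distinguished clique, `T` answers within the given number of steps. -/
def Prog.AnswersWithin (T : Prog) (p : Polynomial ℕ) : Prop :=
  ∀ (n : ℕ) (G : SimpleGraph (Fin n)) (S : Finset (Fin n)), G.IsClique S →
    ∃ (t : ℕ) (b : Bool), t ≤ p.eval n ∧ T.Runs (encGraphSet G S) (encBool b) t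

namespace Comp

variable {A : Ty} {c : ∀ x, A.C x → ℕ}

theorem enumSets {ok : ∀ x, (A.prod .set).C x → Bool} (hok : PComp (A.prod .set) .bool ok)
    (hdown : ∀ x a W W', W ⊆ W' → ok x (a, W') = true → ok x (a, W) = true) :
    Comp A (.list .set) (fun x a => enumSets fun W => ok x (a, W))
      fun x a => numSets fun W => ok x (a, W) := by
  have hF : Comp (A.prod ((Ty.list .set).prod .set)) (.list .set)
      (fun x p => enumStep (fun W => ok x (p.1, W)) p.2.1 p.2.2) fun x p => p.2.1.length := by
    have h1 : PComp ((A.prod ((Ty.list .set).prod .set)).prod .set) (.list .set)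
        fun x p => if ok x (p.1.1, p.2 ∪ p.1.2.2) then [p.2 ∪ p.1.2.2, p.2] else [p.2] := by
      have hu := union (A := (A.prod ((Ty.list .set).prod .set)).prod .set) id.snd id.fst.snd.snd
      have h2 := hok.comp (pair (A := (A.prod ((Ty.list .set).prod .set)).prod .set) id.fst.fst hu)
      refine ite_poly (h2.mono' fun _ _ => le_rfl)
        ((cons hu id.snd.singleton).mono' fun _ _ => le_rfl) id.snd.singleton
    refine (flatMap id.snd.fst h1).mono ⟨4, fun x p => ?_⟩
    have : (p.2.1.map fun b => 0 + (if ok x (p.1, b ∪ p.2.2) then [b ∪ p.2.2, b] else [b]).length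
        + 1).sum ≤ (p.2.1.map fun _ => 3).sum :=
      List.sum_le_sum fun b _ => by split <;> simp
    simp only [List.map_const', List.sum_replicate, smul_eq_mul] at this
    simp only [Polynomial.eval_ofNat]
    omega
  refine (foldl (fun x a _ => (numSets fun W => ok x (a, W)) + 1) empty.singleton singles hF
    ?_).mono ⟨2 * Polynomial.X, fun x a => ?_⟩
  · intro x a l₁ b l₂ h
    exact length_enum_prefix (hdown x a) l₁ _ h
  · simp [length_singles]
    nlinarith

theorem largest {l : ∀ x, A.C x → List (Finset (Fin x.n))} (hl : Comp A (.list .set) l c) :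
    Comp A .set (fun x a => largest (l x a)) fun x a => c x a + (l x a).length := by
  have h : PComp (A.prod (Ty.set.prod .set)) .bool fun x p => decide (p.2.1.card ≤ p.2.2.card) :=
    (card_le 1 1 id.snd.fst id.snd.snd).congr fun x a => by simp
  have hF : PComp (A.prod (Ty.set.prod .set)) .set
      fun x p => if decide (p.2.1.card ≤ p.2.2.card) then p.2.2 else p.2.1 :=
    ite_poly h id.snd.snd id.snd.fst
  exact (foldl (S := .set) (B := .set)
    (F := fun x p => if decide (p.2.1.card ≤ p.2.2.card) then p.2.2 else p.2.1)
    (fun _ _ _ => 0) empty hl hF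
    (fun _ _ _ _ _ _ => le_rfl)).mono' fun x a => by simp

variable {f g : ∀ x, A.C x → Finset (Fin x.n)}

open Classical in
theorem memTest {P : GraphClass} (hP : P.PolyTimeRecognizable) (hf : PComp A .set f) :
    PComp A .bool fun x a => decide (P.Mem (_root_.inducedOn x.G (f x a))) := by
  obtain ⟨R, p, h⟩ := hP
  refine (inducedOn hf).post_poly R p fun x a => ?_
  obtain ⟨t, ht, hr⟩ := h _ (_root_.inducedOn x.G (f x a))
  exact ⟨t, ht.trans (eval_mono p (by simpa using Finset.card_le_univ (f x a))), hr⟩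

open Classical in
/-- The gluing test, guarded by a test whether the distinguished set is a clique. -/
theorem yesTest {T : Prog} {p : Polynomial ℕ}
    (hT : T.AnswersWithin p)
    (hf : PComp A .set f) (hg : PComp A .set g) :
    PComp A .bool fun x a => decide (x.G.IsClique (f x a) ∧
      T.AnswersYes (_root_.inducedOn x.G (g x a ∪ f x a))
        (_root_.setOn (f x a) (g x a ∪ f x a))) := by
  let B : Ty := ⟨fun x => Finset (Fin x.n) × Finset (Fin x.n), fun x p =>
    encGraphSet (_root_.inducedOn x.G p.2) (_root_.setOn p.1 p.2)⟩
  have h1 : PComp A B fun x a => (f x a, g x a ∪ f x a) :=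
    ((inducedOn (union hg hf)).pair (setOn hf (union hg hf))).recode fun x a => rfl
  -- `T` is only known to halt on cliques, so it is run inside the branch guarded by the clique
  -- test.
  have h2 : PComp (A.sub fun x a => decide (x.G.IsClique (f x a)) = true) .bool
      fun x a => decide (T.AnswersYes (_root_.inducedOn x.G (g x a.1 ∪ f x a.1))
        (_root_.setOn (f x a.1) (g x a.1 ∪ f x a.1))) := by
    refine (h1.restrict _).post_poly T p fun x a => ?_
    have hc : (_root_.inducedOn x.G (g x a.1 ∪ f x a.1)).IsClique
        (_root_.setOn (f x a.1) (g x a.1 ∪ f x a.1) : Finset _) := by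
      intro i hi j hj hij
      have h := of_decide_eq_true a.2
      refine h ?_ ?_ ?_
      · simpa [_root_.setOn] using hi
      · simpa [_root_.setOn] using hj
      · exact fun h => hij ((Finset.orderEmbOfFin _ _).injective h)
    obtain ⟨t, b, ht, hr⟩ := hT _ _ _ hc
    have hb : b = decide (T.AnswersYes (_root_.inducedOn x.G (g x a.1 ∪ f x a.1))
        (_root_.setOn (f x a.1) (g x a.1 ∪ f x a.1))) := by
      cases b with
      | true => exact (decide_eq_true ⟨t, hr⟩).symm
      | false =>
        refine (decide_eq_false ?_).symm
        rintro ⟨t', hr'⟩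
        exact absurd (hr.unique hr').1 (by simp [encBool])
    refine ⟨t, ht.trans (eval_mono p (by simpa using Finset.card_le_univ (g x a.1 ∪ f x a.1))), ?_⟩
    rw [hb] at hr
    exact hr
  refine ((ite_sub (isClique hf) (f := fun x a => decide (T.AnswersYes
    (_root_.inducedOn x.G (g x a ∪ f x a)) (_root_.setOn (f x a) (g x a ∪ f x a))))
    (g := fun _ _ => false) (c₂ := fun _ _ => 0) (c₃ := fun _ _ => 0) h2
    ((ff (A := A)).restrict fun x a => decide (x.G.IsClique (f x a)) = false)).congr
    fun x a => ?_).mono' fun x a => by simp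
  by_cases h : x.G.IsClique (f x a) <;> simp [h]

end Comp

/-! ### The algorithm -/

section algorithm

/-- The sets whose size is at most the fraction `1 / c` of the number of vertices. -/
def small (c : ℕ) {n : ℕ} (W : Finset (Fin n)) : Bool := decide (c * W.card ≤ n)

/-- Closed neighbourhoods. -/
noncomputable def cnb {n : ℕ} (G : SimpleGraph (Fin n)) (W : Finset (Fin n)) : Finset (Fin n) :=
  W ∪ nb G W

variable (P : GraphClass) (T : Prog) (a D r z q b : ℕ) (x : Inp)

open Classical in
/-- The membership test for induced subgraphs. -/
noncomputable def inClass (W : Finset (Fin x.n)) : Bool := decide (P.Mem (inducedOn x.G W))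

open Classical in
/-- The clique test. -/
noncomputable def isCl (S : Finset (Fin x.n)) : Bool := decide (x.G.IsClique S)

open Classical in
/-- The gluing test. -/
noncomputable def yes (S X : Finset (Fin x.n)) : Bool :=
  decide (x.G.IsClique S ∧ T.AnswersYes (inducedOn x.G (X ∪ S)) (setOn S (X ∪ S)))

/-- At most one clique, of size about `n / a`. -/
noncomputable def largeCliques : List (Finset (Fin x.n)) :=
  ((enumSets (small a)).filter fun K => isCl x K && !decide (a * (K.card + 1) ≤ x.n)).take 1

/-- A minimal forbidden subset of a set that is not in the class. -/
noncomputable def minForbidden (W : Finset (Fin x.n)) : Finset (Fin x.n) :=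
  (singles x.n).foldl (fun W v => if inClass P x (W \ v) then W else W \ v) W

/-- Branching on a minimal forbidden subset `Q` of `W`, for a set `U` of undecided vertices. -/
noncomputable def hitBranches (Q W U : Finset (Fin x.n)) :
    List (Finset (Fin x.n) × Finset (Fin x.n)) :=
  ((singles x.n).foldl (fun s v => if decide (v ⊆ Q ∩ U) then
    (s.1 \ v, (W \ v, s.1 \ v) :: s.2) else s) (U, [])).2

/-- One step of the search for the maximal members of the class between `W \ U` and `W`. -/
noncomputable def hitStep (p : Finset (Fin x.n) × Finset (Fin x.n)) :
    List (Finset (Fin x.n) × Finset (Fin x.n)) :=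
  if inClass P x p.1 then [p] else hitBranches x (minForbidden P x p.1) p.1 p.2

/-- The search for the maximal members of the class between `W \ U` and `W`. -/
noncomputable def hitSearch (p : Finset (Fin x.n) × Finset (Fin x.n)) :
    List (Finset (Fin x.n) × Finset (Fin x.n)) :=
  (singles x.n).foldl (fun L _ => L.flatMap (hitStep P x)) [p]

/-- Candidates in the presence of a large clique. -/
noncomputable def cliqueCands : List (Finset (Fin x.n)) :=
  (largeCliques a x).flatMap fun K => (enumSets fun Y => decide (Y ⊆ Finset.univ \ K)).flatMap
    fun Y => (hitSearch P x (Y ∪ K, K)).map fun p => p.1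

/-- One step of the choice of a set `Y` of vertices with many private neighbours outside `S`; the
set `C` collects the vertices that are not eligible. -/
noncomputable def coverStep (S : Finset (Fin x.n)) (p : Finset (Fin x.n) × Finset (Fin x.n))
    (v : Finset (Fin x.n)) : List (Finset (Fin x.n) × Finset (Fin x.n)) :=
  if decide (v ⊆ S) then [p] else
    if decide (D * v.card ≤ (nb x.G v \ (S ∪ cnb x.G p.1)).card) then [(p.1 ∪ v, p.2), p]
    else [(p.1, p.2 ∪ v)]

/-- All choices of a set of vertices with many private neighbours outside `S`. -/
noncomputable def coverStates (S : Finset (Fin x.n)) : List (Finset (Fin x.n) × Finset (Fin x.n)) :=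
  (singles x.n).foldl (fun L v => L.flatMap fun p => coverStep D x S p v) [(∅, ∅)]

/-- The vertices that are neither eligible nor dominated. -/
noncomputable def rest (p : Finset (Fin x.n) × Finset (Fin x.n)) : Finset (Fin x.n) :=
  p.2 \ cnb x.G p.1

/-- The sets whose deletion from `C` leaves few undominated vertices. -/
noncomputable def fewUndominated (S : Finset (Fin x.n)) (p : Finset (Fin x.n) × Finset (Fin x.n))
    (E : Finset (Fin x.n)) : Bool :=
  decide (E ⊆ p.2) && decide ((rest x p \ cnb x.G (p.1 ∪ (p.2 \ E))).card ≤ D * S.card)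

/-- Candidates that almost dominate many vertices of small degree. -/
noncomputable def dominatingCands : List (Finset (Fin x.n)) :=
  ((enumSets (small a)).filter (isCl x)).flatMap fun S => (coverStates D x S).flatMap fun p =>
    if small r (rest x p) then [] else
      (enumSets (fewUndominated D x S p)).map fun E => S ∪ (p.1 ∪ (p.2 \ E))

/-- The vertices that are forced to the side of `Z₁`. -/
noncomputable def side (S Z₁ Z₂ : Finset (Fin x.n)) : Finset (Fin x.n) :=
  cnb x.G Z₁ \ (cnb x.G Z₂ ∪ S)

/-- No edge joins the two sets. -/
noncomputable def apart (A₁ A₂ : Finset (Fin x.n)) : Bool := decide (nb x.G A₁ ∩ A₂ = ∅)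

/-- The vertices of `A₁` that are possible when `Q` meets the solution in `U`. -/
noncomputable def core (A₁ A₂ Q U : Finset (Fin x.n)) : Finset (Fin x.n) :=
  ((A₁ \ Q) ∪ (U ∩ A₁)) \ nb x.G (U ∩ A₂)

/-- The best extension of `S` to one side. -/
noncomputable def bestYes (S C : Finset (Fin x.n)) : Finset (Fin x.n) :=
  largest ((enumSets fun X => decide (X ⊆ C)).filter (yes T x S))

/-- Candidates for two sides between which there are few edges. -/
noncomputable def splitCands (S A₁ A₂ Q U : Finset (Fin x.n)) : List (Finset (Fin x.n)) :=
  if apart x (core x A₁ A₂ Q U) (core x A₂ A₁ Q U) &&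
    (decide (x.n ≤ b * (core x A₁ A₂ Q U).card) && decide (x.n ≤ b * (core x A₂ A₁ Q U).card)) then
    [S ∪ (bestYes T x S (core x A₁ A₂ Q U) ∪ bestYes T x S (core x A₂ A₁ Q U))] else []

/-- The small sets that cover all edges between two sides. -/
noncomputable def covers (A₁ A₂ : Finset (Fin x.n)) : List (Finset (Fin x.n)) :=
  (enumSets (small q)).filter fun Q => apart x (A₁ \ Q) (A₂ \ Q)

/-- Sets that are split into two parts without edges in between. -/
noncomputable def splits (A₁ A₂ W : Finset (Fin x.n)) : Bool :=
  decide (W ⊆ A₁ ∪ A₂) && apart x (W ∩ A₁) (W ∩ A₂)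

/-- Candidates for two given sides. -/
noncomputable def sideCands (S A₁ A₂ : Finset (Fin x.n)) : List (Finset (Fin x.n)) :=
  if (covers q x A₁ A₂).isEmpty then (enumSets (splits x A₁ A₂)).map fun W => S ∪ W
  else (covers q x A₁ A₂).flatMap fun Q => (enumSets (small q)).flatMap fun U =>
    splitCands T b x S A₁ A₂ Q U

/-- Candidates whose sides are determined by few vertices. -/
noncomputable def separatedCands : List (Finset (Fin x.n)) :=
  ((enumSets (small a)).filter (isCl x)).flatMap fun S => (enumSets (small z)).flatMap fun Z₁ =>
    (enumSets (small z)).flatMap fun Z₂ =>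
      sideCands T q b x S (side x S Z₁ Z₂) (side x S Z₂ Z₁)

/-- All candidates. -/
noncomputable def allCands (d : ℕ) : List (Finset (Fin x.n)) :=
  enumSets (small d) ++ (cliqueCands P a x ++
    (dominatingCands a D r x ++ separatedCands T a z q b x))

/-- The result of the algorithm. -/
noncomputable def result (d : ℕ) : Finset (Fin x.n) :=
  largest ((allCands P T a D r z q b x d).filter (inClass P x))

end algorithm

theorem small_down (c : ℕ) {n : ℕ} (W W' : Finset (Fin n)) (h : W ⊆ W') (h' : small c W' = true) :
    small c W = true := by
  simp only [small, decide_eq_true_eq] at *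
  exact (Nat.mul_le_mul_left c (Finset.card_le_card h)).trans h'

theorem subset_down {n : ℕ} (C W W' : Finset (Fin n)) (h : W ⊆ W') (h' : decide (W' ⊆ C) = true) :
    decide (W ⊆ C) = true := by
  simp only [decide_eq_true_eq] at *
  exact h.trans h'

theorem nb_mono {n : ℕ} (G : SimpleGraph (Fin n)) {W W' : Finset (Fin n)} (h : W ⊆ W') :
    nb G W ⊆ nb G W' := fun v hv => by
  rw [mem_nb] at *
  obtain ⟨w, hw, hvw⟩ := hv
  exact ⟨w, h hw, hvw⟩

theorem cnb_mono {n : ℕ} (G : SimpleGraph (Fin n)) {W W' : Finset (Fin n)} (h : W ⊆ W') :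
    cnb G W ⊆ cnb G W' := Finset.union_subset_union h (nb_mono G h)

/-- Deleting less from `p.2` leaves a larger dominating set. The family is stated in terms of the
deleted set because `enumSets` needs closure under subsets. -/
theorem fewUndominated_down (D : ℕ) (x : Inp) (S : Finset (Fin x.n)) (p) (W W' : Finset (Fin x.n))
    (h : W ⊆ W') (h' : fewUndominated D x S p W' = true) : fewUndominated D x S p W = true := by
  simp only [fewUndominated, Bool.and_eq_true, decide_eq_true_eq] at *
  refine ⟨h.trans h'.1, (Finset.card_le_card ?_).trans h'.2⟩
  exact Finset.sdiff_subset_sdiff subset_rfl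
    (cnb_mono _ (Finset.union_subset_union subset_rfl (Finset.sdiff_subset_sdiff subset_rfl h)))

theorem apart_iff {x : Inp} {A₁ A₂ : Finset (Fin x.n)} :
    apart x A₁ A₂ = true ↔ ∀ u ∈ A₁, ∀ v ∈ A₂, ¬ x.G.Adj u v := by
  simp only [apart, decide_eq_true_eq, Finset.eq_empty_iff_forall_notMem, Finset.mem_inter, mem_nb]
  constructor
  · exact fun h u hu v hv huv => h v ⟨⟨u, hu, huv.symm⟩, hv⟩
  · rintro h v ⟨⟨u, hu, huv⟩, hv⟩
    exact h u hu v hv huv.symm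

theorem splits_down (x : Inp) (A₁ A₂ W W' : Finset (Fin x.n))
    (h : W ⊆ W') (h' : splits x A₁ A₂ W' = true) : splits x A₁ A₂ W = true := by
  simp only [splits, Bool.and_eq_true, decide_eq_true_eq, apart_iff] at *
  refine ⟨h.trans h'.1, fun u hu v hv => h'.2 u ?_ v ?_⟩
  · exact Finset.inter_subset_inter h subset_rfl hu
  · exact Finset.inter_subset_inter h subset_rfl hv

/-! ### The algorithm as a program -/

/-- The list-valued function `f` is computed in a number of steps that is at most `c` up to a
polynomial factor, and the same bound holds for the length of the result. -/
def LComp (A B : Ty) (f : ∀ x, A.C x → List (B.C x)) (c : ∀ x, A.C x → ℕ) : Prop :=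
  Comp A (.list B) f c ∧
    ∃ r : Polynomial ℕ, ∀ x a, (f x a).length ≤ r.eval x.n * (c x a + 1)

namespace LComp

variable {A B B' : Ty} {f g : ∀ x, A.C x → List (B.C x)} {c c₁ c₂ c₃ : ∀ x, A.C x → ℕ}

theorem mono (h : LComp A B f c) {c' : ∀ x, A.C x → ℕ} (hc : ∀ x a, c x a ≤ c' x a) :
    LComp A B f c' := by
  obtain ⟨h, r, hr⟩ := h
  refine ⟨h.mono' hc, r, fun x a => (hr x a).trans ?_⟩
  gcongr
  exact hc x a

theorem of_length_le (h : Comp A (.list B) f c) (hl : ∀ x a, (f x a).length ≤ c x a + 1) :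
    LComp A B f c := ⟨h, 1, by simpa using hl⟩

theorem map {F : ∀ x, (A.prod B).C x → B'.C x} (hf : LComp A B f c) (hF : PComp (A.prod B) B' F) :
    LComp A B' (fun x a => (f x a).map fun b => F x (a, b)) c := by
  obtain ⟨h, r, hr⟩ := hf
  refine ⟨(Comp.map h hF).mono ⟨r + 1, fun x a => ?_⟩, r, fun x a => by simpa using hr x a⟩
  have := hr x a
  simp
  nlinarith

theorem filter {F : ∀ x, (A.prod B).C x → Bool} (hf : LComp A B f c)
    (hF : PComp (A.prod B) .bool F) :
    LComp A B (fun x a => (f x a).filter fun b => F x (a, b)) c := by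
  obtain ⟨h, r, hr⟩ := hf
  refine ⟨(Comp.filter h hF).mono ⟨r + 1, fun x a => ?_⟩, r, fun x a =>
    (List.length_filter_le _ _).trans (hr x a)⟩
  have := hr x a
  simp
  nlinarith

theorem append (hf : LComp A B f c₁) (hg : LComp A B g c₂) :
    LComp A B (fun x a => f x a ++ g x a) fun x a => c₁ x a + c₂ x a := by
  obtain ⟨h, r, hr⟩ := hf
  obtain ⟨h', r', hr'⟩ := hg
  refine ⟨(Comp.append h h').mono ⟨r + 1, fun x a => ?_⟩, r + r', fun x a => ?_⟩
  · have := hr x a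
    simp
    nlinarith [Nat.zero_le (r.eval x.n * c₂ x a)]
  · have := hr x a
    have := hr' x a
    simp
    nlinarith [Nat.zero_le (r.eval x.n * c₂ x a), Nat.zero_le (r'.eval x.n * c₁ x a)]

theorem take_one (hf : LComp A B f c) : LComp A B (fun x a => (f x a).take 1) c :=
  of_length_le hf.1.take_one fun x a => (List.length_take_le _ _).trans (by simp)

theorem nil : LComp A B (fun _ _ => []) fun _ _ => 0 := of_length_le Comp.nil (by simp)

theorem ite {t : ∀ x, A.C x → Bool} (ht : Comp A .bool t c₁) (hf : LComp A B f c₂)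
    (hg : LComp A B g c₃) : LComp A B (fun x a => if t x a then f x a else g x a)
      fun x a => c₁ x a + if t x a then c₂ x a else c₃ x a := by
  obtain ⟨h, r, hr⟩ := hf
  obtain ⟨h', r', hr'⟩ := hg
  refine ⟨Comp.ite ht h h', r + r', fun x a => ?_⟩
  simp only [Polynomial.eval_add]
  split
  · have := hr x a
    nlinarith [Nat.zero_le (r.eval x.n * c₁ x a), Nat.zero_le (r'.eval x.n * (c₁ x a + c₂ x a + 1))]
  · have := hr' x a
    nlinarith [Nat.zero_le (r'.eval x.n * c₁ x a), Nat.zero_le (r.eval x.n * (c₁ x a + c₃ x a + 1))]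

/-- The inner costs are added up rather than replaced by a maximum; `dominatingCands` depends on
this. -/
theorem flatMap {F : ∀ x, (A.prod B).C x → List (B'.C x)} {cF : ∀ x, (A.prod B).C x → ℕ}
    (hf : LComp A B f c) (hF : LComp (A.prod B) B' F cF) :
    LComp A B' (fun x a => (f x a).flatMap fun b => F x (a, b))
      fun x a => c x a + ((f x a).map fun b => cF x (a, b)).sum := by
  obtain ⟨h, r, hr⟩ := hf
  obtain ⟨h', r', hr'⟩ := hF
  have h1 : ∀ x a, ((f x a).map fun b => (F x (a, b)).length).sum ≤
      r'.eval x.n * (((f x a).map fun b => cF x (a, b)).sum + (f x a).length) := fun x a => by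
    have h2 : ((f x a).map fun b => (F x (a, b)).length).sum ≤
        ((f x a).map fun b => r'.eval x.n * (cF x (a, b) + 1)).sum :=
      List.sum_le_sum fun b _ => hr' x (a, b)
    rw [List.sum_map_mul_left] at h2
    simpa using h2
  have h3 : ∀ x a, (f x a).length ≤ (r.eval x.n) * (c x a + 1) := hr
  refine ⟨(Comp.flatMap h h').mono ⟨1 + r + r' + r' * r, fun x a => ?_⟩, r' + r' * r,
    fun x a => ?_⟩
  · have h1 := h1 x a
    have h3 := h3 x a
    simp only [Polynomial.eval_add, Polynomial.eval_mul, Polynomial.eval_one, List.sum_map_add,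
      List.map_const', List.sum_replicate, smul_eq_mul, mul_one] at *
    generalize ((f x a).map fun b => cF x (a, b)).sum = σ at *
    generalize ((f x a).map fun b => (F x (a, b)).length).sum = σ' at *
    generalize (f x a).length = l at *
    generalize r.eval x.n = R at *
    generalize r'.eval x.n = R' at *
    have h4 : R' * l ≤ R' * (R * (c x a + 1)) := Nat.mul_le_mul_left _ h3
    nlinarith [Nat.zero_le (R * σ), Nat.zero_le (R' * c x a), Nat.zero_le (R' * R * σ)]
  · have h1 := h1 x a
    have h3 := h3 x a
    rw [List.length_flatMap]
    simp only [Polynomial.eval_add, Polynomial.eval_mul] at *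
    generalize ((f x a).map fun b => cF x (a, b)).sum = σ at *
    generalize ((f x a).map fun b => (F x (a, b)).length).sum = σ' at *
    generalize (f x a).length = l at *
    generalize r.eval x.n = R at *
    generalize r'.eval x.n = R' at *
    have h4 : R' * l ≤ R' * (R * (c x a + 1)) := Nat.mul_le_mul_left _ h3
    nlinarith [Nat.zero_le (R' * c x a), Nat.zero_le (R' * R * σ)]

/-- The coarser product bound, for nested guesses whose inner cost is bounded uniformly. -/
theorem flatMap_le {F : ∀ x, (A.prod B).C x → List (B'.C x)} {cF : ∀ x, (A.prod B).C x → ℕ}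
    (hf : LComp A B f c) (hF : LComp (A.prod B) B' F cF) {M : ∀ x, A.C x → ℕ}
    (hM : ∀ x a, ∀ b ∈ f x a, cF x (a, b) ≤ M x a) :
    LComp A B' (fun x a => (f x a).flatMap fun b => F x (a, b))
      fun x a => (c x a + 1) * (M x a + 1) := by
  obtain ⟨h, r', hr'⟩ := flatMap hf hF
  obtain ⟨_, r, hr⟩ := hf
  have key : ∀ x a, c x a + ((f x a).map fun b => cF x (a, b)).sum + 1 ≤
      (r.eval x.n + 1) * ((c x a + 1) * (M x a + 1) + 1) := fun x a => by
    have h1 : ((f x a).map fun b => cF x (a, b)).sum ≤ (f x a).length * M x a := by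
      have := List.sum_le_card_nsmul ((f x a).map fun b => cF x (a, b)) (M x a) (by
        intro m hm
        obtain ⟨b, hb, rfl⟩ := List.mem_map.1 hm
        exact hM x a b hb)
      simpa using this
    have h2 := Nat.mul_le_mul_right (M x a) (hr x a)
    nlinarith [Nat.zero_le (r.eval x.n * (c x a + 1)), Nat.zero_le ((c x a + 1) * M x a)]
  refine ⟨h.mono ⟨r + 1, fun x a => ?_⟩, r' * (r + 1), fun x a => ?_⟩
  · simpa using (Nat.le_succ _).trans (key x a)
  · refine (hr' x a).trans ?_
    simpa [mul_assoc] using Nat.mul_le_mul_left (r'.eval x.n) (key x a)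

theorem enumSets {ok : ∀ x, (A.prod .set).C x → Bool} (hok : PComp (A.prod .set) .bool ok)
    (hdown : ∀ x a W W', W ⊆ W' → ok x (a, W') = true → ok x (a, W) = true) :
    LComp A .set (fun x a => enumSets fun W => ok x (a, W))
      fun x a => numSets fun W => ok x (a, W) :=
  of_length_le (Comp.enumSets hok hdown) fun x a => length_enumSets (hdown x a)

/-- Iterated branching, given a bound for the size of all levels of the search tree. -/
theorem rounds {s₀ : ∀ x, A.C x → List (B.C x)}
    {F : ∀ x, ((A.prod .set).prod B).C x → List (B.C x)} {M : ∀ x, A.C x → ℕ}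
    (hs : PComp A (.list B) s₀) (hF : LComp ((A.prod .set).prod B) B F fun _ _ => 0)
    (hM : ∀ x a l₁ l₂, singles x.n = l₁ ++ l₂ →
      (l₁.foldl (fun L v => L.flatMap fun p => F x ((a, v), p)) (s₀ x a)).length ≤ M x a) :
    LComp A B (fun x a => (singles x.n).foldl (fun L v => L.flatMap fun p => F x ((a, v), p))
      (s₀ x a)) M := by
  refine ⟨?_, 1, fun x a => ?_⟩
  · have hstep : Comp (A.prod ((Ty.list B).prod .set)) (.list B)
        (fun x p => p.2.1.flatMap fun b => F x ((p.1, p.2.2), b)) fun x p => p.2.1.length := by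
      have hl : LComp (A.prod ((Ty.list B).prod .set)) B (fun x p => p.2.1)
          fun x p => p.2.1.length :=
        of_length_le (Comp.id.snd.fst.mono' fun _ _ => Nat.zero_le _) fun _ _ => Nat.le_succ _
      have hF' : LComp ((A.prod ((Ty.list B).prod .set)).prod B) B
          (fun x p => F x ((p.1.1, p.1.2.2), p.2)) fun _ _ => 0 := by
        obtain ⟨h, r, hr⟩ := hF
        refine ⟨(h.comp (Comp.pair (Comp.pair (A := (A.prod ((Ty.list B).prod .set)).prod B)
          Comp.id.fst.fst Comp.id.fst.snd.snd) Comp.id.snd)).mono' fun _ _ => le_rfl, r,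
          fun x p => hr x _⟩
      exact (flatMap hl hF').1.mono' fun x p => by simp
    refine (Comp.foldl (fun x a _ => M x a) hs Comp.singles hstep ?_).mono
      ⟨Polynomial.X, fun x a => ?_⟩
    · intro x a l₁ v l₂ h
      exact hM x a l₁ _ h
    · simp [length_singles]
  · have := hM x a (singles x.n) [] (by simp)
    simp
    omega

end LComp

namespace Comp

variable {A : Ty} {f g : ∀ x, A.C x → Finset (Fin x.n)} (P : GraphClass) (T : Prog)
  (a D r z q b : ℕ)

theorem lift {B C : Ty} {f : ∀ x, A.C x → C.C x} (hf : PComp A C f) :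
    PComp (A.prod B) C fun x p => f x p.1 :=
  (hf.comp id.fst).mono' fun _ _ => le_rfl

theorem small (hf : PComp A .set f) : PComp A .bool fun x p => small a (f x p) :=
  (card_le a 1 hf univ).congr fun x p => by simp [_root_.small]

theorem cnb (hf : PComp A .set f) : PComp A .set fun x p => cnb x.G (f x p) :=
  union hf (nb hf)

theorem inClass {P : GraphClass} (hP : P.PolyTimeRecognizable) (hf : PComp A .set f) :
    PComp A .bool fun x p => inClass P x (f x p) := memTest hP hf

theorem isCl (hf : PComp A .set f) : PComp A .bool fun x p => isCl x (f x p) := isClique hf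

theorem apart (hf : PComp A .set f) (hg : PComp A .set g) :
    PComp A .bool fun x p => apart x (f x p) (g x p) := isEmpty_set (inter (nb hf) hg)

theorem minForbidden {P : GraphClass} (hP : P.PolyTimeRecognizable) (hf : PComp A .set f) :
    PComp A .set fun x p => minForbidden P x (f x p) := by
  have h1 : PComp (A.prod (Ty.set.prod .set)) .set fun x p => p.2.1 \ p.2.2 :=
    sdiff id.snd.fst id.snd.snd
  have hF : PComp (A.prod (Ty.set.prod .set)) .set fun x p =>
      if _root_.inClass P x (p.2.1 \ p.2.2) then p.2.1 else p.2.1 \ p.2.2 :=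
    ite_poly (inClass hP h1) id.snd.fst h1
  exact foldl_poly hf singles hF Polynomial.X (by simp [length_singles])

theorem hitBranches {Q W U : ∀ x, A.C x → Finset (Fin x.n)} (hQ : PComp A .set Q)
    (hW : PComp A .set W) (hU : PComp A .set U) :
    PComp A (.list (Ty.set.prod .set)) fun x p => hitBranches x (Q x p) (W x p) (U x p) := by
  have h0 : PComp A (Ty.set.prod (.list (Ty.set.prod .set))) fun x p => (U x p, []) :=
    (hU.pair nil).mono' fun _ _ => le_rfl
  have h1 : PComp (A.prod ((Ty.set.prod (.list (Ty.set.prod .set))).prod .set)) .set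
    fun x p => p.2.1.1 \ p.2.2 := sdiff id.snd.fst.fst id.snd.snd
  have hF : PComp (A.prod ((Ty.set.prod (.list (Ty.set.prod .set))).prod .set))
      (Ty.set.prod (.list (Ty.set.prod .set))) fun x p =>
      if decide (p.2.2 ⊆ Q x p.1 ∩ U x p.1) then
        (p.2.1.1 \ p.2.2, (W x p.1 \ p.2.2, p.2.1.1 \ p.2.2) :: p.2.1.2) else p.2.1 :=
    ite_poly (subset id.snd.snd (inter (lift hQ) (lift hU)))
      ((pair h1 (cons (pair (sdiff (lift hW) id.snd.snd) h1) id.snd.fst.snd)).mono'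
        fun _ _ => le_rfl) id.snd.fst
  exact (foldl_poly h0 singles hF Polynomial.X (by simp [length_singles])).snd

theorem rest (p : ∀ x, A.C x → (Ty.set.prod .set).C x) (hp : PComp A (Ty.set.prod .set) p) :
    PComp A .set fun x y => rest x (p x y) := sdiff hp.snd (cnb hp.fst)

theorem core {A₁ A₂ Q U : ∀ x, A.C x → Finset (Fin x.n)} (h₁ : PComp A .set A₁)
    (h₂ : PComp A .set A₂) (hQ : PComp A .set Q) (hU : PComp A .set U) :
    PComp A .set fun x p => core x (A₁ x p) (A₂ x p) (Q x p) (U x p) :=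
  sdiff (union (sdiff h₁ hQ) (inter hU h₁)) (nb (inter hU h₂))

theorem side {S Z₁ Z₂ : ∀ x, A.C x → Finset (Fin x.n)} (hS : PComp A .set S)
    (h₁ : PComp A .set Z₁) (h₂ : PComp A .set Z₂) :
    PComp A .set fun x p => side x (S x p) (Z₁ x p) (Z₂ x p) :=
  sdiff (cnb h₁) (union (cnb h₂) hS)

end Comp

theorem length_hitBranches_le (x : Inp) (Q W U : Finset (Fin x.n)) :
    (hitBranches x Q W U).length ≤ x.n := by
  have : ∀ (l : List (Finset (Fin x.n)))
      (s : Finset (Fin x.n) × List (Finset (Fin x.n) × Finset (Fin x.n))),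
      (l.foldl (fun s v => if decide (v ⊆ Q ∩ U) then
        (s.1 \ v, (W \ v, s.1 \ v) :: s.2) else s) s).2.length ≤ s.2.length + l.length := by
    intro l
    induction l with
    | nil => simp
    | cons v l ih =>
      intro s
      refine (ih _).trans ?_
      dsimp only
      split <;> simp <;> omega
  refine (this (singles x.n) (U, [])).trans ?_
  simp [length_singles]

/-- The total size of the levels of a search tree. -/
def levels {α β : Type*} (F : α → β → List β) (L : List β) (l : List α) : ℕ :=
  (l.inits.map fun l₁ => (l₁.foldl (fun L v => L.flatMap (F v)) L).length).sum

theorem length_le_levels {α β : Type*} (F : α → β → List β) (L : List β) {l l₁ l₂ : List α}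
    (h : l = l₁ ++ l₂) : (l₁.foldl (fun L v => L.flatMap (F v)) L).length ≤ levels F L l := by
  refine List.single_le_sum (by simp) _ (List.mem_map.2 ⟨l₁, ?_, rfl⟩)
  rw [List.mem_inits]
  exact ⟨l₂, h.symm⟩

theorem levels_le {α β : Type*} (F : α → β → List β) (L : List β) {l : List α} {M : ℕ}
    (h : ∀ l₁ l₂, l = l₁ ++ l₂ → (l₁.foldl (fun L v => L.flatMap (F v)) L).length ≤ M) :
    levels F L l ≤ (l.length + 1) * M := by
  have := List.sum_le_card_nsmul (l.inits.map fun l₁ =>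
    (l₁.foldl (fun L v => L.flatMap (F v)) L).length) M (by
      intro m hm
      obtain ⟨l₁, hl₁, rfl⟩ := List.mem_map.1 hm
      rw [List.mem_inits] at hl₁
      obtain ⟨l₂, h'⟩ := hl₁
      exact h l₁ l₂ h'.symm)
  simpa [levels] using this

namespace LComp

variable {A : Ty} {P : GraphClass} {T : Prog} {a D r z q b : ℕ}

theorem small : LComp A .set (fun x _ => _root_.enumSets (_root_.small a (n := x.n)))
    fun x _ => numSets (_root_.small a (n := x.n)) :=
  enumSets (ok := fun _ p => _root_.small a p.2) (Comp.small a Comp.id.snd)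
    fun _ _ => small_down a

theorem below {f : ∀ x, A.C x → Finset (Fin x.n)} (hf : PComp A .set f) :
    LComp A .set (fun x p => _root_.enumSets fun X => decide (X ⊆ f x p))
    fun x p => 2 ^ (f x p).card := by
  refine (enumSets (ok := fun x p => decide (p.2 ⊆ f x p.1)) (Comp.subset Comp.id.snd
    (Comp.lift hf)) fun x p => subset_down (f x p)).mono fun x p => le_of_eq ?_
  rw [numSets, ← Finset.card_powerset]
  congr 1
  ext W
  simp

theorem largeCliques : LComp A .set (fun x _ => largeCliques a x)
    fun x _ => numSets (_root_.small a (n := x.n)) := by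
  have h : PComp (A.prod .set) .bool fun x p =>
      isCl x p.2 && !decide (a * (p.2.card + 1) ≤ x.n) := by
    refine Comp.and (Comp.isCl Comp.id.snd) (Comp.not ?_)
    refine ((Comp.mul_const (Comp.succ (Comp.card (A := A.prod .set) Comp.id.snd))
      (Polynomial.X + 1) ?_ a).le (Comp.card Comp.univ) Polynomial.X ?_).congr ?_
    · intro x p; simpa using Finset.card_le_univ p.2
    · simp
    · simp
  exact (small.filter h).take_one

theorem hitSearch (hP : P.PolyTimeRecognizable) {W U : ∀ x, A.C x → Finset (Fin x.n)}
    (hW : PComp A .set W) (hU : PComp A .set U) :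
    LComp A (Ty.set.prod .set) (fun x p => hitSearch P x (W x p, U x p))
      fun x p => levels (fun _ => hitStep P x) [(W x p, U x p)] (singles x.n) := by
  refine rounds (F := fun x p => hitStep P x p.2)
    ((Comp.singleton (hW.pair hU)).mono' fun _ _ => le_rfl) ⟨?_, ?_⟩
    fun x p l₁ l₂ h => length_le_levels (fun _ => hitStep P x) _ h
  · exact Comp.ite_poly (Comp.inClass hP Comp.id.snd.fst) Comp.id.snd.singleton
      (Comp.hitBranches (Comp.minForbidden hP Comp.id.snd.fst) Comp.id.snd.fst Comp.id.snd.snd)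
  · refine ⟨Polynomial.X + 1, fun x p => ?_⟩
    simp only [hitStep]
    split
    · simp
    · simpa using (length_hitBranches_le _ _ _ _).trans (Nat.le_succ _)

theorem cliqueCands (hP : P.PolyTimeRecognizable) {M : Inp → ℕ}
    (hM : ∀ x, ∀ K ∈ _root_.largeCliques a x, 2 ^ (Finset.univ \ K).card +
      ((_root_.enumSets fun Y => decide (Y ⊆ Finset.univ \ K)).map fun Y =>
        levels (fun _ => hitStep P x) [(Y ∪ K, K)] (singles x.n)).sum ≤ M x) :
    LComp .unit .set (fun x _ => cliqueCands P a x)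
      fun x _ => numSets (_root_.small a (n := x.n)) + M x := by
  have h1 : LComp ((Ty.unit.prod .set).prod .set) .set
      (fun x p => (_root_.hitSearch P x (p.2 ∪ p.1.2, p.1.2)).map fun p => p.1) _ :=
    map (hitSearch hP (Comp.union (A := (Ty.unit.prod .set).prod .set) Comp.id.snd Comp.id.fst.snd)
      Comp.id.fst.snd) Comp.id.snd.fst
  refine (flatMap largeCliques (flatMap (below (A := Ty.unit.prod .set) (Comp.sdiff Comp.univ
    Comp.id.snd)) h1)).mono fun x _ => Nat.add_le_add_left ?_ _
  have hM := hM x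
  -- The list of large cliques was cut to one element, so the inner cost is paid at most once.
  have hl : (_root_.largeCliques a x).length ≤ 1 := List.length_take_le _ _
  generalize _root_.largeCliques a x = l at hM hl
  rcases l with _ | ⟨K, _ | ⟨K', l⟩⟩
  · simp
  · simpa using hM K
  · simp at hl

theorem coverStates {S : ∀ x, A.C x → Finset (Fin x.n)} (hS : PComp A .set S) :
    LComp A (Ty.set.prod .set) (fun x p => coverStates D x (S x p))
      fun x p => levels (fun v p' => coverStep D x (S x p) p' v) [(∅, ∅)] (singles x.n) := by
  refine rounds (F := fun x p => coverStep D x (S x p.1.1) p.2 p.1.2)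
    ((Comp.singleton (Comp.empty.pair Comp.empty)).mono' fun _ _ => le_rfl) ⟨?_, ?_⟩
    fun x p l₁ l₂ h => length_le_levels (fun v p' => coverStep D x (S x p) p' v) _ h
  · have hS' : PComp ((A.prod .set).prod (Ty.set.prod .set)) .set fun x p => S x p.1.1 :=
      Comp.lift (Comp.lift hS)
    have hv : PComp ((A.prod .set).prod (Ty.set.prod .set)) .set fun x p => p.1.2 :=
      Comp.id.fst.snd
    have hc := (Comp.card_le D 1 hv (Comp.sdiff (Comp.nb hv)
      (Comp.union hS' (Comp.cnb Comp.id.snd.fst))))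
    refine Comp.ite_poly (Comp.subset hv hS') Comp.id.snd.singleton (Comp.ite_poly (hc.congr
      fun x p => by simp) (Comp.cons (Comp.pair (Comp.union Comp.id.snd.fst hv) Comp.id.snd.snd)
      Comp.id.snd.singleton |>.mono' fun _ _ => le_rfl)
      (Comp.singleton (Comp.pair Comp.id.snd.fst (Comp.union Comp.id.snd.snd hv)) |>.mono'
      fun _ _ => le_rfl))
  · refine ⟨2, fun x p => ?_⟩
    simp only [coverStep]
    split
    · simp
    · split <;> simp

theorem cliques : LComp A .set (fun x _ => (_root_.enumSets (_root_.small a)).filter (isCl x))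
    fun x _ => numSets (_root_.small a (n := x.n)) :=
  small.filter (Comp.isCl Comp.id.snd)

/-- The enumerations are charged to the sum over all cover states. The number of states times the
largest enumeration would be too much, whereas the weights `2^|p.2|` of all states add up to at most
`2^n`. -/
theorem dominatingCands {M : Inp → ℕ}
    (hM : ∀ x, ∀ S ∈ (_root_.enumSets (_root_.small a)).filter (isCl x),
      levels (fun v p => coverStep D x S p v) [(∅, ∅)] (singles x.n) +
      ((_root_.coverStates D x S).map fun p => if _root_.small r (rest x p) then 0 else
        numSets (fewUndominated D x S p)).sum ≤ M x) :
    LComp .unit .set (fun x _ => dominatingCands a D r x)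
      fun x _ => (numSets (_root_.small a (n := x.n)) + 1) * (M x + 1) := by
  have hrest : PComp ((Ty.unit.prod .set).prod (Ty.set.prod .set)) .set fun x p => rest x p.2 :=
    Comp.rest _ Comp.id.snd
  have hfew : PComp (((Ty.unit.prod .set).prod (Ty.set.prod .set)).prod .set) .bool
      fun x p => fewUndominated D x p.1.1.2 p.1.2 p.2 := by
    have hE : PComp (((Ty.unit.prod .set).prod (Ty.set.prod .set)).prod .set) .set
      fun x p => p.2 := Comp.id.snd
    have hY : PComp (((Ty.unit.prod .set).prod (Ty.set.prod .set)).prod .set) .set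
      fun x p => p.1.2.1 := Comp.id.fst.snd.fst
    have hC : PComp (((Ty.unit.prod .set).prod (Ty.set.prod .set)).prod .set) .set
      fun x p => p.1.2.2 := Comp.id.fst.snd.snd
    have hS : PComp (((Ty.unit.prod .set).prod (Ty.set.prod .set)).prod .set) .set
      fun x p => p.1.1.2 := Comp.id.fst.fst.snd
    refine Comp.and (Comp.subset hE hC) ((Comp.card_le 1 D (Comp.sdiff (Comp.lift hrest)
      (Comp.cnb (Comp.union hY (Comp.sdiff hC hE)))) hS).congr fun x p => by simp)
  have hcand : PComp (((Ty.unit.prod .set).prod (Ty.set.prod .set)).prod .set) .set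
      fun x p => p.1.1.2 ∪ (p.1.2.1 ∪ (p.1.2.2 \ p.2)) :=
    Comp.union Comp.id.fst.fst.snd (Comp.union Comp.id.fst.snd.fst (Comp.sdiff
      Comp.id.fst.snd.snd Comp.id.snd))
  have h1 : LComp ((Ty.unit.prod .set).prod (Ty.set.prod .set)) .set
      (fun x p => (_root_.enumSets (fewUndominated D x p.1.2 p.2)).map
        fun E => p.1.2 ∪ (p.2.1 ∪ (p.2.2 \ E)))
      fun x p => numSets (fewUndominated D x p.1.2 p.2) :=
    map (enumSets hfew fun x p => fewUndominated_down D x p.1.2 p.2) hcand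
  have h2 := (ite (Comp.small r hrest) nil h1).mono
    (c' := fun x p => if _root_.small r (rest x p.2) then 0 else
        numSets (fewUndominated D x p.1.2 p.2)) fun x p => by simp
  exact flatMap_le cliques (flatMap (coverStates (A := Ty.unit.prod .set) Comp.id.snd) h2)
    (M := fun x _ => M x) fun x _ S hS => hM x S hS

theorem _root_.Comp.bestYes {p : Polynomial ℕ} (hT : T.AnswersWithin p)
    {S C : ∀ x, A.C x → Finset (Fin x.n)} (hS : PComp A .set S)
    (hC : PComp A .set C) :
    Comp A .set (fun x p => bestYes T x (S x p) (C x p)) fun x p => 2 ^ (C x p).card := by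
  have hyes : PComp (A.prod .set) .bool fun x p => yes T x (S x p.1) p.2 :=
    Comp.yesTest hT (Comp.lift hS) Comp.id.snd
  have hl : LComp A .set (fun x p => (_root_.enumSets fun X => decide (X ⊆ C x p)).filter
      (yes T x (S x p))) fun x p => 2 ^ (C x p).card :=
    filter (below hC) hyes
  obtain ⟨h, r, hr⟩ := hl
  refine h.largest.mono ⟨r + 1, fun x p => ?_⟩
  have := hr x p
  simp only [Polynomial.eval_add, Polynomial.eval_one]
  nlinarith

/-- A wrong guess may produce one huge core, but the size guard is evaluated before the exhaustive
searches; so `hM` is only needed when both cores are large. -/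
theorem splitCands {p : Polynomial ℕ} (hT : T.AnswersWithin p)
    {S A₁ A₂ Q U : ∀ x, A.C x → Finset (Fin x.n)} (hS : PComp A .set S)
    (h₁ : PComp A .set A₁) (h₂ : PComp A .set A₂) (hQ : PComp A .set Q) (hU : PComp A .set U)
    {M : Inp → ℕ} (hM : ∀ x p, x.n ≤ b * (core x (A₁ x p) (A₂ x p) (Q x p) (U x p)).card →
      x.n ≤ b * (core x (A₂ x p) (A₁ x p) (Q x p) (U x p)).card →
      2 ^ (core x (A₁ x p) (A₂ x p) (Q x p) (U x p)).card +
        2 ^ (core x (A₂ x p) (A₁ x p) (Q x p) (U x p)).card ≤ M x) :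
    LComp A .set (fun x p => splitCands T b x (S x p) (A₁ x p) (A₂ x p) (Q x p) (U x p))
      fun x _ => M x := by
  have hc₁ := Comp.core h₁ h₂ hQ hU
  have hc₂ := Comp.core h₂ h₁ hQ hU
  have hu : Comp A .set (fun x p => S x p ∪ (bestYes T x (S x p) (core x (A₁ x p) (A₂ x p)
      (Q x p) (U x p)) ∪ bestYes T x (S x p) (core x (A₂ x p) (A₁ x p) (Q x p) (U x p))))
      fun x p => 2 ^ (core x (A₁ x p) (A₂ x p) (Q x p) (U x p)).card +
        2 ^ (core x (A₂ x p) (A₁ x p) (Q x p) (U x p)).card := by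
    have h := Comp.pair hS ((Comp.bestYes hT hS hc₁).pair (Comp.bestYes hT hS hc₂))
    have hf : PComp (Ty.set.prod (Ty.set.prod .set)) .set fun x p => p.1 ∪ (p.2.1 ∪ p.2.2) :=
      Comp.union Comp.id.fst (Comp.union Comp.id.snd.fst Comp.id.snd.snd)
    exact (hf.comp h).mono' fun x p => by simp
  have hl : ∀ {f : ∀ x, A.C x → Finset (Fin x.n)}, PComp A .set f →
      PComp A .bool fun x p => decide (x.n ≤ b * (f x p).card) := fun hf =>
    (Comp.card_le 1 b Comp.univ hf).congr fun x p => by simp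
  refine (ite (Comp.and (Comp.apart hc₁ hc₂) (Comp.and (hl hc₁) (hl hc₂)))
    (of_length_le hu.singleton fun x p => by simp) nil).mono fun x p => ?_
  split
  · rename_i h
    simp only [Bool.and_eq_true, decide_eq_true_eq] at h
    simpa using hM x p h.2.1 h.2.2
  · simp

theorem sideCands {p : Polynomial ℕ} (hT : T.AnswersWithin p)
    {S A₁ A₂ : ∀ x, A.C x → Finset (Fin x.n)} (hS : PComp A .set S)
    (h₁ : PComp A .set A₁) (h₂ : PComp A .set A₂) {M N : Inp → ℕ}
    (hM : ∀ x p Q U, x.n ≤ b * (core x (A₁ x p) (A₂ x p) Q U).card →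
      x.n ≤ b * (core x (A₂ x p) (A₁ x p) Q U).card →
      2 ^ (core x (A₁ x p) (A₂ x p) Q U).card +
        2 ^ (core x (A₂ x p) (A₁ x p) Q U).card ≤ M x)
    (hN : ∀ x p, covers q x (A₁ x p) (A₂ x p) = [] →
      numSets (splits x (A₁ x p) (A₂ x p)) ≤ N x) :
    LComp A .set (fun x p => sideCands T q b x (S x p) (A₁ x p) (A₂ x p))
      fun x _ => 2 * (numSets (_root_.small q (n := x.n)) + 1) ^ 2 * (M x + 1) + N x := by
  have hS₀ : PComp (A.prod .set) .set fun x p => S x p.1 := Comp.lift hS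
  have h₁₀ : PComp (A.prod .set) .set fun x p => A₁ x p.1 := Comp.lift h₁
  have h₂₀ : PComp (A.prod .set) .set fun x p => A₂ x p.1 := Comp.lift h₂
  have hap : PComp (A.prod .set) .bool fun x p => apart x (A₁ x p.1 \ p.2) (A₂ x p.1 \ p.2) :=
    Comp.apart (Comp.sdiff h₁₀ Comp.id.snd) (Comp.sdiff h₂₀ Comp.id.snd)
  have hcov : LComp A .set (fun x p => covers q x (A₁ x p) (A₂ x p))
      fun x _ => numSets (_root_.small q (n := x.n)) := small.filter hap
  have hsp : PComp (A.prod .set) .bool fun x p => splits x (A₁ x p.1) (A₂ x p.1) p.2 :=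
    Comp.and (Comp.subset Comp.id.snd (Comp.union h₁₀ h₂₀))
      (Comp.apart (Comp.inter Comp.id.snd h₁₀) (Comp.inter Comp.id.snd h₂₀))
  have h3 : LComp A .set (fun x p => (_root_.enumSets (splits x (A₁ x p) (A₂ x p))).map
      fun W => S x p ∪ W) _ :=
    map (enumSets hsp fun x p => splits_down x (A₁ x p) (A₂ x p)) (Comp.union hS₀ Comp.id.snd)
  have hS' : PComp ((A.prod .set).prod .set) .set fun x p => S x p.1.1 := Comp.lift hS₀
  have h₁' : PComp ((A.prod .set).prod .set) .set fun x p => A₁ x p.1.1 :=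
    Comp.lift h₁₀
  have h₂' : PComp ((A.prod .set).prod .set) .set fun x p => A₂ x p.1.1 :=
    Comp.lift h₂₀
  have hQ' : PComp ((A.prod .set).prod .set) .set fun x p => p.1.2 := Comp.id.fst.snd
  have hU' : PComp ((A.prod .set).prod .set) .set fun x p => p.2 := Comp.id.snd
  have h4 : LComp ((A.prod .set).prod .set) .set (fun x p => _root_.splitCands T b x (S x p.1.1)
      (A₁ x p.1.1) (A₂ x p.1.1) p.1.2 p.2) fun x _ => M x :=
    splitCands hT hS' h₁' h₂' hQ' hU' fun x p => hM x p.1.1 p.1.2 p.2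
  have h5 : LComp (A.prod .set) .set (fun x p => (_root_.enumSets (_root_.small q)).flatMap
      fun U => _root_.splitCands T b x (S x p.1) (A₁ x p.1) (A₂ x p.1) p.2 U)
      fun x _ => (numSets (_root_.small q (n := x.n)) + 1) * (M x + 1) :=
    flatMap_le small h4 (M := fun x _ => M x) fun _ _ _ _ => le_rfl
  have h6 := flatMap_le hcov h5 (M := fun x _ => (numSets (_root_.small q (n := x.n)) + 1) *
    (M x + 1)) fun _ _ _ _ => le_rfl
  -- The factor 2 in the bound absorbs the cost of listing the covers and the additive terms of
  -- `flatMap_le`.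
  refine (ite hcov.1.isEmpty h3 h6).mono fun x p => ?_
  generalize hσ : numSets (_root_.small q (n := x.n)) = σ
  split
  · rename_i h
    have := hN x p (by simpa using h)
    nlinarith [Nat.zero_le (σ ^ 2), Nat.zero_le ((σ + 1) ^ 2 * M x)]
  · nlinarith [Nat.zero_le (σ ^ 2), Nat.zero_le ((σ + 1) ^ 2 * M x), Nat.zero_le (N x)]

theorem separatedCands {p : Polynomial ℕ} (hT : T.AnswersWithin p)
    {M N : Inp → ℕ}
    (hM : ∀ x S Z₁ Z₂ Q U, x.n ≤ b * (core x (side x S Z₁ Z₂) (side x S Z₂ Z₁) Q U).card →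
      x.n ≤ b * (core x (side x S Z₂ Z₁) (side x S Z₁ Z₂) Q U).card →
      2 ^ (core x (side x S Z₁ Z₂) (side x S Z₂ Z₁) Q U).card +
        2 ^ (core x (side x S Z₂ Z₁) (side x S Z₁ Z₂) Q U).card ≤ M x)
    (hN : ∀ x S Z₁ Z₂, covers q x (side x S Z₁ Z₂) (side x S Z₂ Z₁) = [] →
      numSets (splits x (side x S Z₁ Z₂) (side x S Z₂ Z₁)) ≤ N x) :
    LComp .unit .set (fun x _ => separatedCands T a z q b x)
      fun x _ => (numSets (_root_.small a (n := x.n)) + 1) *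
        ((numSets (_root_.small z (n := x.n)) + 1) * ((numSets (_root_.small z (n := x.n)) + 1) *
          (2 * (numSets (_root_.small q (n := x.n)) + 1) ^ 2 * (M x + 1) + N x + 1) + 1) + 1) := by
  have hS : PComp (((Ty.unit.prod .set).prod .set).prod .set) .set fun x p => p.1.1.2 :=
    Comp.id.fst.fst.snd
  have h₁ : PComp (((Ty.unit.prod .set).prod .set).prod .set) .set fun x p => p.1.2 :=
    Comp.id.fst.snd
  have h₂ : PComp (((Ty.unit.prod .set).prod .set).prod .set) .set fun x p => p.2 :=
    Comp.id.snd
  have h := sideCands hT hS (Comp.side hS h₁ h₂) (Comp.side hS h₂ h₁)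
    (fun x p Q U => hM x p.1.1.2 p.1.2 p.2 Q U) (fun x p => hN x p.1.1.2 p.1.2 p.2)
  have h' := flatMap_le (small (a := z)) h (M := fun x _ =>
    2 * (numSets (_root_.small q (n := x.n)) + 1) ^ 2 * (M x + 1) + N x) fun _ _ _ _ => le_rfl
  have h'' := flatMap_le (small (a := z)) h' (M := fun x _ =>
    (numSets (_root_.small z (n := x.n)) + 1) *
    (2 * (numSets (_root_.small q (n := x.n)) + 1) ^ 2 * (M x + 1) + N x + 1))
    fun _ _ _ _ => le_rfl
  exact flatMap_le (cliques (a := a)) h'' (M := fun x _ =>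
    (numSets (_root_.small z (n := x.n)) + 1) * ((numSets (_root_.small z (n := x.n)) + 1) *
    (2 * (numSets (_root_.small q (n := x.n)) + 1) ^ 2 * (M x + 1) + N x + 1) + 1))
    fun _ _ _ _ => le_rfl

end LComp

/-! ### Graph classes -/

namespace GraphClass

variable {P : GraphClass} {n : ℕ} {G : SimpleGraph (Fin n)}

theorem mem_of_embedding (hP : P.Hereditary) {V W : Type} [Finite V] [Finite W]
    {H : SimpleGraph V} {K : SimpleGraph W} (f : H ↪g K) (h : P.Mem K) : P.Mem H :=
  P.mem_of_iso ⟨f.isoInduceRange.symm⟩ (hP K (Set.range f) h)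

/-- The subgraph induced on a set of vertices is in the class. -/
def MemOn (P : GraphClass) (G : SimpleGraph (Fin n)) (W : Finset (Fin n)) : Prop :=
  P.Mem (G.induce (W : Set (Fin n)))

theorem MemOn.mono (hP : P.Hereditary) {W W' : Finset (Fin n)} (h : P.MemOn G W') (hW : W ⊆ W') :
    P.MemOn G W :=
  mem_of_embedding hP (G.induceHomOfLE (s := (W : Set (Fin n))) (s' := (W' : Set (Fin n)))
    (by exact_mod_cast hW)) h

/-- The isomorphism between the two versions of an induced subgraph. -/
def inducedOnIso (G : SimpleGraph (Fin n)) (W : Finset (Fin n)) :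
    inducedOn G W ≃g G.induce (W : Set (Fin n)) where
  toEquiv := (W.orderIsoOfFin rfl).toEquiv
  map_rel_iff' := Iff.rfl

theorem memOn_iff {W : Finset (Fin n)} : P.MemOn G W ↔ P.Mem (inducedOn G W) :=
  ⟨P.mem_of_iso ⟨(inducedOnIso G W).symm⟩, P.mem_of_iso ⟨inducedOnIso G W⟩⟩

theorem inClass_iff {x : Inp} {W : Finset (Fin x.n)} :
    inClass P x W = true ↔ P.MemOn x.G W := by
  simp [inClass, memOn_iff]

/-- A proper induced subgraph misses some vertex `v`, hence embeds into the subgraph on `Q.erase v`.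
-/
theorem minimalForbidden_of_erase (hP : P.Hereditary) {Q : Finset (Fin n)} (hQ : ¬ P.MemOn G Q)
    (h : ∀ v ∈ Q, P.MemOn G (Q.erase v)) : P.MinimalForbidden (G.induce (Q : Set (Fin n))) := by
  refine ⟨hQ, fun W hW => ?_⟩
  obtain ⟨⟨v, hv⟩, hvW⟩ := (Set.ne_univ_iff_exists_notMem W).1 hW
  have hmem : ∀ w : W, w.1.1 ∈ ((Q.erase v : Finset (Fin n)) : Set (Fin n)) := fun w => by
    have h1 : w.1.1 ∈ Q := w.1.2
    have h2 : w.1.1 ≠ v := by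
      rintro h
      exact hvW ((Subtype.ext h : w.1 = ⟨v, hv⟩) ▸ w.2)
    simp [h2]
  refine mem_of_embedding hP ⟨⟨fun w => ⟨w.1.1, hmem w⟩, ?_⟩, ?_⟩ (h v hv)
  · intro w w' h
    have := congrArg Subtype.val h
    exact Subtype.ext (Subtype.ext this)
  · intro w w'; rfl

theorem exists_minimalForbidden (hP : P.Hereditary) {W : Finset (Fin n)} (hW : ¬ P.MemOn G W) :
    ∃ Q ⊆ W, ¬ P.MemOn G Q ∧ P.MinimalForbidden (G.induce (Q : Set (Fin n))) := by
  induction W using Finset.strongInduction with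
  | H W ih =>
    by_cases h : ∀ v ∈ W, P.MemOn G (W.erase v)
    · exact ⟨W, subset_rfl, hW, minimalForbidden_of_erase hP hW h⟩
    · push Not at h
      obtain ⟨v, hv, h⟩ := h
      obtain ⟨Q, hQ, h'⟩ := ih _ (Finset.erase_ssubset hv) h
      exact ⟨Q, hQ.trans (Finset.erase_subset _ _), h'⟩

variable {k : ℕ}

/-- A minimal forbidden graph is connected and therefore nonempty. -/
theorem memOn_empty (hP : P.Hereditary) (hk : P.ForbiddenBound k) : P.MemOn G ∅ := by
  by_contra h
  obtain ⟨Q, hQ, _, h2⟩ := exists_minimalForbidden hP h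
  obtain ⟨⟨v, hv⟩⟩ := (hk _ h2).1.nonempty
  simpa using hQ hv

/-- Adding isolated vertices does not lead out of the class. -/
theorem memOn_union_isolated (hP : P.Hereditary) (hk : P.ForbiddenBound k) {F I : Finset (Fin n)}
    (hF : P.MemOn G F) (hI : ∀ v ∈ I, P.MemOn G {v})
    (hadj : ∀ v ∈ I, ∀ u ∈ F ∪ I, ¬ G.Adj v u) : P.MemOn G (F ∪ I) := by
  by_contra h
  obtain ⟨Q, hQ, h1, h2⟩ := exists_minimalForbidden hP h
  -- Outside this case `Q` contains some `v ∈ I`. Being connected, `Q` contains a neighbour of `v`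
  -- or is just `{v}`; both are excluded.
  by_cases hQF : Q ⊆ F
  · exact h1 (hF.mono hP hQF)
  · obtain ⟨v, hv, hvF⟩ := Finset.not_subset.1 hQF
    have hvI : v ∈ I := (Finset.mem_union.1 (hQ hv)).resolve_left hvF
    by_cases hnt : Nontrivial (Q : Set (Fin n))
    · obtain ⟨⟨u, hu⟩, huv⟩ := (hk _ h2).1.preconnected.exists_adj_of_nontrivial ⟨v, hv⟩
      exact hadj v hvI u (hQ hu) huv
    · rw [not_nontrivial_iff_subsingleton, Set.subsingleton_coe] at hnt
      refine h1 ((hI v hvI).mono hP fun u hu => ?_)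
      rw [Finset.mem_singleton]
      exact hnt hu hv

end GraphClass

/-! ### Gluing and separating -/

section

variable {P : GraphClass} {T : Prog} {n : ℕ} {G : SimpleGraph (Fin n)}

theorem mem_setOn {S W : Finset (Fin n)} {i : Fin W.card} :
    i ∈ setOn S W ↔ W.orderEmbOfFin rfl i ∈ S := by simp [setOn]

/-- The position of a vertex in a set. -/
def posOf (W : Finset (Fin n)) (v : W) : Fin W.card := (W.orderIsoOfFin rfl).symm v

theorem orderEmbOfFin_posOf (W : Finset (Fin n)) (v : W) :
    W.orderEmbOfFin rfl (posOf W v) = v := by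
  rw [posOf, ← Finset.coe_orderIsoOfFin_apply, OrderIso.apply_symm_apply]

theorem posOf_orderEmbOfFin (W : Finset (Fin n)) (i : Fin W.card) (h) :
    posOf W ⟨W.orderEmbOfFin rfl i, h⟩ = i := by
  rw [posOf, OrderIso.symm_apply_eq]
  rfl

/-- A set and its renumbered version. -/
def setOnEquiv {S W : Finset (Fin n)} (h : S ⊆ W) : setOn S W ≃ S where
  toFun i := ⟨W.orderEmbOfFin rfl i.1, mem_setOn.1 i.2⟩
  invFun v := ⟨posOf W ⟨v.1, h v.2⟩, by rw [mem_setOn, orderEmbOfFin_posOf]; exact v.2⟩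
  left_inv i := Subtype.ext (posOf_orderEmbOfFin W i.1 _)
  right_inv v := Subtype.ext (orderEmbOfFin_posOf W _)

theorem isClique_setOn {S : Finset (Fin n)} (hS : G.IsClique S) (W : Finset (Fin n)) :
    (inducedOn G W).IsClique (setOn S W : Finset _) := by
  intro i hi j hj hij
  refine hS ?_ ?_ fun h => hij ((W.orderEmbOfFin rfl).injective h)
  · simpa [setOn] using hi
  · simpa [setOn] using hj

/-- Gluing the two parts along the identity of `S` creates no edge between `X₁ \ S` and `X₂ \ S`,
and by `hadj` neither does `G`. So the induced subgraph embeds into the glued graph. -/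
theorem memOn_of_answersYes (hP : P.Hereditary) (hT : P.GluingSound T) {S X₁ X₂ : Finset (Fin n)}
    (hS : G.IsClique S) (hadj : ∀ u ∈ X₁, ∀ v ∈ X₂, ¬ G.Adj u v)
    (hy₁ : T.AnswersYes (inducedOn G (X₁ ∪ S)) (setOn S (X₁ ∪ S)))
    (hy₂ : T.AnswersYes (inducedOn G (X₂ ∪ S)) (setOn S (X₂ ∪ S))) :
    P.MemOn G (S ∪ (X₁ ∪ X₂)) := by
  have hS₁ : S ⊆ X₁ ∪ S := Finset.subset_union_right
  have hS₂ : S ⊆ X₂ ∪ S := Finset.subset_union_right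
  let e := (setOnEquiv hS₁).trans (setOnEquiv hS₂).symm
  have key := hT _ _ _ _ _ _ (isClique_setOn hS (X₁ ∪ S)) (isClique_setOn hS (X₂ ∪ S)) hy₁ hy₂ e
  have hX₂ : ∀ v, v ∈ S ∪ (X₁ ∪ X₂) → v ∉ X₁ ∪ S → v ∈ X₂ := by
    intro v hv hv'
    simp only [Finset.mem_union] at hv hv'
    tauto
  have hval : ∀ (i : setOn S (X₁ ∪ S)),
      (X₂ ∪ S).orderEmbOfFin rfl (e i) = (X₁ ∪ S).orderEmbOfFin rfl i := fun i => by
    change (X₂ ∪ S).orderEmbOfFin rfl (posOf (X₂ ∪ S) ⟨_, _⟩) = _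
    rw [orderEmbOfFin_posOf]
    rfl
  let f : (S ∪ (X₁ ∪ X₂) : Finset (Fin n)) →
      Fin (X₁ ∪ S).card ⊕ {v : Fin (X₂ ∪ S).card // v ∉ setOn S (X₂ ∪ S)} := fun v =>
    if h : v.1 ∈ X₁ ∪ S then .inl (posOf _ ⟨v.1, h⟩)
    else .inr ⟨posOf _ ⟨v.1, Finset.mem_union_left _ (hX₂ v.1 v.2 h)⟩, by
      rw [mem_setOn, orderEmbOfFin_posOf]
      exact fun h' => h (Finset.mem_union_right _ h')⟩
  -- `g` sends every vertex of the glued graph back to `G`. The glued adjacency is the pullback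
  -- along `g` (`hglue`) and `f` is a section of `g`, so `f` is an embedding.
  let g : Fin (X₁ ∪ S).card ⊕ {v : Fin (X₂ ∪ S).card // v ∉ setOn S (X₂ ∪ S)} → Fin n :=
    Sum.elim (fun i => (X₁ ∪ S).orderEmbOfFin rfl i) (fun i => (X₂ ∪ S).orderEmbOfFin rfl i.1)
  have hgf : ∀ v, g (f v) = v.1 := by
    intro v
    by_cases h : v.1 ∈ X₁ ∪ S
    · simp only [f, dif_pos h, g, Sum.elim_inl, orderEmbOfFin_posOf]
    · simp only [f, dif_neg h, g, Sum.elim_inr, orderEmbOfFin_posOf]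
  have hglue : ∀ p q, (glue (inducedOn G (X₁ ∪ S)) (inducedOn G (X₂ ∪ S)) e).Adj p q ↔
      G.Adj (g p) (g q) := by
    have h2 : ∀ i : {v : Fin (X₂ ∪ S).card // v ∉ setOn S (X₂ ∪ S)},
        (X₂ ∪ S).orderEmbOfFin rfl i.1 ∈ X₂ := fun i => by
      have h3 := Finset.orderEmbOfFin_mem (X₂ ∪ S) rfl i.1
      have h4 := i.2
      rw [mem_setOn] at h4
      exact (Finset.mem_union.1 h3).resolve_right h4
    have h3 : ∀ i j, (∃ h : i ∈ setOn S (X₁ ∪ S),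
        (inducedOn G (X₂ ∪ S)).Adj (e ⟨i, h⟩) j) ↔
        (X₁ ∪ S).orderEmbOfFin rfl i ∈ S ∧
          G.Adj ((X₁ ∪ S).orderEmbOfFin rfl i) ((X₂ ∪ S).orderEmbOfFin rfl j) := fun i j => by
      rw [← mem_setOn, ← exists_prop]
      refine exists_congr fun h => ?_
      rw [← hval ⟨i, h⟩]
      rfl
    have h4 : ∀ i (j : {v : Fin (X₂ ∪ S).card // v ∉ setOn S (X₂ ∪ S)}),
        G.Adj ((X₁ ∪ S).orderEmbOfFin rfl i) ((X₂ ∪ S).orderEmbOfFin rfl j.1) →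
        (X₁ ∪ S).orderEmbOfFin rfl i ∈ S := fun i j hij => by
      refine (Finset.mem_union.1 (Finset.orderEmbOfFin_mem (X₁ ∪ S) rfl i)).resolve_left fun h => ?_
      exact hadj _ h _ (h2 j) hij
    rintro (i | i) (j | j)
    · rfl
    · exact (h3 i j).trans ⟨fun h => h.2, fun h => ⟨h4 i j h, h⟩⟩
    · have h5 : (∃ h : j ∈ setOn S (X₁ ∪ S), (inducedOn G (X₂ ∪ S)).Adj i (e ⟨j, h⟩)) ↔
          ∃ h : j ∈ setOn S (X₁ ∪ S), (inducedOn G (X₂ ∪ S)).Adj (e ⟨j, h⟩) i :=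
        exists_congr fun h => SimpleGraph.adj_comm _ _ _
      refine (h5.trans (h3 j i)).trans ⟨fun h => h.2.symm, fun h => ⟨h4 j i h.symm, h.symm⟩⟩
    · rfl
  refine GraphClass.mem_of_embedding hP ⟨⟨f, ?_⟩, ?_⟩ key
  · intro v w h
    have := congrArg g h
    rw [hgf, hgf] at this
    exact Subtype.ext this
  · intro v w
    refine (hglue _ _).trans ?_
    change G.Adj (g (f v)) (g (f w)) ↔ G.Adj v.1 w.1
    rw [hgf, hgf]

theorem encGraphSet_congr {m m' : ℕ} (h : m = m') {H : SimpleGraph (Fin m)}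
    {H' : SimpleGraph (Fin m')} {S : Finset (Fin m)} {S' : Finset (Fin m')}
    (hadj : ∀ i j, H.Adj i j ↔ H'.Adj (Fin.cast h i) (Fin.cast h j))
    (hS : ∀ i, i ∈ S ↔ Fin.cast h i ∈ S') : encGraphSet H S = encGraphSet H' S' := by
  subst h
  have h1 : H = H' := by ext i j; exact hadj i j
  have h2 : S = S' := by ext i; exact hS i
  rw [h1, h2]

/-- Renumbering twice is the same as renumbering once. -/
theorem encGraphSet_inducedOn {F : Finset (Fin n)} {W S : Finset (Fin F.card)} :
    encGraphSet (inducedOn (inducedOn G F) W) (setOn S W) =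
      encGraphSet (inducedOn G (W.map (F.orderEmbOfFin rfl).toEmbedding))
        (setOn (S.map (F.orderEmbOfFin rfl).toEmbedding)
          (W.map (F.orderEmbOfFin rfl).toEmbedding)) := by
  have hc := (Finset.card_map (F.orderEmbOfFin rfl).toEmbedding (s := W)).symm
  -- A composition of increasing enumerations is again the increasing enumeration of its range.
  have he : ∀ i, (W.map (F.orderEmbOfFin rfl).toEmbedding).orderEmbOfFin rfl (Fin.cast hc i) =
      F.orderEmbOfFin rfl (W.orderEmbOfFin rfl i) := by
    have h := Finset.orderEmbOfFin_unique (s := W.map (F.orderEmbOfFin rfl).toEmbedding)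
      (k := W.card) hc.symm (f := fun i => F.orderEmbOfFin rfl (W.orderEmbOfFin rfl i))
      (fun i => Finset.mem_map_of_mem _ (Finset.orderEmbOfFin_mem W rfl i))
      (fun i j hij => (F.orderEmbOfFin rfl).strictMono ((W.orderEmbOfFin rfl).strictMono hij))
    intro i
    rw [congrFun h i]
    simp only [Finset.orderEmbOfFin_apply]
    rfl
  refine encGraphSet_congr hc (fun i j => ?_) fun i => ?_
  · simp only [inducedOn, SimpleGraph.comap_adj]
    rw [he, he]
  · rw [mem_setOn, mem_setOn, he]
    simp

/-- Completeness is applied to `inducedOn G F` and transported back. An isomorphism would not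
transfer the answers of `T`, which depend on the numbering; by `encGraphSet_inducedOn` the encoded
inputs are literally equal. -/
theorem exists_separator (hT : P.SeparatorComplete T) {F : Finset (Fin n)} (hF : P.MemOn G F) :
    ∃ S X₁ X₂ : Finset (Fin n), G.IsClique S ∧ Disjoint X₁ S ∧ Disjoint X₂ S ∧ Disjoint X₁ X₂ ∧
      S ∪ (X₁ ∪ X₂) = F ∧ 3 * X₁.card ≤ 2 * F.card ∧ 3 * X₂.card ≤ 2 * F.card ∧
      (∀ u ∈ X₁, ∀ v ∈ X₂, ¬ G.Adj u v) ∧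
      T.AnswersYes (inducedOn G (X₁ ∪ S)) (setOn S (X₁ ∪ S)) ∧
      T.AnswersYes (inducedOn G (X₂ ∪ S)) (setOn S (X₂ ∪ S)) := by
  obtain ⟨S, X₁, X₂, hS, h1, h2, h3, h4, h5, h6, h7, h8, h9⟩ :=
    hT _ (inducedOn G F) (GraphClass.memOn_iff.1 hF)
  set e := (F.orderEmbOfFin rfl).toEmbedding with he
  have hy : ∀ X, T.AnswersYes (inducedOn (inducedOn G F) (X ∪ S)) (setOn S (X ∪ S)) →
      T.AnswersYes (inducedOn G (X.map e ∪ S.map e)) (setOn (S.map e) (X.map e ∪ S.map e)) := by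
    rintro X ⟨t, ht⟩
    rw [encGraphSet_inducedOn, Finset.map_union] at ht
    exact ⟨t, ht⟩
  refine ⟨S.map e, X₁.map e, X₂.map e, ?_, ?_, ?_, ?_, ?_, by simpa using h5, by simpa using h6,
    ?_, hy _ h8, hy _ h9⟩
  · intro u hu v hv huv
    simp only [Finset.coe_map, Set.mem_image, Finset.mem_coe] at hu hv
    obtain ⟨i, hi, rfl⟩ := hu
    obtain ⟨j, hj, rfl⟩ := hv
    exact hS hi hj fun h => huv (h ▸ rfl)
  · simpa [Finset.disjoint_map] using h1
  · simpa [Finset.disjoint_map] using h2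
  · simpa [Finset.disjoint_map] using h3
  · rw [← Finset.map_union, ← Finset.map_union, Finset.union_comm, h4]
    exact Finset.map_orderEmbOfFin_univ F rfl
  · intro u hu v hv
    simp only [Finset.mem_map] at hu hv
    obtain ⟨i, hi, rfl⟩ := hu
    obtain ⟨j, hj, rfl⟩ := hv
    exact h7 i hi j hj

end

/-- A set in which all degrees are less than `D` contains an independent set of at least a fraction
`1 / D` of its vertices. -/
theorem exists_independent {n : ℕ} (G : SimpleGraph (Fin n)) (D : ℕ) (U : Finset (Fin n))
    (hU : ∀ u ∈ U, (nb G {u} ∩ U).card < D) :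
    ∃ I ⊆ U, (∀ u ∈ I, ∀ v ∈ I, ¬ G.Adj u v) ∧ U.card ≤ D * I.card := by
  induction U using Finset.strongInduction with
  | H U ih =>
    rcases U.eq_empty_or_nonempty with rfl | ⟨u, hu⟩
    · exact ⟨∅, by simp⟩
    -- Greedy choice: taking `u` discards its closed neighbourhood, which has at most `D` vertices
    -- in `U`.
    · have hss : U \ cnb G {u} ⊂ U := by
        refine (Finset.ssubset_iff_of_subset Finset.sdiff_subset).2 ⟨u, hu, ?_⟩
        simp [cnb]
      obtain ⟨I, hI, hind, hc⟩ := ih _ hss fun v hv =>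
        (Finset.card_le_card (Finset.inter_subset_inter subset_rfl Finset.sdiff_subset)).trans_lt
          (hU v (Finset.mem_sdiff.1 hv).1)
      have hu' : ∀ v ∈ I, v ≠ u ∧ ¬ G.Adj v u := fun v hv => by
        have := (Finset.mem_sdiff.1 (hI hv)).2
        simpa [cnb, mem_nb] using this
      refine ⟨insert u I, ?_, ?_, ?_⟩
      · exact Finset.insert_subset hu (hI.trans Finset.sdiff_subset)
      · intro v hv w hw
        rw [Finset.mem_insert] at hv hw
        rcases hv with rfl | hv <;> rcases hw with rfl | hw
        · exact G.loopless.irrefl _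
        · exact fun h => (hu' w hw).2 h.symm
        · exact (hu' v hv).2
        · exact hind v hv w hw
      · rw [Finset.card_insert_of_notMem fun h => (hu' u h).1 rfl]
        have h1 : U ⊆ (U \ cnb G {u}) ∪ ({u} ∪ (nb G {u} ∩ U)) := by
          intro v hv
          simp only [Finset.mem_union, Finset.mem_sdiff, cnb, Finset.mem_inter, hv, true_and,
            and_true]
          tauto
        have h2 := Finset.card_le_card h1
        have h3 := Finset.card_union_le (U \ cnb G {u}) ({u} ∪ (nb G {u} ∩ U))
        have h4 := Finset.card_union_le {u} (nb G {u} ∩ U)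
        have h5 := hU u hu
        rw [Finset.card_singleton] at h4
        rw [Nat.mul_add]
        omega

/-! ### Correctness of the algorithm -/

theorem rounds_invariant {α β : Type*} {F : α → β → List β} {I : β → Prop} {L : List β} {l : List α}
    (h₀ : ∀ p ∈ L, I p) (hstep : ∀ v ∈ l, ∀ p, I p → ∀ p' ∈ F v p, I p') :
    ∀ p ∈ l.foldl (fun L v => L.flatMap (F v)) L, I p := by
  induction l generalizing L with
  | nil => exact h₀
  | cons v l ih =>
    refine ih (fun p hp => ?_) fun w hw => hstep w (List.mem_cons_of_mem _ hw)
    obtain ⟨p', hp', hp⟩ := List.mem_flatMap.1 hp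
    exact hstep v List.mem_cons_self p' (h₀ p' hp') p hp

/-- Follows one path in the search tree; `J l₁` is what is known on this path after the rounds in
`l₁`. -/
theorem rounds_exists {α β : Type*} {F : α → β → List β} {J : List α → β → Prop} {L : List β}
    {l : List α} (h₀ : ∃ p ∈ L, J [] p)
    (hstep : ∀ l₁ v, l₁ ++ [v] <+: l → ∀ p, J l₁ p → ∃ p' ∈ F v p, J (l₁ ++ [v]) p') :
    ∃ p ∈ l.foldl (fun L v => L.flatMap (F v)) L, J l p := by
  induction l using List.reverseRecOn with
  | nil => exact h₀
  | append_singleton l v ih =>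
    obtain ⟨p, hp, hJ⟩ := ih fun l₁ w h => hstep l₁ w (h.trans (List.prefix_append _ _))
    obtain ⟨p', hp', hJ'⟩ := hstep l v (List.prefix_refl _) p hJ
    rw [List.foldl_append]
    exact ⟨p', List.mem_flatMap.2 ⟨p, hp, hp'⟩, hJ'⟩

section

variable {P : GraphClass} {T : Prog} {x : Inp} {k : ℕ}

/-- A vertex is kept only if its removal led into the class. By heredity this stays true while the
set shrinks further, so one pass is enough. -/
theorem minForbidden_spec (hP : P.Hereditary) {W : Finset (Fin x.n)} (hW : ¬ P.MemOn x.G W) :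
    minForbidden P x W ⊆ W ∧ ¬ P.MemOn x.G (minForbidden P x W) ∧
      P.MinimalForbidden (x.G.induce (minForbidden P x W : Set (Fin x.n))) := by
  have key : ∀ (l : List (Finset (Fin x.n))) (W : Finset (Fin x.n)), ¬ P.MemOn x.G W →
      let Q := l.foldl (fun W v => if inClass P x (W \ v) then W else W \ v) W
      Q ⊆ W ∧ ¬ P.MemOn x.G Q ∧ ∀ v, {v} ∈ l → v ∈ Q → P.MemOn x.G (Q.erase v) := by
    intro l
    induction l with
    | nil => intro W hW; simp [hW]
    | cons s l ih =>
      intro W hW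
      rw [List.foldl_cons]
      by_cases h : P.MemOn x.G (W \ s)
      · rw [if_pos (GraphClass.inClass_iff.2 h)]
        obtain ⟨h1, h2, h3⟩ := ih W hW
        refine ⟨h1, h2, fun v hv hvQ => ?_⟩
        rcases List.mem_cons.1 hv with rfl | hv
        · refine h.mono hP ?_
          rw [Finset.sdiff_singleton_eq_erase]
          exact Finset.erase_subset_erase _ h1
        · exact h3 v hv hvQ
      · rw [if_neg fun h' => h (GraphClass.inClass_iff.1 h')]
        obtain ⟨h1, h2, h3⟩ := ih (W \ s) h
        refine ⟨h1.trans Finset.sdiff_subset, h2, fun v hv hvQ => ?_⟩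
        rcases List.mem_cons.1 hv with rfl | hv
        · simpa using h1 hvQ
        · exact h3 v hv hvQ
  obtain ⟨h1, h2, h3⟩ := key (singles x.n) W hW
  exact ⟨h1, h2, GraphClass.minimalForbidden_of_erase hP h2
    fun v hv => h3 v (mem_singles.2 ⟨v, rfl⟩) hv⟩

/-- The right branch belongs to the first vertex of `Q ∩ U` missed by `F`: this vertex is deleted,
and the earlier ones, which lie in `F`, are correctly declared to stay. -/
theorem exists_mem_hitBranches {Q W U F : Finset (Fin x.n)} (hFW : F ⊆ W) (hWU : W \ U ⊆ F)
    (hQ : ∃ v ∈ Q ∩ U, v ∉ F) :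
    ∃ p ∈ hitBranches x Q W U, F ⊆ p.1 ∧ p.1 \ p.2 ⊆ F ∧ p.2.card < U.card := by
  have key : ∀ (l : List (Finset (Fin x.n))) (s), (∀ v ∈ l, v ∈ singles x.n) →
      ((∃ p ∈ s.2, F ⊆ p.1 ∧ p.1 \ p.2 ⊆ F ∧ p.2.card < U.card) ∨
        (s.1 ⊆ U ∧ W \ s.1 ⊆ F ∧ ∃ v ∈ Q ∩ U, v ∉ F ∧ {v} ∈ l)) →
      ∃ p ∈ (l.foldl (fun s v => if decide (v ⊆ Q ∩ U) then
        (s.1 \ v, (W \ v, s.1 \ v) :: s.2) else s) s).2,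
        F ⊆ p.1 ∧ p.1 \ p.2 ⊆ F ∧ p.2.card < U.card := by
    intro l
    induction l with
    | nil => simp
    | cons s₀ l ih =>
      rintro s hl hs
      obtain ⟨i, rfl⟩ := mem_singles.1 (hl s₀ List.mem_cons_self)
      refine ih _ (fun v hv => hl v (List.mem_cons_of_mem _ hv)) ?_
      dsimp only
      rcases hs with ⟨p, hp, h⟩ | ⟨h1, h2, v, hv, hvF, hvl⟩
      · left
        refine ⟨p, ?_, h⟩
        split
        · exact List.mem_cons_of_mem _ hp
        · exact hp
      · by_cases hi : {i} ⊆ Q ∩ U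
        · simp only [hi, decide_true, if_true]
          by_cases hiF : i ∈ F
          · right
            refine ⟨Finset.sdiff_subset.trans h1, fun w hw => ?_, v, hv, hvF, ?_⟩
            · simp only [Finset.mem_sdiff, Finset.mem_singleton, not_and, not_not] at hw
              by_cases hws : w ∈ s.1
              · exact hw.2 hws ▸ hiF
              · exact h2 (by simp [hw.1, hws])
            · refine (List.mem_cons.1 hvl).resolve_left fun h => hvF ?_
              rw [Finset.singleton_inj] at h
              exact h ▸ hiF
          · left
            refine ⟨_, List.mem_cons_self, fun w hw => ?_, fun w hw => ?_, ?_⟩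
            · rw [Finset.mem_sdiff, Finset.mem_singleton]
              exact ⟨hFW hw, fun h => hiF (h ▸ hw)⟩
            · simp only [Finset.mem_sdiff, Finset.mem_singleton] at hw
              exact h2 (by simp; tauto)
            · refine Finset.card_lt_card ((Finset.ssubset_iff_of_subset
                (Finset.sdiff_subset.trans h1)).2 ⟨i, ?_, by simp⟩)
              exact (Finset.mem_inter.1 (hi (Finset.mem_singleton_self i))).2
        · simp only [hi, decide_false, Bool.false_eq_true, if_false]
          right
          refine ⟨h1, h2, v, hv, hvF, (List.mem_cons.1 hvl).resolve_left fun h => hi ?_⟩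
          rw [← h]
          simpa using hv
  obtain ⟨v, hv, hvF⟩ := hQ
  exact key _ _ (fun _ h => h) (.inr ⟨subset_rfl, hWU, v, hv, hvF, mem_singles.2 ⟨v, rfl⟩⟩)

/-- Along the branch that agrees with `F`, every round either has reached the class or decides a
vertex of `U`; so `n` rounds suffice. A forbidden set contained in `W` meets `U` outside `F`,
because `F` is in the class and contains `W \ U`. -/
theorem exists_mem_hitSearch (hP : P.Hereditary) {F W U : Finset (Fin x.n)} (hF : P.MemOn x.G F)
    (hFW : F ⊆ W) (hWU : W \ U ⊆ F) :
    ∃ p ∈ hitSearch P x (W, U), F ⊆ p.1 ∧ P.MemOn x.G p.1 := by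
  obtain ⟨p, hp, h1, h2, h3⟩ := rounds_exists (F := fun _ => hitStep P x) (L := [(W, U)])
    (l := singles x.n)
    (J := fun l p => F ⊆ p.1 ∧ p.1 \ p.2 ⊆ F ∧ (P.MemOn x.G p.1 ∨ p.2.card + l.length ≤ x.n))
    ⟨(W, U), by simp, hFW, hWU, .inr (by simpa using Finset.card_le_univ U)⟩ (by
    rintro l₁ v - ⟨W', U'⟩ ⟨h1, h2, h3⟩
    rw [hitStep]
    by_cases h : P.MemOn x.G W'
    · rw [if_pos (GraphClass.inClass_iff.2 h)]
      exact ⟨_, by simp, h1, h2, .inl h⟩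
    · rw [if_neg fun h' => h (GraphClass.inClass_iff.1 h')]
      obtain ⟨hQ1, hQ2, -⟩ := minForbidden_spec hP h
      have : ∃ v ∈ minForbidden P x W' ∩ U', v ∉ F := by
        obtain ⟨v, hv, hvF⟩ := Finset.not_subset.1 fun h => hQ2 (hF.mono hP h)
        refine ⟨v, Finset.mem_inter.2 ⟨hv, ?_⟩, hvF⟩
        by_contra hvU
        exact hvF (h2 (Finset.mem_sdiff.2 ⟨hQ1 hv, hvU⟩))
      obtain ⟨p, hp, h4, h5, h6⟩ := exists_mem_hitBranches h1 h2 this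
      refine ⟨p, hp, h4, h5, .inr ?_⟩
      have := h3.resolve_left h
      rw [List.length_append, List.length_singleton]
      dsimp only at this h6
      omega)
  refine ⟨p, hp, h1, h3.elim (fun h => h) fun h => ?_⟩
  rw [length_singles] at h
  -- With no undecided vertices left, the current set equals `F`.
  have : p.2 = ∅ := by rw [← Finset.card_eq_zero]; omega
  rw [this, Finset.sdiff_empty] at h2
  exact h2.antisymm h1 ▸ hF

/-- A bigger clique would contain one of exactly `x.n / a` vertices, and that one passes the filter.
-/
theorem isClique_of_largeCliques_eq_nil {a : ℕ} (ha : 1 ≤ a) (h : largeCliques a x = [])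
    {S : Finset (Fin x.n)} (hS : x.G.IsClique S) : a * S.card ≤ x.n := by
  by_contra hlt
  push Not at hlt
  have h1 : x.n / a ≤ S.card := by
    rw [Nat.div_le_iff_le_mul_add_pred (by omega)]
    omega
  obtain ⟨K, hKS, hK⟩ := Finset.exists_subset_card_eq h1
  have h2 : K ∈ (enumSets (small a)).filter
      fun K => isCl x K && !decide (a * (K.card + 1) ≤ x.n) := by
    rw [List.mem_filter, mem_enumSets (small_down a)]
    refine ⟨.inr ?_, ?_⟩
    · rw [small, decide_eq_true_eq, hK]
      exact Nat.mul_div_le _ _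
    · simp only [isCl, Bool.and_eq_true, decide_eq_true_eq, Bool.not_eq_true',
        decide_eq_false_iff_not, not_le]
      refine ⟨hS.subset (by exact_mod_cast hKS), ?_⟩
      rw [hK]
      exact Nat.lt_mul_div_succ _ (by omega)
  rw [largeCliques, List.take_eq_nil_iff] at h
  rw [h.resolve_left (by simp)] at h2
  simp at h2

theorem largeCliques_spec {a : ℕ} {K : Finset (Fin x.n)} (hK : K ∈ largeCliques a x) :
    x.G.IsClique K ∧ x.n < a * (K.card + 1) := by
  have := (List.mem_filter.1 (List.mem_of_mem_take hK)).2
  simpa [isCl] using this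

/-! ### Cover states, and domination by a maximum solution -/

variable {D : ℕ} {S : Finset (Fin x.n)}

/-- What is known about the pairs in `coverStates`. -/
structure CoverInv (D : ℕ) (x : Inp) (S : Finset (Fin x.n))
    (p : Finset (Fin x.n) × Finset (Fin x.n)) : Prop where
  card_le : D * p.1.card ≤ (cnb x.G p.1).card
  notMem : ∀ c ∈ p.2, c ∉ S
  deg_lt : ∀ c ∈ p.2, (nb x.G {c} \ (S ∪ cnb x.G p.1)).card < D

theorem CoverInv.empty : CoverInv D x S (∅, ∅) := ⟨by simp, by simp, by simp⟩

/-- A vertex is chosen only if it brings `D` new vertices into the closed neighbourhood. A vertex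
found ineligible remains so, since the closed neighbourhood of `p.1` only grows. -/
theorem CoverInv.step {v : Finset (Fin x.n)} (hv : v ∈ singles x.n)
    {p p' : Finset (Fin x.n) × Finset (Fin x.n)} (hI : CoverInv D x S p)
    (hp' : p' ∈ coverStep D x S p v) : CoverInv D x S p' := by
  obtain ⟨i, rfl⟩ := mem_singles.1 hv
  rw [coverStep] at hp'
  simp only [decide_eq_true_eq, Finset.card_singleton, mul_one] at hp'
  split at hp'
  · rw [List.mem_singleton] at hp'; exact hp' ▸ hI
  · rename_i hiS
    rw [Finset.singleton_subset_iff] at hiS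
    split at hp'
    · rename_i h
      rcases List.mem_cons.1 hp' with rfl | hp'
      · have hmono := cnb_mono x.G (Finset.subset_union_left : p.1 ⊆ p.1 ∪ {i})
        refine ⟨?_, hI.notMem, fun c hc => (Finset.card_le_card
          (Finset.sdiff_subset_sdiff subset_rfl (Finset.union_subset_union subset_rfl
          hmono))).trans_lt (hI.deg_lt c hc)⟩
        dsimp only
        have h1 : cnb x.G p.1 ∪ (nb x.G {i} \ (S ∪ cnb x.G p.1)) ⊆ cnb x.G (p.1 ∪ {i}) := by
          refine Finset.union_subset hmono (Finset.sdiff_subset.trans ?_)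
          exact (nb_mono x.G Finset.subset_union_right).trans Finset.subset_union_right
        have h2 := Finset.card_le_card h1
        rw [Finset.card_union_of_disjoint] at h2
        · have h3 := Finset.card_union_le p.1 {i}
          have h4 := hI.card_le
          rw [Finset.card_singleton] at h3
          nlinarith
        · rw [Finset.disjoint_left]
          intro w hw hw'
          simp only [Finset.mem_sdiff, Finset.mem_union, not_or] at hw'
          exact hw'.2.2 hw
      · rw [List.mem_singleton] at hp'; exact hp' ▸ hI
    · rename_i h
      rw [List.mem_singleton] at hp'
      subst hp'
      refine ⟨hI.card_le, fun c hc => ?_, fun c hc => ?_⟩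
      · rcases Finset.mem_union.1 hc with hc | hc
        · exact hI.notMem c hc
        · exact Finset.mem_singleton.1 hc ▸ hiS
      · rcases Finset.mem_union.1 hc with hc | hc
        · exact hI.deg_lt c hc
        · obtain rfl := Finset.mem_singleton.1 hc
          exact not_le.1 h

theorem coverInv_of_mem {p : Finset (Fin x.n) × Finset (Fin x.n)} (hp : p ∈ coverStates D x S) :
    CoverInv D x S p :=
  rounds_invariant (F := fun v p => coverStep D x S p v) (I := CoverInv D x S)
    (by simpa using CoverInv.empty) (fun _ hv _ hI _ hp' => hI.step hv hp') p hp

/-- At every eligible vertex take the branch that agrees with `F`; ineligible vertices go to `p.2`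
whether or not they are in `F`. -/
theorem exists_mem_coverStates {F : Finset (Fin x.n)} (hF : Disjoint F S) :
    ∃ p ∈ coverStates D x S, p.1 ⊆ F ∧ F ⊆ p.1 ∪ p.2 := by
  obtain ⟨p, hp, h1, h2⟩ := rounds_exists (F := fun v p => coverStep D x S p v) (L := [(∅, ∅)])
    (l := singles x.n) (J := fun l p => p.1 ⊆ F ∧ ∀ v ∈ F, {v} ∈ l → v ∈ p.1 ∪ p.2)
    ⟨(∅, ∅), by simp, by simp, by simp⟩ (by
    rintro l₁ v hpre p ⟨h1, h2⟩
    obtain ⟨i, rfl⟩ := mem_singles.1 (hpre.subset (by simp) : v ∈ singles x.n)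
    have hmem : ∀ w : Fin x.n, {w} ∈ l₁ ++ [({i} : Finset (Fin x.n))] → {w} ∈ l₁ ∨ w = i :=
      fun w hw => by simpa using hw
    rw [coverStep]
    simp only [decide_eq_true_eq, Finset.card_singleton, mul_one]
    split
    · rename_i hiS
      rw [Finset.singleton_subset_iff] at hiS
      refine ⟨p, by simp, h1, fun w hw hw' => ?_⟩
      rcases hmem w hw' with h | rfl
      · exact h2 w hw h
      · exact absurd hiS (Finset.disjoint_left.1 hF hw)
    · split
      · by_cases hiF : i ∈ F
        · refine ⟨_, List.mem_cons_self, ?_, fun w hw hw' => ?_⟩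
          · exact Finset.union_subset h1 (by simpa using hiF)
          · rcases hmem w hw' with h | rfl
            · have := h2 w hw h
              simp only [Finset.mem_union] at this ⊢
              tauto
            · simp
        · refine ⟨p, by simp, h1, fun w hw hw' => ?_⟩
          rcases hmem w hw' with h | rfl
          · exact h2 w hw h
          · exact absurd hw hiF
      · refine ⟨_, List.mem_singleton_self _, h1, fun w hw hw' => ?_⟩
        rcases hmem w hw' with h | rfl
        · have := h2 w hw h
          simp only [Finset.mem_union] at this ⊢
          tauto
        · simp)
  exact ⟨p, hp, h1, fun v hv => h2 v hv (mem_singles.2 ⟨v, rfl⟩)⟩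

/-- Few vertices in the rest are left undominated by a maximum solution. -/
theorem card_undominated_le (hP : P.Hereditary) (hk : P.ForbiddenBound k)
    (hone : ∀ v : Fin x.n, P.MemOn x.G {v}) {F F' : Finset (Fin x.n)}
    (hF' : P.MemOn x.G F') (hcard : F.card ≤ S.card + F'.card)
    (hmax : ∀ W, P.MemOn x.G W → W.card ≤ F.card)
    {p : Finset (Fin x.n) × Finset (Fin x.n)} (hI : CoverInv D x S p) :
    (rest x p \ cnb x.G F').card ≤ D * S.card := by
  -- A neighbour inside `rest x p` lies outside `S` and outside the closed neighbourhood of `p.1`,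
  -- so `deg_lt` bounds the degrees here.
  obtain ⟨I, hI1, hI2, hI3⟩ := exists_independent x.G D (rest x p \ cnb x.G F') fun u hu => by
    have hu' : u ∈ p.2 := by
      simp only [rest, Finset.mem_sdiff] at hu
      exact hu.1.1
    refine (Finset.card_le_card fun w hw => ?_).trans_lt (hI.deg_lt u hu')
    simp only [rest, Finset.mem_inter, Finset.mem_sdiff, Finset.mem_union, not_or] at hw ⊢
    exact ⟨hw.1, hI.notMem w hw.2.1.1, hw.2.1.2⟩
  refine hI3.trans (Nat.mul_le_mul_left _ ?_)
  have hnot : ∀ v ∈ I, v ∉ F' ∧ ∀ u ∈ F', ¬ x.G.Adj v u := fun v hv => by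
    have := (Finset.mem_sdiff.1 (hI1 hv)).2
    simpa [cnb, mem_nb, not_or] using this
  -- Exchange: the vertices of `I` are isolated in `F' ∪ I`. Maximality of `F` and `hcard` then give
  -- `|I| ≤ |S|`.
  have h1 : P.MemOn x.G (F' ∪ I) := GraphClass.memOn_union_isolated hP hk hF'
    (fun v _ => hone v) fun v hv u hu => by
      rcases Finset.mem_union.1 hu with hu | hu
      · exact (hnot v hv).2 u hu
      · exact hI2 v hv u hu
  have h2 := hmax _ h1
  rw [Finset.card_union_of_disjoint (Finset.disjoint_right.2 fun v hv => (hnot v hv).1)] at h2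
  omega

/-! ### The two sides of a separated solution -/

theorem side_disjoint (x : Inp) (S Z₁ Z₂ : Finset (Fin x.n)) :
    Disjoint (side x S Z₁ Z₂) (side x S Z₂ Z₁) := by
  rw [Finset.disjoint_left]
  intro v h1 h2
  simp only [side, Finset.mem_sdiff, Finset.mem_union, not_or] at h1 h2
  exact h2.2.1 h1.1

theorem side_disjoint_left (x : Inp) (S Z₁ Z₂ : Finset (Fin x.n)) :
    Disjoint (side x S Z₁ Z₂) S := by
  rw [Finset.disjoint_left]
  intro v h1 h2
  simp only [side, Finset.mem_sdiff, Finset.mem_union, not_or] at h1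
  exact h1.2.2 h2

theorem core_subset (x : Inp) (A₁ A₂ Q U : Finset (Fin x.n)) : core x A₁ A₂ Q U ⊆ A₁ := by
  intro v hv
  simp only [core, Finset.mem_sdiff, Finset.mem_union, Finset.mem_inter] at hv
  tauto

/-- Edges avoiding `Q` are excluded by `h`; any other edge would have an end in `U`, whose
neighbours on the opposite side have been removed. -/
theorem apart_core {A₁ A₂ Q U : Finset (Fin x.n)} (h : apart x (A₁ \ Q) (A₂ \ Q) = true) :
    apart x (core x A₁ A₂ Q U) (core x A₂ A₁ Q U) = true := by
  rw [apart_iff] at *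
  intro u hu v hv huv
  simp only [core, Finset.mem_sdiff, Finset.mem_union, Finset.mem_inter, mem_nb, not_exists,
    not_and] at hu hv
  rcases hu.1 with h1 | h1
  · rcases hv.1 with h2 | h2
    · exact h u (Finset.mem_sdiff.2 h1) v (Finset.mem_sdiff.2 h2) huv
    · exact hu.2 v h2 huv
  · exact hv.2 u h1 huv.symm

/-- For the correct guess `U`, the part of `U` in `A₂` belongs to `X₂`, so removing its neighbours
does not affect `X₁`. -/
theorem subset_core {A₁ A₂ Q X₁ X₂ : Finset (Fin x.n)} (h₁ : X₁ ⊆ A₁)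
    (hA : Disjoint A₁ A₂) (hadj : ∀ u ∈ X₁, ∀ v ∈ X₂, ¬ x.G.Adj u v) :
    X₁ ⊆ core x A₁ A₂ Q ((X₁ ∪ X₂) ∩ Q) := by
  intro v hv
  simp only [core, Finset.mem_sdiff, Finset.mem_union, Finset.mem_inter, mem_nb, not_exists,
    not_and]
  refine ⟨?_, fun w hw hvw => hadj v hv w ?_ hvw⟩
  · have := h₁ hv
    tauto
  · rcases hw.1.1 with h | h
    · exact absurd hw.2 (Finset.disjoint_left.1 hA (h₁ h))
    · exact h

theorem bestYes_spec {C X : Finset (Fin x.n)} (hX : X ⊆ C) (hy : yes T x S X = true) :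
    bestYes T x S C ⊆ C ∧ yes T x S (bestYes T x S C) = true ∧
      X.card ≤ (bestYes T x S C).card := by
  have hmem : X ∈ (enumSets fun X => decide (X ⊆ C)).filter (yes T x S) := by
    rw [List.mem_filter, mem_enumSets (subset_down C)]
    exact ⟨.inr (by simpa using hX), hy⟩
  obtain ⟨h1, h2⟩ := largest_spec ((enumSets fun X => decide (X ⊆ C)).filter (yes T x S))
  have h3 := h1.resolve_left (List.ne_nil_of_mem hmem)
  rw [List.mem_filter, mem_enumSets (subset_down C)] at h3
  refine ⟨?_, h3.2, h2 X hmem⟩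
  rcases h3.1 with h | h
  · rw [bestYes, h]; simp
  · exact of_decide_eq_true h

/-- Replacing `X₁` and `X₂` by the largest sets in their cores that pass the test loses nothing in
size, and any two such sets fit together because the cores are not joined by edges. -/
theorem exists_mem_sideCands (hP : P.Hereditary) (hT : P.GluingSound T) {q b : ℕ}
    {A₁ A₂ X₁ X₂ : Finset (Fin x.n)} (hS : x.G.IsClique S) (hA : Disjoint A₁ A₂)
    (hA₁ : Disjoint A₁ S) (hA₂ : Disjoint A₂ S) (h₁ : X₁ ⊆ A₁) (h₂ : X₂ ⊆ A₂)
    (hadj : ∀ u ∈ X₁, ∀ v ∈ X₂, ¬ x.G.Adj u v) (hF : P.MemOn x.G (S ∪ (X₁ ∪ X₂)))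
    (hb₁ : x.n ≤ b * X₁.card) (hb₂ : x.n ≤ b * X₂.card)
    (hy₁ : yes T x S X₁ = true) (hy₂ : yes T x S X₂ = true) :
    ∃ W ∈ sideCands T q b x S A₁ A₂, P.MemOn x.G W ∧ (S ∪ (X₁ ∪ X₂)).card ≤ W.card := by
  rw [sideCands]
  split
  · refine ⟨_, List.mem_map.2 ⟨X₁ ∪ X₂, ?_, rfl⟩, hF, le_rfl⟩
    rw [mem_enumSets (splits_down x A₁ A₂)]
    right
    simp only [splits, Bool.and_eq_true, decide_eq_true_eq, apart_iff]
    refine ⟨Finset.union_subset_union h₁ h₂, fun u hu v hv => hadj u ?_ v ?_⟩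
    · rw [Finset.mem_inter, Finset.mem_union] at hu
      exact hu.1.resolve_right fun h => Finset.disjoint_left.1 hA hu.2 (h₂ h)
    · rw [Finset.mem_inter, Finset.mem_union] at hv
      exact hv.1.resolve_left fun h => Finset.disjoint_left.1 hA (h₁ h) hv.2
  · rename_i hne
    obtain ⟨Q, hQ⟩ := List.exists_mem_of_ne_nil (covers q x A₁ A₂)
      fun h => hne (by simp [h])
    have hQ' := hQ
    rw [covers, List.mem_filter, mem_enumSets (small_down q)] at hQ'
    have hsmall : small q Q = true := hQ'.1.elim (by rintro rfl; simp [small]) fun h => h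
    -- The correct guess is the trace of the solution on `Q`; it is small because `Q` is.
    set U := (X₁ ∪ X₂) ∩ Q with hU
    have hX₁ : X₁ ⊆ core x A₁ A₂ Q U := subset_core h₁ hA hadj
    have hX₂ : X₂ ⊆ core x A₂ A₁ Q U := by
      rw [hU, Finset.union_comm]
      exact subset_core h₂ hA.symm fun u hu v hv h => hadj v hv u hu h.symm
    obtain ⟨h3, h4, h5⟩ := bestYes_spec hX₁ hy₁
    obtain ⟨h6, h7, h8⟩ := bestYes_spec hX₂ hy₂
    have hap := apart_core (U := U) hQ'.2
    have hB₁ := h3.trans (core_subset x A₁ A₂ Q U)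
    have hB₂ := h6.trans (core_subset x A₂ A₁ Q U)
    refine ⟨S ∪ (bestYes T x S (core x A₁ A₂ Q U) ∪ bestYes T x S (core x A₂ A₁ Q U)), ?_, ?_, ?_⟩
    · rw [List.mem_flatMap]
      refine ⟨Q, hQ, ?_⟩
      rw [List.mem_flatMap]
      refine ⟨U, ?_, ?_⟩
      · rw [mem_enumSets (small_down q)]
        exact .inr (small_down q U Q Finset.inter_subset_right hsmall)
      · rw [splitCands, if_pos]
        · simp
        · simp only [Bool.and_eq_true, decide_eq_true_eq]
          exact ⟨hap, hb₁.trans (Nat.mul_le_mul_left _ (Finset.card_le_card hX₁)),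
            hb₂.trans (Nat.mul_le_mul_left _ (Finset.card_le_card hX₂))⟩
    · simp only [yes, decide_eq_true_eq] at h4 h7
      refine memOn_of_answersYes hP hT hS ?_ h4.2 h7.2
      exact fun u hu v hv => apart_iff.1 hap u (h3 hu) v (h6 hv)
    · rw [Finset.card_union_of_disjoint, Finset.card_union_of_disjoint,
        Finset.card_union_of_disjoint, Finset.card_union_of_disjoint]
      · omega
      · exact (hA.mono_left hB₁).mono_right hB₂
      · rw [Finset.disjoint_union_right]
        exact ⟨(hA₁.mono_left hB₁).symm, (hA₂.mono_left hB₂).symm⟩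
      · exact (hA.mono_left h₁).mono_right h₂
      · rw [Finset.disjoint_union_right]
        exact ⟨(hA₁.mono_left h₁).symm, (hA₂.mono_left h₂).symm⟩

/-- A vertex of `X₁` is in `p.1`, or in the rest, or has a neighbour in `p.1`; such a neighbour is
in `X₁ ∪ X₂`, hence in `X₁`. It is neither in `X₂` nor adjacent to `X₂`, so nothing is lost by
removing the other neighbourhood. -/
theorem subset_side {X₁ X₂ : Finset (Fin x.n)} (h₁ : Disjoint X₁ S) (h₁₂ : Disjoint X₁ X₂)
    (hadj : ∀ u ∈ X₁, ∀ v ∈ X₂, ¬ x.G.Adj u v) {p : Finset (Fin x.n) × Finset (Fin x.n)}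
    (hY : p.1 ⊆ X₁ ∪ X₂) (hF : X₁ ∪ X₂ ⊆ p.1 ∪ p.2) :
    X₁ ⊆ side x S (X₁ ∩ (p.1 ∪ rest x p)) (X₂ ∩ (p.1 ∪ rest x p)) := by
  intro v hv
  simp only [side, Finset.mem_sdiff, Finset.mem_union, not_or]
  refine ⟨?_, fun h => ?_, Finset.disjoint_left.1 h₁ hv⟩
  · simp only [cnb, Finset.mem_union, Finset.mem_inter, mem_nb, hv, true_and]
    by_cases h1 : v ∈ p.1
    · exact .inl (.inl h1)
    have h2 : v ∈ p.2 := (Finset.mem_union.1 (hF (Finset.mem_union_left _ hv))).resolve_left h1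
    by_cases h3 : v ∈ cnb x.G p.1
    · simp only [cnb, Finset.mem_union, mem_nb, h1, false_or] at h3
      obtain ⟨w, hw, hvw⟩ := h3
      refine .inr ⟨w, ⟨?_, .inl hw⟩, hvw⟩
      exact (Finset.mem_union.1 (hY hw)).resolve_right fun h => hadj v hv w h hvw
    · exact .inl (.inr (by simp [rest, h2, h3]))
  · simp only [cnb, Finset.mem_union, Finset.mem_inter, mem_nb] at h
    rcases h with h | ⟨w, hw, hvw⟩
    · exact Finset.disjoint_left.1 h₁₂ hv h.1
    · exact hadj v hv w hw.1 hvw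

/-! ### Some candidate is a maximum solution -/

theorem exists_mem_allCands (hP : P.Hereditary) (hk : P.ForbiddenBound k) (hT : P.GluingSound T)
    (hsep : P.SeparatorComplete T) {a D r z q b d : ℕ} (hb : b = 6 * d) (ha : b ≤ a) (ha' : 1 ≤ a)
    (hD : 2 * z ≤ D) (hr : 2 * z ≤ r) {F : Finset (Fin x.n)} (hF : P.MemOn x.G F)
    (hmax : ∀ W, P.MemOn x.G W → W.card ≤ F.card) :
    ∃ W ∈ allCands P T a D r z q b x d, P.MemOn x.G W ∧ F.card ≤ W.card := by
  simp only [allCands, List.mem_append]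
  by_cases hd : d * F.card ≤ x.n
  · refine ⟨F, .inl ?_, hF, le_rfl⟩
    rw [mem_enumSets (small_down d)]
    exact .inr (by simpa [small] using hd)
  -- `F` is nonempty here, and all graphs with one vertex are isomorphic.
  have hone : ∀ v : Fin x.n, P.MemOn x.G {v} := by
    have hne : F.Nonempty := by
      rw [← Finset.card_pos]
      rcases Nat.eq_zero_or_pos F.card with h | h
      · rw [h] at hd; omega
      · exact h
    obtain ⟨w, hw⟩ := hne
    have h1 : P.MemOn x.G {w} := hF.mono hP (by simpa using hw)
    intro v
    refine GraphClass.mem_of_embedding hP ⟨⟨fun _ => ⟨w, by simp⟩, ?_⟩, ?_⟩ h1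
    · rintro ⟨u, hu⟩ ⟨u', hu'⟩ _
      simp only [Finset.coe_singleton, Set.mem_singleton_iff] at hu hu'
      exact Subtype.ext (hu.trans hu'.symm)
    · rintro ⟨u, hu⟩ ⟨u', hu'⟩
      simp only [Finset.coe_singleton, Set.mem_singleton_iff] at hu hu'
      subst hu hu'
      simp
  rcases hK : largeCliques a x with _ | ⟨K, Ks⟩
  · obtain ⟨S, X₁, X₂, hS, h1, h2, h12, rfl, hc1, hc2, hadj, hy1, hy2⟩ := exists_separator hsep hF
    have hSs : a * S.card ≤ x.n := isClique_of_largeCliques_eq_nil ha' hK hS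
    have hSmem : S ∈ (enumSets (small a)).filter (isCl x) := by
      rw [List.mem_filter, mem_enumSets (small_down a)]
      exact ⟨.inr (by simpa [small] using hSs), by simpa [isCl] using hS⟩
    obtain ⟨p, hp, hY, hYC⟩ := exists_mem_coverStates (D := D) (S := S) (F := X₁ ∪ X₂)
      (by rw [Finset.disjoint_union_left]; exact ⟨h1, h2⟩)
    have hI := coverInv_of_mem hp
    have hcard : (S ∪ (X₁ ∪ X₂)).card = S.card + (X₁.card + X₂.card) := by
      rw [Finset.card_union_of_disjoint, Finset.card_union_of_disjoint h12]
      rw [Finset.disjoint_union_right]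
      exact ⟨h1.symm, h2.symm⟩
    by_cases hrest : small r (rest x p) = true
    -- `2 * z ≤ D` and `2 * z ≤ r` split the budget: `p.1` and the rest each have at most `n / (2z)`
    -- vertices.
    · have hsize : ∀ X, small z (X ∩ (p.1 ∪ rest x p)) = true := fun X => by
        simp only [small, decide_eq_true_eq] at hrest ⊢
        have h3 := Finset.card_le_card
          (Finset.inter_subset_right : X ∩ (p.1 ∪ rest x p) ⊆ p.1 ∪ rest x p)
        have h4 := Finset.card_union_le p.1 (rest x p)
        have h5 := hI.card_le.trans ((Finset.card_le_univ _).trans_eq (Fintype.card_fin _))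
        have h6 := Nat.mul_le_mul_right p.1.card hD
        have h7 := Nat.mul_le_mul_right (rest x p).card hr
        have h8 := Nat.mul_le_mul_left z (h3.trans h4)
        nlinarith
      -- Balance gives `|F| ≤ 3|S| + 3|X'|`. With `d|F| > n` and `6d|S| ≤ n` this leaves `n ≤
      -- 6d|X'|`, hence `b = 6 * d`.
      have hbig : ∀ X X' : Finset (Fin x.n), 3 * X.card ≤ 2 * (S ∪ (X₁ ∪ X₂)).card →
          (S ∪ (X₁ ∪ X₂)).card = S.card + (X.card + X'.card) → x.n ≤ b * X'.card := by
        intro X X' h3 h4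
        have h5 := Nat.mul_le_mul_right S.card ha
        rw [hb] at h5 ⊢
        push Not at hd
        have h6 : (S ∪ (X₁ ∪ X₂)).card ≤ 3 * S.card + 3 * X'.card := by omega
        have h7 := Nat.mul_le_mul_left (2 * d) h6
        nlinarith
      obtain ⟨W, hW, hWmem, hWc⟩ := exists_mem_sideCands hP hT (q := q) (b := b)
        (A₁ := side x S (X₁ ∩ (p.1 ∪ rest x p)) (X₂ ∩ (p.1 ∪ rest x p)))
        (A₂ := side x S (X₂ ∩ (p.1 ∪ rest x p)) (X₁ ∩ (p.1 ∪ rest x p))) hS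
        (side_disjoint _ _ _ _) (side_disjoint_left _ _ _ _) (side_disjoint_left _ _ _ _)
        (subset_side h1 h12 hadj hY hYC)
        (subset_side h2 h12.symm (fun u hu v hv h => hadj v hv u hu h.symm)
          (by rwa [Finset.union_comm]) (by rwa [Finset.union_comm]))
        hadj hF (hbig X₂ X₁ hc2 (by omega)) (hbig X₁ X₂ hc1 hcard)
        (by simpa [yes] using ⟨hS, hy1⟩) (by simpa [yes] using ⟨hS, hy2⟩)
      refine ⟨W, .inr (.inr (.inr ?_)), hWmem, hWc⟩
      simp only [separatedCands, List.mem_flatMap]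
      exact ⟨S, hSmem, _, (mem_enumSets (small_down z)).2 (.inr (hsize X₁)), _,
        (mem_enumSets (small_down z)).2 (.inr (hsize X₂)), hW⟩
    · refine ⟨_, .inr (.inr (.inl ?_)), hF, le_rfl⟩
      simp only [dominatingCands, List.mem_flatMap]
      refine ⟨S, hSmem, p, hp, ?_⟩
      rw [if_neg hrest, List.mem_map]
      -- The set to be deleted from `p.2` is its part outside the solution.
      have hW : p.1 ∪ (p.2 \ (p.2 \ (X₁ ∪ X₂))) = X₁ ∪ X₂ := by
        ext v
        have h3 := @hY v
        have h4 := @hYC v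
        simp only [Finset.mem_union, Finset.mem_sdiff] at *
        tauto
      refine ⟨p.2 \ (X₁ ∪ X₂), ?_, by rw [hW]⟩
      rw [mem_enumSets (fewUndominated_down D x S p)]
      right
      simp only [fewUndominated, Bool.and_eq_true, decide_eq_true_eq, hW]
      exact ⟨Finset.sdiff_subset, card_undominated_le hP hk hone
        (hF.mono hP Finset.subset_union_right) (Finset.card_union_le _ _) hmax hI⟩
  -- The correct guess outside `K` is `F \ K`; the search then decides the vertices of `K`.
  · obtain ⟨p, hp, h1, h2⟩ := exists_mem_hitSearch (P := P) hP hF (W := (F \ K) ∪ K) (U := K)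
      (fun v hv => by simp only [Finset.mem_union, Finset.mem_sdiff]; tauto)
      (fun v hv => by simp only [Finset.mem_union, Finset.mem_sdiff] at hv; tauto)
    refine ⟨p.1, .inr (.inl ?_), h2, Finset.card_le_card h1⟩
    simp only [cliqueCands, hK, List.mem_flatMap, List.mem_map]
    refine ⟨K, by simp, F \ K, ?_, p, hp, rfl⟩
    rw [mem_enumSets (subset_down _)]
    right
    simp

theorem result_isMaximumInduced (hP : P.Hereditary) (hk : P.ForbiddenBound k)
    (hT : P.GluingSound T) (hsep : P.SeparatorComplete T) {a D r z q b d : ℕ} (hb : b = 6 * d)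
    (ha : b ≤ a) (ha' : 1 ≤ a) (hD : 2 * z ≤ D) (hr : 2 * z ≤ r) :
    P.IsMaximumInduced x.G (result P T a D r z q b x d) := by
  classical
  obtain ⟨F, hF, hmax⟩ := Finset.exists_max_image
    (Finset.univ.filter fun W : Finset (Fin x.n) => P.MemOn x.G W) Finset.card
    ⟨∅, by simpa using GraphClass.memOn_empty hP hk⟩
  simp only [Finset.mem_filter, Finset.mem_univ, true_and] at hF hmax
  obtain ⟨W, hW, hWm, hWc⟩ := exists_mem_allCands (q := q) hP hk hT hsep hb ha ha' hD hr hF hmax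
  have hW' : W ∈ (allCands P T a D r z q b x d).filter (inClass P x) :=
    List.mem_filter.2 ⟨hW, GraphClass.inClass_iff.2 hWm⟩
  obtain ⟨h1, h2⟩ := largest_spec ((allCands P T a D r z q b x d).filter (inClass P x))
  refine ⟨?_, fun W' hW' => ?_⟩
  · exact GraphClass.inClass_iff.1 (List.mem_filter.1 (h1.resolve_left (List.ne_nil_of_mem hW'))).2
  · exact (hmax W' hW').trans (hWc.trans (h2 W ‹_›))

end

/-! ### Counting -/

/-- Weighting a set `W` by `y^|W|` replaces entropy estimates: all subsets together weigh `(1 +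
y)^n`, and a set of at most `n / c` elements alone weighs nearly that much. Half of the exponent
pays for `(1 + y)^n`, the other half for `y^(-m)`. -/
theorem exists_weight {η : ℝ} (hη : 0 < η) : ∃ (y : ℝ) (c₀ : ℕ), 0 < y ∧ ∀ c ≥ c₀, ∀ n m : ℕ,
    c * m ≤ n → (1 + y) ^ n ≤ 2 ^ (η * n) * y ^ m := by
  have h1 : (1 : ℝ) < 2 ^ (η / 2) := Real.one_lt_rpow (by norm_num) (by positivity)
  obtain ⟨y, hy0, hy⟩ : ∃ y : ℝ, 0 < y ∧ 1 + y ≤ 2 ^ (η / 2) :=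
    ⟨2 ^ (η / 2) - 1, by linarith, by linarith⟩
  refine ⟨y, ⌈-2 * Real.logb 2 y / η⌉₊, hy0, fun c hc n m hm => ?_⟩
  have h2 : -2 * Real.logb 2 y / η ≤ c := Nat.ceil_le.1 hc
  rw [div_le_iff₀ hη] at h2
  have h3 : (c : ℝ) * m ≤ n := by exact_mod_cast hm
  have h4 : y ^ m = 2 ^ (Real.logb 2 y * m) := by
    rw [Real.rpow_mul (by norm_num), Real.rpow_logb (by norm_num) (by norm_num) hy0,
      Real.rpow_natCast]
  rw [h4, ← Real.rpow_add (by norm_num)]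
  calc (1 + y) ^ n ≤ ((2 : ℝ) ^ (η / 2)) ^ n := by gcongr
    _ = 2 ^ (η / 2 * n) := by rw [Real.rpow_mul (by norm_num), Real.rpow_natCast]
    _ ≤ _ := by
      refine Real.rpow_le_rpow_of_exponent_le (by norm_num) ?_
      have h5 := mul_le_mul_of_nonneg_right h2 (Nat.cast_nonneg (α := ℝ) m)
      have h6 := mul_le_mul_of_nonneg_left h3 hη.le
      linarith

/-- The number of small sets is `2 ^ (η * n)` for every `η > 0`. -/
theorem exists_numSets_small_le {η : ℝ} (hη : 0 < η) : ∃ c₀ : ℕ, ∀ c ≥ c₀, ∀ n : ℕ,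
    (numSets (small c (n := n)) : ℝ) ≤ 2 ^ (η * n) := by
  obtain ⟨y, c₀, hy, h⟩ := exists_weight hη
  refine ⟨c₀, fun c hc n => ?_⟩
  -- Each small set carries at least the fraction `2^(-ηn)` of the total weight.
  have h1 : ∑ W ∈ Finset.univ.filter fun W : Finset (Fin n) => small c W = true, (1 + y) ^ n ≤
      ∑ W ∈ Finset.univ.filter fun W : Finset (Fin n) => small c W = true,
        2 ^ (η * n) * y ^ W.card :=
    Finset.sum_le_sum fun W hW => h c hc n _ (by simpa [small] using hW)
  rw [Finset.sum_const, ← Finset.mul_sum, nsmul_eq_mul] at h1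
  have h2 : ∑ W ∈ Finset.univ.filter fun W : Finset (Fin n) => small c W = true, y ^ W.card ≤
      (1 + y) ^ n := by
    have h3 := Fintype.sum_pow_mul_eq_add_pow (Fin n) y (1 : ℝ)
    simp only [one_pow, mul_one, Fintype.card_fin] at h3
    rw [add_comm, ← h3]
    exact Finset.sum_le_sum_of_subset_of_nonneg (Finset.filter_subset _ _)
      fun _ _ _ => by positivity
  exact le_of_mul_le_mul_right (h1.trans (mul_le_mul_of_nonneg_left h2 (by positivity)))
    (by positivity : 0 < (1 + y) ^ n)

/-- A potential argument: the children of a node together weigh no more than the node, so the last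
level weighs no more than the root. The index of `φ` decreases by one in each round. -/
theorem sum_foldl_le {α β : Type*} {F : α → β → List β} {I : β → Prop} {φ : ℕ → β → ℝ}
    {L : List β} {l : List α} (m : ℕ) (h₀ : ∀ p ∈ L, I p)
    (hstep : ∀ v ∈ l, ∀ m p, I p →
      (∀ p' ∈ F v p, I p') ∧ ((F v p).map (φ m)).sum ≤ φ (m + 1) p) :
    ((l.foldl (fun L v => L.flatMap (F v)) L).map (φ m)).sum ≤
      (L.map (φ (m + l.length))).sum := by
  induction l generalizing L with
  | nil => simp
  | cons v l ih =>
    have hv := hstep v List.mem_cons_self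
    refine (ih (L := L.flatMap (F v)) (fun p hp => ?_)
      fun w hw => hstep w (List.mem_cons_of_mem _ hw)).trans ?_
    · obtain ⟨p', hp', hp⟩ := List.mem_flatMap.1 hp
      exact (hv 0 p' (h₀ p' hp')).1 p hp
    · rw [List.map_flatMap, List.flatMap, List.sum_flatten, List.map_map, List.length_cons,
        ← add_assoc]
      exact List.sum_le_sum fun p hp => (hv _ p (h₀ p hp)).2

/-! ### Disjoint blocks and an exponential tail bound -/

section packing

variable {ι V : Type*} [DecidableEq ι] [DecidableEq V]

/-- Greedy choice of a maximal disjoint subfamily. Nonemptiness makes a chosen block meet the union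
itself. -/
theorem exists_packing (I : Finset ι) (B : ι → Finset V) (hB : ∀ i ∈ I, (B i).Nonempty) :
    ∃ J ⊆ I, (J : Set ι).PairwiseDisjoint B ∧ ∀ i ∈ I, ¬ Disjoint (B i) (J.biUnion B) := by
  induction I using Finset.induction_on with
  | empty => exact ⟨∅, by simp⟩
  | insert i I hi ih =>
    obtain ⟨J, hJI, hJ, h⟩ := ih fun i hi => hB i (Finset.mem_insert_of_mem hi)
    by_cases hd : Disjoint (B i) (J.biUnion B)
    · refine ⟨insert i J, Finset.insert_subset_insert i hJI, ?_, fun j hj => ?_⟩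
      · rw [Finset.coe_insert, Set.pairwiseDisjoint_insert]
        exact ⟨hJ, fun j hj _ => (Finset.disjoint_biUnion_right _ _ _).1 hd j hj⟩
      · rw [Finset.biUnion_insert, Finset.disjoint_union_right]
        rcases Finset.mem_insert.1 hj with rfl | hj
        · exact fun h' => (hB j (Finset.mem_insert_self _ _)).ne_empty (disjoint_self.1 h'.1)
        · exact fun h' => h j hj h'.2
    · refine ⟨J, hJI.trans (Finset.subset_insert _ _), hJ, fun j hj => ?_⟩
      rcases Finset.mem_insert.1 hj with rfl | hj
      · exact hd
      · exact h j hj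

/-- `E` contains `B` with probability `2^(-|B|)`, independently of `f`. Formally, sets are grouped
by `E ∪ B`, and a group injects into the subsets of `B` via `E ∩ B`. -/
theorem sum_powerset_le {B C : Finset V} (hB : B ⊆ C) {f : Finset V → ℝ} (h₀ : ∀ E, 0 ≤ f E)
    (hf : ∀ E, f (E ∪ B) = f E) :
    ∑ E ∈ C.powerset, f E ≤ 2 ^ B.card * ∑ E ∈ C.powerset with B ⊆ E, f E := by
  rw [← Finset.sum_fiberwise_of_maps_to (g := fun E => E ∪ B)
    (t := C.powerset.filter fun E => B ⊆ E) ?_, Finset.mul_sum]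
  · refine Finset.sum_le_sum fun E' _ => ?_
    have h1 : ∑ E ∈ C.powerset with E ∪ B = E', f E = ∑ E ∈ C.powerset with E ∪ B = E', f E' :=
      Finset.sum_congr rfl fun E hE => by
        rw [← hf E, (Finset.mem_filter.1 hE).2]
    rw [h1, Finset.sum_const, nsmul_eq_mul]
    refine mul_le_mul_of_nonneg_right ?_ (h₀ _)
    have h2 : (C.powerset.filter fun E => E ∪ B = E').card ≤ B.powerset.card := by
      refine Finset.card_le_card_of_injOn (fun E => E ∩ B) (fun E _ => by simp) ?_
      intro E₁ hE₁ E₂ hE₂ h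
      simp only [Finset.coe_filter, Set.mem_ofPred_eq] at hE₁ hE₂ h
      have h3 := hE₁.2.trans hE₂.2.symm
      ext v
      have h4 := Finset.ext_iff.1 h v
      have h5 := Finset.ext_iff.1 h3 v
      simp only [Finset.mem_inter, Finset.mem_union] at h4 h5
      tauto
    rw [Finset.card_powerset] at h2
    exact_mod_cast h2
  · intro E hE
    simp only [Finset.mem_filter, Finset.mem_powerset] at hE ⊢
    exact ⟨Finset.union_subset hE hB, Finset.subset_union_right⟩

/-- For a random `E` the factors are independent, the blocks being disjoint, and a block of at most
`s` elements has mean `1 - 2^(-|B j|) / 2 ≤ 1 - (1/2)^(s+1)`. -/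
theorem sum_prod_ite_le {s : ℕ} {B : ι → Finset V} {C : Finset V} {J : Finset ι}
    (hJ : (J : Set ι).PairwiseDisjoint B) (hC : ∀ j ∈ J, B j ⊆ C) (hs : ∀ j ∈ J, (B j).card ≤ s) :
    ∑ E ∈ C.powerset, ∏ j ∈ J, (if B j ⊆ E then (1 / 2 : ℝ) else 1) ≤
      2 ^ C.card * (1 - (1 / 2) ^ (s + 1)) ^ J.card := by
  induction J using Finset.induction_on with
  | empty => simp
  | insert i J hi ih =>
    rw [Finset.coe_insert, Set.pairwiseDisjoint_insert] at hJ
    have ih := ih hJ.1 (fun j hj => hC j (Finset.mem_insert_of_mem hj))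
      fun j hj => hs j (Finset.mem_insert_of_mem hj)
    set f : Finset V → ℝ := fun E => ∏ j ∈ J, (if B j ⊆ E then (1 / 2 : ℝ) else 1) with hf
    have h₀ : ∀ E, 0 ≤ f E := fun E => Finset.prod_nonneg fun j _ => by split <;> norm_num
    have hfB : ∀ E, f (E ∪ B i) = f E := fun E => Finset.prod_congr rfl fun j hj => by
      have : Disjoint (B i) (B j) := hJ.2 j hj fun h => hi (h ▸ hj)
      have h1 : B j ⊆ E ∪ B i ↔ B j ⊆ E := by
        refine ⟨fun h v hv => (Finset.mem_union.1 (h hv)).resolve_right fun h' =>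
          Finset.disjoint_left.1 this h' hv, fun h => h.trans Finset.subset_union_left⟩
      simp only [h1]
    have h1 := sum_powerset_le (hC i (Finset.mem_insert_self _ _)) h₀ hfB
    have h2 : ∑ E ∈ C.powerset, ∏ j ∈ insert i J, (if B j ⊆ E then (1 / 2 : ℝ) else 1) =
        ∑ E ∈ C.powerset, f E - 1 / 2 * ∑ E ∈ C.powerset with B i ⊆ E, f E := by
      rw [Finset.mul_sum, Finset.sum_filter, ← Finset.sum_sub_distrib]
      refine Finset.sum_congr rfl fun E _ => ?_
      rw [Finset.prod_insert hi]
      change _ * f E = _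
      split <;> ring
    have h3 : (2 : ℝ) ^ (B i).card ≤ 2 ^ s :=
      pow_le_pow_right₀ (by norm_num) (hs i (Finset.mem_insert_self _ _))
    have h4 : 0 ≤ ∑ E ∈ C.powerset with B i ⊆ E, f E := Finset.sum_nonneg fun E _ => h₀ E
    have h5 := h1.trans (mul_le_mul_of_nonneg_right h3 h4)
    have h6 : (1 / 2 : ℝ) ^ (s + 1) * ∑ E ∈ C.powerset, f E ≤
        1 / 2 * ∑ E ∈ C.powerset with B i ⊆ E, f E := by
      refine (mul_le_mul_of_nonneg_left h5 (by positivity)).trans (le_of_eq ?_)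
      have : (1 / 2 : ℝ) ^ s * 2 ^ s = 1 := by rw [← mul_pow]; norm_num
      rw [pow_succ, ← mul_assoc, mul_right_comm ((1 / 2 : ℝ) ^ s), this, one_mul]
    have h7 : 0 ≤ 1 - (1 / 2 : ℝ) ^ (s + 1) := by
      have := pow_le_one₀ (n := s + 1) (by norm_num : (0 : ℝ) ≤ 1 / 2) (by norm_num)
      linarith
    rw [h2, Finset.card_insert_of_notMem hi, pow_succ]
    have h8 := mul_le_mul_of_nonneg_right ih h7
    linarith

/-- Few sets contain only few members of a large family of disjoint small sets. -/
theorem card_few_le {s j₀ : ℕ} {B : ι → Finset V} {C : Finset V} {J : Finset ι}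
    (hJ : (J : Set ι).PairwiseDisjoint B) (hC : ∀ j ∈ J, B j ⊆ C) (hs : ∀ j ∈ J, (B j).card ≤ s) :
    ((C.powerset.filter fun E => (J.filter fun j => B j ⊆ E).card ≤ j₀).card : ℝ) ≤
      2 ^ C.card * (1 - (1 / 2) ^ (s + 1)) ^ J.card * 2 ^ j₀ := by
  -- Markov's inequality: a set containing at most `j₀` blocks contributes at least `(1/2)^j₀`.
  have h1 : ∑ E ∈ C.powerset.filter (fun E => (J.filter fun j => B j ⊆ E).card ≤ j₀),
      (1 / 2 : ℝ) ^ j₀ ≤ ∑ E ∈ C.powerset, ∏ j ∈ J, (if B j ⊆ E then (1 / 2 : ℝ) else 1) := by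
    refine (Finset.sum_le_sum fun E hE => ?_).trans (Finset.sum_le_sum_of_subset_of_nonneg
      (Finset.filter_subset _ _) fun E _ _ => Finset.prod_nonneg fun j _ => by split <;> norm_num)
    rw [Finset.prod_ite, Finset.prod_const, Finset.prod_const_one, mul_one]
    exact pow_le_pow_of_le_one (by norm_num) (by norm_num) (Finset.mem_filter.1 hE).2
  rw [Finset.sum_const, nsmul_eq_mul] at h1
  have h2 := h1.trans (sum_prod_ite_le hJ hC hs)
  have h3 := mul_le_mul_of_nonneg_right h2 (by positivity : (0 : ℝ) ≤ 2 ^ j₀)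
  rwa [mul_assoc, ← mul_pow, show (1 / 2 * 2 : ℝ) = 1 by norm_num, one_pow, mul_one] at h3

end packing

/-! ### Sizes of the search trees and of the enumerated families -/

section

variable {P : GraphClass} {x : Inp} {k : ℕ} {D r q : ℕ} {S : Finset (Fin x.n)}

/-- Weigh a state by `y^|p.1|`. A branching multiplies the weight by `1 + y`, so a level weighs at
most `(1 + y)^n`; since `|p.1| ≤ n / D`, each single state weighs at least `(1 + y)^n * 2^(-ηn)`. -/
theorem exists_levels_coverStep_le {η : ℝ} (hη : 0 < η) : ∃ D₀ : ℕ, ∀ D ≥ D₀, 1 ≤ D →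
    ∀ (x : Inp) (S : Finset (Fin x.n)),
    (levels (fun v p => coverStep D x S p v) [(∅, ∅)] (singles x.n) : ℝ) ≤
      (x.n + 1) * 2 ^ (η * x.n) := by
  obtain ⟨y, D₀, hy, h⟩ := exists_weight hη
  refine ⟨D₀, fun D hD hD' x S => ?_⟩
  have key : ∀ l₁ l₂, singles x.n = l₁ ++ l₂ →
      (l₁.foldl (fun L v => L.flatMap fun p => coverStep D x S p v) [(∅, ∅)]).length ≤
        ⌊(2 : ℝ) ^ (η * x.n)⌋₊ := by
    intro l₁ l₂ hl
    have hmem : ∀ v ∈ l₁, v ∈ singles x.n := fun v hv => hl ▸ List.mem_append_left _ hv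
    have h1 := sum_foldl_le (F := fun v p => coverStep D x S p v) (I := CoverInv D x S)
      (φ := fun m p => y ^ p.1.card * (1 + y) ^ m) (L := [(∅, ∅)]) (l := l₁) 0
      (by simpa using CoverInv.empty) ?_
    · have hinv : ∀ p ∈ l₁.foldl (fun L v => L.flatMap fun p => coverStep D x S p v) [(∅, ∅)],
          CoverInv D x S p :=
        rounds_invariant (F := fun v p => coverStep D x S p v) (by simpa using CoverInv.empty)
          fun v hv p hI p' hp' => hI.step (hmem v hv) hp'
      generalize l₁.foldl (fun L v => L.flatMap fun p => coverStep D x S p v) [(∅, ∅)] = L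
        at h1 hinv ⊢
      rw [Nat.le_floor_iff (by positivity)]
      have h2 : (L.map fun _ => (1 + y) ^ x.n).sum ≤
          (L.map fun p => 2 ^ (η * x.n) * (y ^ p.1.card * (1 + y) ^ 0)).sum := by
        refine List.sum_le_sum fun p hp => ?_
        rw [pow_zero, mul_one]
        exact h D hD _ _ ((hinv p hp).card_le.trans
          ((Finset.card_le_univ _).trans_eq (Fintype.card_fin _)))
      rw [List.sum_map_mul_left, List.map_const', List.sum_replicate, nsmul_eq_mul] at h2
      have h3 : (1 + y) ^ l₁.length ≤ (1 + y) ^ x.n := by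
        refine pow_le_pow_right₀ (by linarith) ?_
        have := congrArg List.length hl
        rw [length_singles, List.length_append] at this
        omega
      simp only [List.map_cons, List.map_nil, List.sum_singleton, Finset.card_empty, pow_zero,
        one_mul, zero_add] at h1
      exact le_of_mul_le_mul_right (h2.trans (mul_le_mul_of_nonneg_left
        (by simpa using h1.trans h3) (by positivity))) (by positivity : 0 < (1 + y) ^ x.n)
    · intro v hv m p hI
      refine ⟨fun p' hp' => hI.step (hmem v hv) hp', ?_⟩
      obtain ⟨i, rfl⟩ := mem_singles.1 (hmem v hv)
      have hm : (1 + y) ^ m ≤ (1 + y) ^ (m + 1) := pow_le_pow_right₀ (by linarith) (Nat.le_succ m)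
      simp only [coverStep, decide_eq_true_eq]
      split
      · simpa using mul_le_mul_of_nonneg_left hm (by positivity)
      · split
        · rename_i h'
          -- A vertex of `p.1` has all neighbours in `cnb x.G p.1`; as `D ≥ 1` it is not eligible,
          -- so `p.1` really grows.
          have hi : i ∉ p.1 := fun hi => by
            have : nb x.G {i} \ (S ∪ cnb x.G p.1) = ∅ := by
              rw [Finset.sdiff_eq_empty_iff_subset]
              refine (nb_mono x.G (Finset.singleton_subset_iff.2 hi)).trans ?_
              exact Finset.subset_union_right.trans Finset.subset_union_right
            rw [this] at h'
            simp at h'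
            omega
          rw [List.map_cons, List.map_singleton, List.sum_cons, List.sum_singleton,
            Finset.union_comm, ← Finset.insert_eq, Finset.card_insert_of_notMem hi]
          exact le_of_eq (by ring)
        · simpa using mul_le_mul_of_nonneg_left hm (by positivity)
  have h1 : (levels (fun v p => coverStep D x S p v) [(∅, ∅)] (singles x.n) : ℝ) ≤
      (x.n + 1) * (⌊(2 : ℝ) ^ (η * x.n)⌋₊ : ℝ) := by
    have := levels_le (fun v p => coverStep D x S p v) [(∅, ∅)] key
    rw [length_singles] at this
    exact_mod_cast this
  exact h1.trans (mul_le_mul_of_nonneg_left (Nat.floor_le (by positivity)) (by positivity))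

/-- Each round either makes two states with the same second component or enlarges that component by
at most one vertex. So counting `2` for every vertex still to be scanned, the total weight never
increases. -/
theorem sum_two_pow_coverStates_le (D : ℕ) (x : Inp) (S : Finset (Fin x.n)) :
    ((coverStates D x S).map fun p => (2 : ℝ) ^ p.2.card).sum ≤ 2 ^ x.n := by
  have h1 := sum_foldl_le (F := fun v p => coverStep D x S p v) (I := fun _ => True)
    (φ := fun m p => (2 : ℝ) ^ (p.2.card + m)) (L := [(∅, ∅)]) (l := singles x.n) 0 (by simp) ?_
  · simpa [coverStates, length_singles] using h1
  · intro v hv m p _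
    refine ⟨fun _ _ => trivial, ?_⟩
    obtain ⟨i, rfl⟩ := mem_singles.1 hv
    have hpow : ∀ {i j : ℕ}, i ≤ j → (2 : ℝ) ^ i ≤ 2 ^ j := fun h =>
      pow_le_pow_right₀ (by norm_num) h
    simp only [coverStep]
    split
    · simpa using hpow (by omega : p.2.card + m ≤ p.2.card + (m + 1))
    · split
      · simp only [List.map_cons, List.map_nil, List.sum_cons, List.sum_nil]
        exact le_of_eq (by ring)
      · have := Finset.card_union_le p.2 {i}
        rw [Finset.card_singleton] at this
        simpa using hpow (by omega : (p.2 ∪ {i}).card + m ≤ p.2.card + (m + 1))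

/-- The ends of a maximal matching cover all edges between the sides, so by `h` the matching is
large. A set without edges between the sides contains no matching edge entirely. -/
theorem exists_numSets_splits_le {A₁ A₂ : Finset (Fin x.n)} (h : covers q x A₁ A₂ = []) :
    ∃ m : ℕ, x.n ≤ 2 * q * m ∧ (numSets (splits x A₁ A₂) : ℝ) ≤ 2 ^ x.n * (7 / 8) ^ m := by
  classical
  obtain ⟨J, hJI, hJ, hhit⟩ := exists_packing
    ((A₁ ×ˢ A₂).filter fun e => x.G.Adj e.1 e.2) (fun e => {e.1, e.2})
    fun e _ => ⟨e.1, by simp⟩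
  have hs : ∀ e ∈ J, ({e.1, e.2} : Finset (Fin x.n)).card ≤ 2 := fun e _ => Finset.card_le_two
  refine ⟨J.card, ?_, ?_⟩
  · by_contra hlt
    set Q := J.biUnion fun e => ({e.1, e.2} : Finset (Fin x.n)) with hQ
    have hQc : Q.card ≤ J.card * 2 := Finset.card_biUnion_le_card_mul _ _ _ hs
    have hmem : Q ∈ covers q x A₁ A₂ := by
      rw [covers, List.mem_filter, mem_enumSets (small_down q)]
      refine ⟨.inr ?_, apart_iff.2 fun u hu v hv huv => ?_⟩
      · rw [small, decide_eq_true_eq]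
        have := Nat.mul_le_mul_left q hQc
        nlinarith
      · rw [Finset.mem_sdiff] at hu hv
        refine hhit (u, v) (by simp [hu.1, hv.1, huv]) ?_
        rw [Finset.disjoint_left]
        intro w hw
        simp only [Finset.mem_insert, Finset.mem_singleton] at hw
        rcases hw with rfl | rfl
        · exact hu.2
        · exact hv.2
    rw [h] at hmem
    simp at hmem
  -- Blocks have at most two vertices, so the factor is `1 - (1/2)^3 = 7/8`.
  · have h1 := card_few_le (j₀ := 0) (C := Finset.univ) hJ (fun _ _ => Finset.subset_univ _) hs
    rw [Finset.card_univ, Fintype.card_fin, pow_zero, mul_one] at h1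
    norm_num at h1
    refine le_trans ?_ h1
    rw [Nat.cast_le]
    refine Finset.card_le_card fun W hW => ?_
    simp only [Finset.mem_filter, Finset.mem_univ, true_and] at hW ⊢
    simp only [splits, Bool.and_eq_true, decide_eq_true_eq, apart_iff] at hW
    intro u v he hsub
    have he' := hJI he
    simp only [Finset.mem_filter, Finset.mem_product] at he'
    exact hW.2 u (Finset.mem_inter.2 ⟨hsub (by simp), he'.1.1⟩) v
      (Finset.mem_inter.2 ⟨hsub (by simp), he'.1.2⟩) he'.2

open Classical in
theorem card_adj_rest_lt {p : Finset (Fin x.n) × Finset (Fin x.n)} (hI : CoverInv D x S p)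
    {c : Fin x.n} (hc : c ∈ p.2) : ((rest x p).filter fun v => x.G.Adj v c).card < D := by
  refine (Finset.card_le_card fun v hv => ?_).trans_lt (hI.deg_lt c hc)
  simp only [rest, Finset.mem_filter, Finset.mem_sdiff] at hv
  simp only [Finset.mem_sdiff, Finset.mem_union, mem_nb, Finset.mem_singleton, exists_eq_left,
    not_or]
  exact ⟨hv.2, hI.notMem v hv.1.1, by simpa using hv.1.2⟩

/-- Half of the rest has bounded degree. -/
theorem card_low_le {p : Finset (Fin x.n) × Finset (Fin x.n)} (hI : CoverInv D x S p)
    (hr : x.n < r * (rest x p).card) (hD : 1 ≤ D) :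
    x.n ≤ 2 * r * ((rest x p).filter fun v => (nb x.G {v} ∩ p.2).card < 2 * D * r).card := by
  classical
  set low := (rest x p).filter fun v => (nb x.G {v} ∩ p.2).card < 2 * D * r
  set high := (rest x p).filter fun v => ¬ (nb x.G {v} ∩ p.2).card < 2 * D * r with hhigh
  have h1 : low.card + high.card = (rest x p).card := Finset.card_filter_add_card_filter_not _
  -- Double counting of edges between `high` and `p.2`: at least `2 * D * r` at each vertex of
  -- `high`, fewer than `D` at each vertex of `p.2`. So at most `n / (2r)` vertices are high.
  have h2 : high.card * (2 * D * r) ≤ p.2.card * D := by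
    refine Finset.card_mul_le_card_mul (fun v c => x.G.Adj v c) (fun v hv => ?_) fun c hc => ?_
    · rw [hhigh, Finset.mem_filter, not_lt] at hv
      refine hv.2.trans (Finset.card_le_card fun c hc => ?_)
      simp only [Finset.mem_inter, mem_nb, Finset.mem_singleton, exists_eq_left] at hc
      simp only [Finset.bipartiteAbove, Finset.mem_filter]
      exact ⟨hc.2, hc.1.symm⟩
    · refine (Finset.card_le_card ?_).trans (card_adj_rest_lt hI hc).le
      exact Finset.filter_subset_filter _ (Finset.filter_subset _ _)
  have h3 : p.2.card ≤ x.n := (Finset.card_le_univ _).trans_eq (Fintype.card_fin _)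
  have h4 : D * (2 * r * high.card) ≤ D * x.n := by
    have := Nat.mul_le_mul_right D h3
    nlinarith
  have h5 := Nat.le_of_mul_le_mul_left h4 hD
  rw [← h1] at hr
  nlinarith

/-- The blocks are the closed neighbourhoods in `p.2` of vertices of low degree. If `E` contains the
block of `v`, then `v` is undominated after the deletion of `E`; so `E` contains at most `D *
S.card` of the disjoint blocks and `card_few_le` applies. -/
theorem exists_numSets_fewUndominated_le {p : Finset (Fin x.n) × Finset (Fin x.n)}
    (hI : CoverInv D x S p) (hr : x.n < r * (rest x p).card) (hD : 1 ≤ D) :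
    ∃ m : ℕ, x.n ≤ 4 * D ^ 2 * r ^ 2 * m ∧ (numSets (fewUndominated D x S p) : ℝ) ≤
      2 ^ p.2.card * (1 - (1 / 2) ^ (2 * D * r + 1)) ^ m * 2 ^ (D * S.card) := by
  classical
  set low := (rest x p).filter fun v => (nb x.G {v} ∩ p.2).card < 2 * D * r with hlow
  have hlowC : ∀ v ∈ low, v ∈ p.2 := fun v hv => by
    have := (Finset.mem_filter.1 hv).1
    exact (Finset.mem_sdiff.1 this).1
  obtain ⟨J, hJI, hJ, hhit⟩ := exists_packing low (fun v => insert v (nb x.G {v} ∩ p.2))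
    fun v _ => ⟨v, by simp⟩
  have hs : ∀ v ∈ J, (insert v (nb x.G {v} ∩ p.2)).card ≤ 2 * D * r := fun v hv =>
    (Finset.card_insert_le _ _).trans (Finset.mem_filter.1 (hJI hv)).2
  have hC : ∀ v ∈ J, insert v (nb x.G {v} ∩ p.2) ⊆ p.2 := fun v hv =>
    Finset.insert_subset (hlowC v (hJI hv)) Finset.inter_subset_right
  refine ⟨J.card, ?_, ?_⟩
  · set Q := J.biUnion fun v => insert v (nb x.G {v} ∩ p.2)
    have h1 : Q.card ≤ J.card * (2 * D * r) := Finset.card_biUnion_le_card_mul _ _ _ hs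
    -- The packing is large: each low vertex equals or is adjacent to a vertex `c` of the packed
    -- blocks, and each `c` accounts for at most `D` low vertices.
    have h2 : low ⊆ Q.biUnion fun c => insert c ((rest x p).filter fun v => x.G.Adj v c) := by
      intro v hv
      obtain ⟨c, hc, hcQ⟩ := Finset.not_disjoint_iff.1 (hhit v hv)
      rw [Finset.mem_biUnion]
      refine ⟨c, hcQ, ?_⟩
      simp only [Finset.mem_insert, Finset.mem_inter, mem_nb, Finset.mem_singleton,
        exists_eq_left, Finset.mem_filter] at hc ⊢
      exact hc.imp Eq.symm fun h => ⟨(Finset.mem_filter.1 hv).1, h.1.symm⟩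
    have h3 : low.card ≤ Q.card * D := by
      refine (Finset.card_le_card h2).trans (Finset.card_biUnion_le_card_mul _ _ _ fun c hc => ?_)
      obtain ⟨v, hv, hcv⟩ := Finset.mem_biUnion.1 hc
      exact (Finset.card_insert_le _ _).trans (card_adj_rest_lt hI (hC v hv hcv))
    have h4 := card_low_le hI hr hD
    calc x.n ≤ 2 * r * low.card := h4
      _ ≤ 2 * r * (J.card * (2 * D * r) * D) :=
        Nat.mul_le_mul_left _ (h3.trans (Nat.mul_le_mul_right _ h1))
      _ = _ := by ring
  · refine le_trans ?_ (card_few_le hJ hC hs)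
    rw [Nat.cast_le]
    refine Finset.card_le_card fun E hE => ?_
    simp only [Finset.mem_filter, Finset.mem_univ, true_and, fewUndominated, Bool.and_eq_true,
      decide_eq_true_eq, Finset.mem_powerset] at hE ⊢
    refine ⟨hE.1, (Finset.card_le_card fun v hv => ?_).trans hE.2⟩
    obtain ⟨hvJ, hvE⟩ := Finset.mem_filter.1 hv
    have hvr := (Finset.mem_filter.1 (hJI hvJ)).1
    refine Finset.mem_sdiff.2 ⟨hvr, ?_⟩
    have hvc := (Finset.mem_sdiff.1 hvr).2
    simp only [cnb, Finset.mem_union, mem_nb, Finset.mem_sdiff, not_or, not_exists,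
      not_and] at hvc ⊢
    refine ⟨⟨hvc.1, fun _ h => h (hvE (Finset.mem_insert_self _ _))⟩, ?_⟩
    rintro w (hw | hw) hvw
    · exact hvc.2 w hw hvw
    · refine hw.2 (hvE (Finset.mem_insert_of_mem (Finset.mem_inter.2 ⟨?_, hw.1⟩)))
      rw [mem_nb]
      exact ⟨v, by simp, hvw.symm⟩

/-! ### Weighted branching inside a clique -/

/-- The base of the running time of the search below a clique. -/
noncomputable def hitBase (k : ℕ) : ℝ := 2 - (1 / 2) ^ (k + 1)

theorem one_lt_hitBase (k : ℕ) : 1 < hitBase k := by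
  have : (1 / 2 : ℝ) ^ (k + 1) ≤ (1 / 2) ^ 1 :=
    pow_le_pow_of_le_one (by norm_num) (by norm_num) (by omega)
  rw [hitBase]
  linarith

theorem hitBase_lt_two (k : ℕ) : hitBase k < 2 := by
  have : 0 < (1 / 2 : ℝ) ^ (k + 1) := by positivity
  rw [hitBase]
  linarith

/-- The sum of the first `m` negative powers of `hitBase k`. -/
noncomputable def hitSum (k m : ℕ) : ℝ := (1 - (hitBase k)⁻¹ ^ m) / (hitBase k - 1)

theorem hitSum_succ (k m : ℕ) : hitBase k * hitSum k (m + 1) = 1 + hitSum k m := by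
  have h := one_lt_hitBase k
  have h0 : hitBase k ≠ 0 := by linarith
  have h1 : hitBase k - 1 ≠ 0 := by linarith
  rw [hitSum, hitSum, pow_succ]
  field_simp
  ring

theorem hitSum_nonneg (k m : ℕ) : 0 ≤ hitSum k m := by
  have h := one_lt_hitBase k
  have h1 : (hitBase k)⁻¹ ^ m ≤ 1 :=
    pow_le_one₀ (inv_nonneg.2 (by linarith)) (inv_le_one_of_one_le₀ h.le)
  exact div_nonneg (by linarith) (by linarith)

/-- With `β = hitBase k` the claim reads `2 - β ≤ β^(-m)`. The left side is `(1/2)^(k+1)` by the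
choice of the base, and `β < 2`. -/
theorem hitSum_le_one {k m : ℕ} (hm : m ≤ k) : hitSum k m ≤ 1 := by
  have h := one_lt_hitBase k
  rw [hitSum, div_le_one (by linarith)]
  have h1 : (1 / 2 : ℝ) ^ (k + 1) ≤ (hitBase k)⁻¹ ^ m := by
    calc (1 / 2 : ℝ) ^ (k + 1) ≤ (1 / 2) ^ m :=
          pow_le_pow_of_le_one (by norm_num) (by norm_num) (by omega)
      _ ≤ _ := by
        refine pow_le_pow_left₀ (by norm_num) ?_ m
        rw [one_div]
        exact inv_anti₀ (by linarith) (hitBase_lt_two k).le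
  have h2 : (1 / 2 : ℝ) ^ (k + 1) = 2 - hitBase k := by rw [hitBase]; ring
  linarith

/-- The `i`-th branch has decided `i` vertices of `Q ∩ U`. So the weights add up to `β^|U|` times
the sum of the first `|Q ∩ U|` negative powers of `β = hitBase k`. -/
theorem sum_hitBranches_le {Q W U : Finset (Fin x.n)} (hQ : (Q ∩ U).card ≤ k) :
    (∀ p ∈ hitBranches x Q W U, p.2 ⊆ U) ∧
      ((hitBranches x Q W U).map fun p => hitBase k ^ p.2.card).sum ≤ hitBase k ^ U.card := by
  have hb := one_lt_hitBase k
  have key : ∀ (l : List (Fin x.n)) (s : Finset (Fin x.n) × List (Finset (Fin x.n) ×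
      Finset (Fin x.n))), l.Nodup → s.1 ⊆ U → (∀ v ∈ l, v ∈ U → v ∈ s.1) → (∀ p ∈ s.2, p.2 ⊆ U) →
      let s' := (l.map fun v => ({v} : Finset (Fin x.n))).foldl (fun s v =>
        if decide (v ⊆ Q ∩ U) then (s.1 \ v, (W \ v, s.1 \ v) :: s.2) else s) s
      (∀ p ∈ s'.2, p.2 ⊆ U) ∧ (s'.2.map fun p => hitBase k ^ p.2.card).sum ≤
        (s.2.map fun p => hitBase k ^ p.2.card).sum +
          hitSum k (Q ∩ s.1).card * hitBase k ^ s.1.card := by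
    intro l
    induction l with
    | nil =>
      intro s _ _ _ h
      refine ⟨h, ?_⟩
      have := mul_nonneg (hitSum_nonneg k (Q ∩ s.1).card)
        (pow_nonneg (by linarith : 0 ≤ hitBase k) s.1.card)
      simpa using this
    | cons v l ih =>
      intro s hl hsU hs hp
      rw [List.map_cons, List.foldl_cons]
      by_cases hv : {v} ⊆ Q ∩ U
      · have hv' := Finset.mem_inter.1 (hv (Finset.mem_singleton_self v))
        have hvs : v ∈ s.1 := hs v List.mem_cons_self hv'.2
        simp only [hv, decide_true, if_true]
        have hsub : s.1 \ {v} ⊆ U := Finset.sdiff_subset.trans hsU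
        obtain ⟨h1, h2⟩ := ih (s.1 \ {v}, (W \ {v}, s.1 \ {v}) :: s.2) (List.nodup_cons.1 hl).2
          hsub (fun w hw hwU => by
            rw [Finset.mem_sdiff, Finset.mem_singleton]
            exact ⟨hs w (List.mem_cons_of_mem _ hw) hwU,
              fun h => (List.nodup_cons.1 hl).1 (h ▸ hw)⟩)
          (fun p hp' => by
            rcases List.mem_cons.1 hp' with rfl | hp'
            · exact hsub
            · exact hp p hp')
        refine ⟨h1, h2.trans (le_of_eq ?_)⟩
        have h3 : s.1.card = (s.1 \ {v}).card + 1 := by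
          rw [Finset.sdiff_singleton_eq_erase, Finset.card_erase_add_one hvs]
        have h4 : (Q ∩ s.1).card = (Q ∩ (s.1 \ {v})).card + 1 := by
          rw [Finset.sdiff_singleton_eq_erase, Finset.inter_erase, Finset.card_erase_add_one
            (Finset.mem_inter.2 ⟨hv'.1, hvs⟩)]
        rw [List.map_cons, List.sum_cons, h3, h4, pow_succ]
        linear_combination -(hitBase k ^ (s.1 \ {v}).card) * hitSum_succ k (Q ∩ (s.1 \ {v})).card
      · simp only [hv, decide_false, Bool.false_eq_true, if_false]
        exact ih s (List.nodup_cons.1 hl).2 hsU (fun w hw => hs w (List.mem_cons_of_mem _ hw)) hp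
  obtain ⟨h1, h2⟩ := key (List.finRange x.n) (U, []) (List.nodup_finRange _) subset_rfl
    (fun _ _ h => h) (by simp)
  rw [← singles_eq] at h1 h2
  refine ⟨h1, h2.trans ?_⟩
  have := mul_le_mul_of_nonneg_right (hitSum_le_one hQ)
    (pow_nonneg (by linarith : 0 ≤ hitBase k) U.card)
  simpa using this

/-- More than `k` vertices of a minimal forbidden set inside the clique `p.2` would form a clique
that it must not contain. -/
theorem sum_hitStep_le (hP : P.Hereditary) (hk : P.ForbiddenBound k)
    {p : Finset (Fin x.n) × Finset (Fin x.n)} (hU : x.G.IsClique p.2) :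
    (∀ p' ∈ hitStep P x p, p'.2 ⊆ p.2) ∧
      ((hitStep P x p).map fun p => hitBase k ^ p.2.card).sum ≤ hitBase k ^ p.2.card := by
  rw [hitStep]
  by_cases h : P.MemOn x.G p.1
  · rw [if_pos (GraphClass.inClass_iff.2 h)]
    simp
  · rw [if_neg fun h' => h (GraphClass.inClass_iff.1 h')]
    refine sum_hitBranches_le ?_
    have hfree := (hk _ (minForbidden_spec hP h).2.2).2
    by_contra hlt
    push Not at hlt
    obtain ⟨K, hK, hKc⟩ := Finset.exists_subset_card_eq (Nat.succ_le_of_lt hlt)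
    have hKQ : K ⊆ minForbidden P x p.1 := hK.trans Finset.inter_subset_left
    have hKU : K ⊆ p.2 := hK.trans Finset.inter_subset_right
    refine hfree (K.subtype fun v => v ∈ (minForbidden P x p.1 : Set (Fin x.n))) ⟨?_, ?_⟩
    · intro u hu v hv huv
      rw [Finset.mem_coe, Finset.mem_subtype] at hu hv
      exact hU (hKU hu) (hKU hv) fun h => huv (Subtype.ext h)
    · rw [Finset.card_subtype, Finset.filter_true_of_mem (fun v hv => by exact hKQ hv), hKc]

/-- As `hitBase k > 1`, every node weighs at least 1, so a level has at most as many nodes as the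
root weighs. -/
theorem levels_hitStep_le (hP : P.Hereditary) (hk : P.ForbiddenBound k)
    {W U : Finset (Fin x.n)} (hU : x.G.IsClique U) :
    (levels (fun _ => hitStep P x) [(W, U)] (singles x.n) : ℝ) ≤
      (x.n + 1) * hitBase k ^ U.card := by
  have hb := one_lt_hitBase k
  have h0 : 0 ≤ hitBase k ^ U.card := pow_nonneg (by linarith) _
  have key : ∀ l₁ l₂, singles x.n = l₁ ++ l₂ →
      (l₁.foldl (fun L _ => L.flatMap (hitStep P x)) [(W, U)]).length ≤
        ⌊hitBase k ^ U.card⌋₊ := by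
    intro l₁ l₂ _
    have h1 := sum_foldl_le (F := fun _ => hitStep P x) (I := fun p => p.2 ⊆ U)
      (φ := fun _ p => hitBase k ^ p.2.card) (L := [(W, U)]) (l := l₁) 0 (by simp)
      fun _ _ _ p hp => by
        obtain ⟨h1, h2⟩ := sum_hitStep_le hP hk (hU.subset (by exact_mod_cast hp))
        exact ⟨fun p' hp' => (h1 p' hp').trans hp, h2⟩
    rw [Nat.le_floor_iff h0]
    generalize l₁.foldl (fun L _ => L.flatMap (hitStep P x)) [(W, U)] = L at h1 ⊢
    have h2 : (L.map fun _ => (1 : ℝ)).sum ≤ (L.map fun p => hitBase k ^ p.2.card).sum :=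
      List.sum_le_sum fun p _ => one_le_pow₀ hb.le
    rw [List.map_const', List.sum_replicate, nsmul_eq_mul, mul_one] at h2
    simpa using h2.trans h1
  have h1 : (levels (fun _ => hitStep P x) [(W, U)] (singles x.n) : ℝ) ≤
      (x.n + 1) * (⌊hitBase k ^ U.card⌋₊ : ℝ) := by
    have := levels_le (fun _ => hitStep P x) [(W, U)] key
    rw [length_singles] at this
    exact_mod_cast this
  exact h1.trans (mul_le_mul_of_nonneg_left (Nat.floor_le h0) (by positivity))

end

/-! ### The running time -/

/-- The function `f` is at most `2 ^ (μ * n)` up to a polynomial factor. -/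
def GrowthLE (f : Inp → ℕ) (μ : ℝ) : Prop :=
  ∃ p : Polynomial ℕ, ∀ x, (f x : ℝ) ≤ (p.eval x.n : ℕ) * 2 ^ (μ * x.n)

namespace GrowthLE

variable {f g : Inp → ℕ} {μ ν : ℝ}

theorem mono (h : GrowthLE f μ) (hμ : μ ≤ ν) : GrowthLE f ν := by
  obtain ⟨p, hp⟩ := h
  refine ⟨p, fun x => (hp x).trans (mul_le_mul_of_nonneg_left ?_ (by positivity))⟩
  exact Real.rpow_le_rpow_of_exponent_le (by norm_num)
    (mul_le_mul_of_nonneg_right hμ (by positivity))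

theorem add (hf : GrowthLE f μ) (hg : GrowthLE g μ) : GrowthLE (fun x => f x + g x) μ := by
  obtain ⟨p, hp⟩ := hf
  obtain ⟨q, hq⟩ := hg
  refine ⟨p + q, fun x => ?_⟩
  have h1 := hp x
  have h2 := hq x
  rw [Polynomial.eval_add]
  push_cast
  linarith

theorem mul (hf : GrowthLE f μ) (hg : GrowthLE g ν) : GrowthLE (fun x => f x * g x) (μ + ν) := by
  obtain ⟨p, hp⟩ := hf
  obtain ⟨q, hq⟩ := hg
  refine ⟨p * q, fun x => ?_⟩
  rw [Polynomial.eval_mul, add_mul, Real.rpow_add (by norm_num)]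
  push_cast
  calc (f x : ℝ) * g x ≤ _ := mul_le_mul (hp x) (hq x) (by positivity) (by positivity)
    _ = _ := by ring

theorem const (m : ℕ) (hμ : 0 ≤ μ) : GrowthLE (fun _ => m) μ := by
  refine ⟨Polynomial.C m, fun x => ?_⟩
  rw [Polynomial.eval_C]
  exact le_mul_of_one_le_right (by positivity)
    (Real.one_le_rpow (by norm_num) (by positivity))

theorem succ (hf : GrowthLE f μ) (hμ : 0 ≤ μ) : GrowthLE (fun x => f x + 1) μ :=
  hf.add (const 1 hμ)

theorem floor (p : Polynomial ℕ) (μ : ℝ) :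
    GrowthLE (fun x => ⌊((p.eval x.n : ℕ) : ℝ) * 2 ^ (μ * x.n)⌋₊) μ :=
  ⟨p, fun _ => Nat.floor_le (by positivity)⟩

end GrowthLE

/-- A factor below 1 occurring linearly often is an exponential saving. The `t + 1` in the witness
avoids division by zero; the cap at 1 keeps later exponents nonnegative. -/
theorem exists_rate {ρ : ℝ} (h₀ : 0 < ρ) (h₁ : ρ < 1) (t : ℕ) : ∃ σ : ℝ, 0 < σ ∧ σ ≤ 1 ∧
    ∀ n m : ℕ, n ≤ t * m → ρ ^ m ≤ 2 ^ (-σ * n) := by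
  have hlog : Real.logb 2 ρ < 0 := Real.logb_neg (by norm_num) h₀ h₁
  refine ⟨min 1 (-Real.logb 2 ρ / (t + 1)), lt_min one_pos (div_pos (by linarith) (by positivity)),
    min_le_left _ _, fun n m hm => ?_⟩
  have h4 : ρ ^ m = 2 ^ (Real.logb 2 ρ * m) := by
    rw [Real.rpow_mul (by norm_num), Real.rpow_logb (by norm_num) (by norm_num) h₀,
      Real.rpow_natCast]
  rw [h4]
  refine Real.rpow_le_rpow_of_exponent_le (by norm_num) ?_
  have h5 : (n : ℝ) ≤ (t + 1) * m := by
    have : n ≤ (t + 1) * m := by nlinarith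
    exact_mod_cast this
  have h6 := mul_le_mul_of_nonneg_right (min_le_right 1 (-Real.logb 2 ρ / (t + 1)))
    (Nat.cast_nonneg (α := ℝ) n)
  have h7 : -Real.logb 2 ρ / (t + 1) * n ≤ -Real.logb 2 ρ * m := by
    rw [div_mul_eq_mul_div, div_le_iff₀ (by positivity)]
    have := mul_le_mul_of_nonneg_left h5 (by linarith : 0 ≤ -Real.logb 2 ρ)
    linarith
  linarith

theorem numSets_subset {n : ℕ} (C : Finset (Fin n)) :
    numSets (fun Y : Finset (Fin n) => decide (Y ⊆ C)) = 2 ^ C.card := by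
  rw [numSets, ← Finset.card_powerset]
  congr 1
  ext W
  simp

theorem two_pow_eq (n : ℕ) : (2 : ℝ) ^ n = 2 ^ (1 * (n : ℝ)) := by
  rw [one_mul, Real.rpow_natCast]

/-- Guessing outside `K` and searching inside costs `2^(n - |K|) * β^|K| = 2^n * (β / 2)^|K|` with
`β = hitBase k`, and `|K|` is linear in `n`. -/
theorem exists_clique_bound (k a : ℕ) : ∃ (p : Polynomial ℕ) (μ : ℝ), μ < 1 ∧
    ∀ (P : GraphClass), P.Hereditary → P.ForbiddenBound k → ∀ (x : Inp), ∀ K ∈ largeCliques a x,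
    2 ^ (Finset.univ \ K).card + ((enumSets fun Y => decide (Y ⊆ Finset.univ \ K)).map fun Y =>
        levels (fun _ => hitStep P x) [(Y ∪ K, K)] (singles x.n)).sum ≤
      ⌊((p.eval x.n : ℕ) : ℝ) * 2 ^ (μ * x.n)⌋₊ := by
  have hb := one_lt_hitBase k
  obtain ⟨σ, hσ, -, h⟩ := exists_rate (ρ := hitBase k / 2) (by linarith)
    (by linarith [hitBase_lt_two k]) a
  refine ⟨4 * Polynomial.X + 6, 1 + -σ, by linarith, fun P hP hk x K hK => ?_⟩
  obtain ⟨hK1, hK2⟩ := largeCliques_spec hK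
  rw [Nat.le_floor_iff (by positivity)]
  set C := Finset.univ \ K with hC
  have hcard : C.card + K.card = x.n := by
    rw [hC, Finset.card_sdiff_add_card_eq_card (Finset.subset_univ K)]
    simp
  have hlen : ((enumSets fun Y => decide (Y ⊆ C)).length : ℝ) ≤ 2 ^ C.card + 1 := by
    have := length_enumSets (subset_down C)
    rw [numSets_subset] at this
    exact_mod_cast this
  have hsum : ((((enumSets fun Y => decide (Y ⊆ C)).map fun Y =>
      levels (fun _ => hitStep P x) [(Y ∪ K, K)] (singles x.n)).sum : ℕ) : ℝ) ≤
      (2 ^ C.card + 1) * ((x.n + 1) * hitBase k ^ K.card) := by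
    rw [Nat.cast_list_sum, List.map_map]
    refine (List.sum_le_card_nsmul _ ((x.n + 1) * hitBase k ^ K.card) fun m hm => ?_).trans ?_
    · obtain ⟨Y, -, rfl⟩ := List.mem_map.1 hm
      exact levels_hitStep_le hP hk hK1
    · rw [List.length_map, nsmul_eq_mul]
      exact mul_le_mul_of_nonneg_right hlen (by positivity)
  have h1 : (2 : ℝ) ^ C.card * hitBase k ^ K.card = 2 ^ x.n * (hitBase k / 2) ^ K.card := by
    rw [show (2 : ℝ) ^ x.n = 2 ^ C.card * 2 ^ K.card by rw [← pow_add, hcard], div_pow]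
    field_simp
  -- Only `|K| + 1` is known to exceed `n / a`; since `hitBase k / 2 ≥ 1 / 2`, the missing vertex
  -- costs a factor 2.
  have h2 : (hitBase k / 2) ^ K.card ≤ 2 * 2 ^ (-σ * x.n) := by
    have h3 := h x.n (K.card + 1) hK2.le
    rw [pow_succ] at h3
    have h4 : 0 ≤ (hitBase k / 2) ^ K.card := by positivity
    have h5 := mul_le_mul_of_nonneg_left (by linarith : 1 / 2 ≤ hitBase k / 2) h4
    linarith
  have h6 : (1 : ℝ) ≤ hitBase k ^ K.card := one_le_pow₀ hb.le
  have h7 : (1 : ℝ) ≤ 2 ^ C.card := one_le_pow₀ (by norm_num)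
  have h8 : (2 : ℝ) ^ C.card * hitBase k ^ K.card ≤ 2 * 2 ^ ((1 + -σ) * x.n) := by
    rw [h1, add_mul, Real.rpow_add (by norm_num), ← two_pow_eq]
    have := mul_le_mul_of_nonneg_left h2 (by positivity : (0 : ℝ) ≤ 2 ^ x.n)
    linarith
  have h9 : (2 : ℝ) ^ C.card ≤ 2 ^ C.card * hitBase k ^ K.card :=
    le_mul_of_one_le_right (by positivity) h6
  have h10 : (2 ^ C.card + 1 : ℝ) * ((x.n + 1) * hitBase k ^ K.card) ≤
      2 * (x.n + 1) * (2 ^ C.card * hitBase k ^ K.card) := by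
    have := mul_le_mul_of_nonneg_right (by linarith : (2 : ℝ) ^ C.card + 1 ≤ 2 * 2 ^ C.card)
      (by positivity : 0 ≤ (x.n + 1 : ℝ) * hitBase k ^ K.card)
    linarith
  have h11 := mul_le_mul_of_nonneg_left h8 (by positivity : (0 : ℝ) ≤ 2 * (x.n + 1) + 1)
  rw [Nat.cast_add, Nat.cast_pow, Nat.cast_ofNat]
  refine (add_le_add le_rfl hsum).trans ?_
  simp only [Polynomial.eval_add, Polynomial.eval_mul, Polynomial.eval_X, Polynomial.eval_ofNat]
  push_cast
  linarith

/-- The packing saves `2^(-σn)`, and `2 * D ≤ σ * a` keeps the loss `2^(D|S|)` below `2^(σn/2)`. As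
`σ` depends only on `D` and `r`, `a` may be chosen afterwards. -/
theorem exists_dominating_bound {D r : ℕ} (hD : 1 ≤ D)
    (hlev : ∀ (x : Inp) (S : Finset (Fin x.n)),
      (levels (fun v p => coverStep D x S p v) [(∅, ∅)] (singles x.n) : ℝ) ≤
        (x.n + 1) * 2 ^ (1 / 2 * x.n : ℝ)) :
    ∃ (p : Polynomial ℕ) (σ : ℝ), 0 < σ ∧ σ ≤ 1 ∧ ∀ a : ℕ, 2 * D ≤ σ * a →
    ∀ (x : Inp), ∀ S ∈ (enumSets (small a)).filter (isCl x),
      levels (fun v p => coverStep D x S p v) [(∅, ∅)] (singles x.n) +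
      ((coverStates D x S).map fun p => if small r (rest x p) then 0 else
        numSets (fewUndominated D x S p)).sum ≤
        ⌊((p.eval x.n : ℕ) : ℝ) * 2 ^ ((1 - σ / 2) * x.n)⌋₊ := by
  have hρ : (1 / 2 : ℝ) ^ (2 * D * r + 1) ≤ 1 / 2 := by
    have := pow_le_pow_of_le_one (by norm_num : (0 : ℝ) ≤ 1 / 2) (by norm_num)
      (by omega : 1 ≤ 2 * D * r + 1)
    simpa using this
  obtain ⟨σ, hσ, hσ1, h⟩ := exists_rate (ρ := 1 - (1 / 2) ^ (2 * D * r + 1)) (by linarith)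
    (by linarith [(by positivity : 0 < (1 / 2 : ℝ) ^ (2 * D * r + 1))]) (4 * D ^ 2 * r ^ 2)
  refine ⟨Polynomial.X + 2, σ, hσ, hσ1, fun a ha x S hS => ?_⟩
  rw [Nat.le_floor_iff (by positivity)]
  have hS' : (a : ℝ) * S.card ≤ x.n := by
    have := (mem_enumSets (small_down a)).1 (List.mem_filter.1 hS).1
    have : a * S.card ≤ x.n := by
      rcases this with rfl | h
      · simp
      · simpa [small] using h
    exact_mod_cast this
  have hDS : (D * S.card : ℝ) ≤ σ / 2 * x.n := by
    have h1 := mul_le_mul_of_nonneg_right ha (Nat.cast_nonneg (α := ℝ) S.card)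
    have h2 := mul_le_mul_of_nonneg_left hS' hσ.le
    linarith
  have hterm : ∀ p ∈ coverStates D x S, ((if small r (rest x p) then 0 else
      numSets (fewUndominated D x S p) : ℕ) : ℝ) ≤ 2 ^ (-(σ / 2) * x.n) * 2 ^ p.2.card := by
    intro p hp
    split
    · rw [Nat.cast_zero]
      positivity
    · rename_i hr
      simp only [small, decide_eq_true_eq, not_le] at hr
      obtain ⟨m, hm, hm'⟩ := exists_numSets_fewUndominated_le (coverInv_of_mem hp) hr hD
      refine hm'.trans ?_
      have h1 := h _ _ hm
      have h2 : (2 : ℝ) ^ (D * S.card) ≤ 2 ^ (σ / 2 * x.n) := by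
        rw [← Real.rpow_natCast]
        refine Real.rpow_le_rpow_of_exponent_le (by norm_num) ?_
        push_cast
        exact hDS
      have h3 := mul_le_mul h1 h2 (by positivity) (by positivity)
      rw [← Real.rpow_add (by norm_num), ← add_mul,
        show -σ + σ / 2 = -(σ / 2) by ring] at h3
      have := mul_le_mul_of_nonneg_left h3 (by positivity : (0 : ℝ) ≤ 2 ^ p.2.card)
      linarith
  have hsum : ((((coverStates D x S).map fun p => if small r (rest x p) then 0 else
      numSets (fewUndominated D x S p)).sum : ℕ) : ℝ) ≤ 2 ^ ((1 - σ / 2) * x.n) := by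
    rw [Nat.cast_list_sum, List.map_map]
    refine (List.sum_le_sum (g := fun p => 2 ^ (-(σ / 2) * x.n) * 2 ^ p.2.card) hterm).trans ?_
    rw [List.sum_map_mul_left, show (1 - σ / 2) * (x.n : ℝ) = -(σ / 2) * x.n + 1 * x.n by ring,
      Real.rpow_add (by norm_num), ← two_pow_eq]
    exact mul_le_mul_of_nonneg_left (sum_two_pow_coverStates_le D x S) (by positivity)
  have h1 := hlev x S
  have h2 : (2 : ℝ) ^ (1 / 2 * x.n : ℝ) ≤ 2 ^ ((1 - σ / 2) * x.n) :=
    Real.rpow_le_rpow_of_exponent_le (by norm_num)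
      (mul_le_mul_of_nonneg_right (by linarith) (by positivity))
  have h3 := mul_le_mul_of_nonneg_left h2 (by positivity : (0 : ℝ) ≤ x.n + 1)
  push_cast at hsum ⊢
  simp only [Polynomial.eval_add, Polynomial.eval_X, Polynomial.eval_ofNat]
  push_cast
  linarith

/-- The cores are disjoint and each has at least `n / b` vertices, which leaves at most `(1 - 1/b)n`
for the other. -/
theorem core_bound {b : ℕ} (hb : 1 ≤ b) {x : Inp} {A₁ A₂ Q U : Finset (Fin x.n)}
    (hA : Disjoint A₁ A₂) (h₁ : x.n ≤ b * (core x A₁ A₂ Q U).card)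
    (h₂ : x.n ≤ b * (core x A₂ A₁ Q U).card) :
    2 ^ (core x A₁ A₂ Q U).card + 2 ^ (core x A₂ A₁ Q U).card ≤
      ⌊(((2 : Polynomial ℕ).eval x.n : ℕ) : ℝ) * 2 ^ ((1 - 1 / b : ℝ) * x.n)⌋₊ := by
  rw [Nat.le_floor_iff (by positivity)]
  have hb' : (0 : ℝ) < b := by exact_mod_cast hb
  have key : ∀ c c' : ℕ, c + c' ≤ x.n → x.n ≤ b * c' →
      (2 : ℝ) ^ c ≤ 2 ^ ((1 - 1 / b : ℝ) * x.n) := fun c c' h h' => by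
    rw [← Real.rpow_natCast]
    refine Real.rpow_le_rpow_of_exponent_le (by norm_num) ?_
    have h1 : (c + c' : ℝ) ≤ x.n := by exact_mod_cast h
    have h2 : (x.n : ℝ) ≤ b * c' := by exact_mod_cast h'
    have h3 : (x.n : ℝ) / b ≤ c' := by rwa [div_le_iff₀' hb']
    have h4 : (1 - 1 / b : ℝ) * x.n = x.n - x.n / b := by ring
    linarith
  have hsum : (core x A₁ A₂ Q U).card + (core x A₂ A₁ Q U).card ≤ x.n := by
    rw [← Finset.card_union_of_disjoint ((hA.mono_left (core_subset x A₁ A₂ Q U)).mono_right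
      (core_subset x A₂ A₁ Q U))]
    exact (Finset.card_le_univ _).trans_eq (Fintype.card_fin _)
  have h3 := key _ _ hsum h₂
  have h4 := key _ _ ((Nat.add_comm _ _).trans_le hsum) h₁
  simp only [Polynomial.eval_ofNat]
  push_cast
  linarith

theorem exists_splits_bound (q : ℕ) : ∃ τ : ℝ, 0 < τ ∧ τ ≤ 1 ∧
    ∀ (x : Inp) (A₁ A₂ : Finset (Fin x.n)), covers q x A₁ A₂ = [] →
      numSets (splits x A₁ A₂) ≤
        ⌊(((1 : Polynomial ℕ).eval x.n : ℕ) : ℝ) * 2 ^ ((1 - τ) * x.n)⌋₊ := by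
  obtain ⟨τ, h0, h1, h⟩ := exists_rate (ρ := 7 / 8) (by norm_num) (by norm_num) (2 * q)
  refine ⟨τ, h0, h1, fun x A₁ A₂ hc => ?_⟩
  obtain ⟨m, hm, hm'⟩ := exists_numSets_splits_le hc
  rw [Nat.le_floor_iff (by positivity)]
  refine hm'.trans ?_
  rw [Polynomial.eval_one, Nat.cast_one, one_mul, sub_eq_add_neg, add_mul,
    Real.rpow_add (by norm_num), ← two_pow_eq]
  exact mul_le_mul_of_nonneg_left (h _ _ hm) (by positivity)

/-- The parameters can be chosen so that the base of the running time is less than `2`. -/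
theorem exists_parameters (k : ℕ) : ∃ (a D r z q b d : ℕ) (lam : ℝ), lam < 1 ∧ b = 6 * d ∧ b ≤ a ∧
    1 ≤ a ∧ 2 * z ≤ D ∧ 2 * z ≤ r ∧
    ∀ (P : GraphClass) (T : Prog) (p : Polynomial ℕ), P.Hereditary → P.ForbiddenBound k →
      P.PolyTimeRecognizable → T.AnswersWithin p →
      ∃ c : Inp → ℕ, GrowthLE c lam ∧
        LComp .unit .set (fun x _ => allCands P T a D r z q b x d) fun x _ => c x := by
  obtain ⟨d₀, hd⟩ := exists_numSets_small_le (by norm_num : (0 : ℝ) < 1 / 2)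
  obtain ⟨d, hd1, hd0⟩ : ∃ d, 1 ≤ d ∧ d₀ ≤ d := ⟨d₀ + 1, by omega, by omega⟩
  replace hd := hd d hd0
  obtain ⟨b, hb⟩ : ∃ b, b = 6 * d := ⟨_, rfl⟩
  have hb1 : 1 ≤ b := by omega
  have hb' : (1 : ℝ) ≤ b := by exact_mod_cast hb1
  have hbi : 0 < (1 / b : ℝ) := by positivity
  have hbi1 : (1 / b : ℝ) ≤ 1 := by rw [div_le_one (by positivity)]; exact hb'
  -- `Q` and `U` together cost `2^(n/(4b))`, well below the saving `2^(n/b)` of `core_bound`.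
  obtain ⟨q, hq⟩ := exists_numSets_small_le (by linarith : (0 : ℝ) < 1 / b / 8)
  replace hq := hq q le_rfl
  obtain ⟨τ, hτ, hτ1, hsplit⟩ := exists_splits_bound q
  -- Both outcomes for the sides save `5ε`; the guesses of `Z₁`, `Z₂` and `S` cost at most `3ε` of
  -- it.
  obtain ⟨ε, hε, hε1, hε2⟩ : ∃ ε : ℝ, 0 < ε ∧ 5 * ε ≤ τ ∧ 8 * ε ≤ 1 / b :=
    ⟨min (τ / 5) (1 / b / 8), lt_min (by linarith) (by linarith),
      by linarith [min_le_left (τ / 5) (1 / b / 8 : ℝ)],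
      by linarith [min_le_right (τ / 5) (1 / b / 8 : ℝ)]⟩
  obtain ⟨z₀, hz⟩ := exists_numSets_small_le hε
  obtain ⟨D₀, hD⟩ := exists_levels_coverStep_le (by norm_num : (0 : ℝ) < 1 / 2)
  obtain ⟨z, hz1, hz0, hzD⟩ : ∃ z, 1 ≤ z ∧ z₀ ≤ z ∧ D₀ ≤ 2 * z :=
    ⟨z₀ + D₀ + 1, by omega, by omega, by omega⟩
  replace hz := hz z hz0
  obtain ⟨pd, σ, hσ, hσ1, hdom⟩ := exists_dominating_bound (r := 2 * z) (by omega : 1 ≤ 2 * z)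
    (hD (2 * z) hzD (by omega))
  -- `ζ` is the price of guessing `S`, to be covered by the saving of each case that uses it.
  obtain ⟨ζ, hζ, hζ1, hζ2, hζ3⟩ : ∃ ζ : ℝ, 0 < ζ ∧ ζ ≤ ε ∧ ζ ≤ σ / 4 ∧ ζ ≤ 1 / 2 :=
    ⟨min ε (min (σ / 4) (1 / 2)), lt_min hε (lt_min (by linarith) (by norm_num)), min_le_left _ _,
      (min_le_right _ _).trans (min_le_left _ _), (min_le_right _ _).trans (min_le_right _ _)⟩
  obtain ⟨a₀, ha⟩ := exists_numSets_small_le hζ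
  obtain ⟨a₁, ha₁⟩ := exists_nat_ge (2 * (2 * z : ℕ) / σ : ℝ)
  obtain ⟨a, ha0, hab, ha1⟩ : ∃ a, a₀ ≤ a ∧ b ≤ a ∧ a₁ ≤ a :=
    ⟨a₀ + a₁ + b, by omega, by omega, by omega⟩
  replace ha := ha a ha0
  have haD : (2 * (2 * z : ℕ) : ℝ) ≤ σ * a := by
    rw [div_le_iff₀' hσ] at ha₁
    refine ha₁.trans (mul_le_mul_of_nonneg_left ?_ hσ.le)
    exact_mod_cast ha1
  obtain ⟨pc, μ, hμ, hcl⟩ := exists_clique_bound k a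
  obtain ⟨lam, hl, hl1, hl2, hl3, hl4⟩ : ∃ lam : ℝ, lam < 1 ∧ 1 / 2 ≤ lam ∧ μ ≤ lam ∧
      1 - σ / 4 ≤ lam ∧ 1 - ε ≤ lam :=
    ⟨max (max (1 / 2) μ) (max (1 - σ / 4) (1 - ε)), max_lt (max_lt (by norm_num) hμ)
      (max_lt (by linarith) (by linarith)), (le_max_left _ _).trans (le_max_left _ _),
      (le_max_right _ _).trans (le_max_left _ _), (le_max_left _ _).trans (le_max_right _ _),
      (le_max_right _ _).trans (le_max_right _ _)⟩
  refine ⟨a, 2 * z, 2 * z, z, q, b, d, lam, hl, hb, hab, hb1.trans hab, le_rfl, le_rfl,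
    fun P T p hP hk hR hT => ?_⟩
  have hNS : ∀ {c : ℕ} {η : ℝ}, (∀ n : ℕ, (numSets (small c (n := n)) : ℝ) ≤ 2 ^ (η * n)) →
      GrowthLE (fun x => numSets (small c (n := x.n))) η := fun h =>
    ⟨1, fun x => by simpa using h x.n⟩
  have gM := GrowthLE.floor 2 (1 - 1 / b : ℝ)
  have gN := GrowthLE.floor 1 (1 - τ)
  have g1 : GrowthLE _ (1 - 5 * ε) :=
    (((GrowthLE.const 2 le_rfl).mul (((hNS hq).succ (by linarith)).mul
      ((hNS hq).succ (by linarith)))).mul (gM.succ (by linarith))).mono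
      (by linarith : 0 + (1 / b / 8 + 1 / b / 8) + (1 - 1 / b) ≤ 1 - 5 * ε)
  have g2 := (g1.add (gN.mono (by linarith : 1 - τ ≤ 1 - 5 * ε))).succ (by linarith)
  have g3 := (((hNS hz).succ hε.le).mul g2).succ (by linarith)
  have g4 := (((hNS hz).succ hε.le).mul g3).succ (by linarith)
  have gsep := (((hNS ha).succ hζ.le).mul g4).mono
    (by linarith : ζ + (ε + (ε + (1 - 5 * ε))) ≤ lam)
  have gdom := (((hNS ha).succ hζ.le).mul ((GrowthLE.floor pd (1 - σ / 2)).succ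
    (by linarith))).mono (by linarith : ζ + (1 - σ / 2) ≤ lam)
  have gcl := ((hNS ha).mono (by linarith : ζ ≤ lam)).add ((GrowthLE.floor pc μ).mono hl2)
  refine ⟨_, ((hNS hd).mono hl1).add (gcl.add (gdom.add gsep)), ?_⟩
  have lsep := LComp.separatedCands (T := T) (a := a) (z := z) (q := q) (b := b) hT
    (M := fun x => ⌊(((2 : Polynomial ℕ).eval x.n : ℕ) : ℝ) * 2 ^ ((1 - 1 / b : ℝ) * x.n)⌋₊)
    (N := fun x => ⌊(((1 : Polynomial ℕ).eval x.n : ℕ) : ℝ) * 2 ^ ((1 - τ) * x.n)⌋₊)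
    (fun x S Z₁ Z₂ Q U => core_bound hb1 (side_disjoint x S Z₁ Z₂))
    fun x S Z₁ Z₂ => hsplit x _ _
  simp only [pow_two] at lsep
  exact LComp.small.append ((LComp.cliqueCands hR (hcl P hP hk)).append
    ((LComp.dominatingCands (hdom a haD)).append lsep))

theorem LComp.result {P : GraphClass} {T : Prog} {a D r z q b d : ℕ} {c : Inp → ℕ}
    (hP : P.PolyTimeRecognizable)
    (h : LComp .unit .set (fun x _ => allCands P T a D r z q b x d) fun x _ => c x) :
    Comp .unit .set (fun x _ => result P T a D r z q b x d) fun x _ => c x := by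
  have htest : PComp (Ty.unit.prod .set) .bool fun x p => inClass P x p.2 :=
    Comp.inClass hP Comp.id.snd
  obtain ⟨h, s, hs⟩ := h.filter htest
  refine h.largest.mono ⟨s + 1, fun x u => ?_⟩
  have := hs x u
  rw [Polynomial.eval_add, Polynomial.eval_one]
  nlinarith

theorem theorem1 (k : ℕ) :
    ∃ lam : ℝ, lam < 1 ∧
      ∀ P : GraphClass, P.Hereditary → P.SubclassOfChordal → P.ForbiddenBound k →
        P.PolyTimeRecognizable → P.HasGluingTest →
        ∃ (M : Prog) (q : Polynomial ℕ), ∀ (n : ℕ) (G : SimpleGraph (Fin n)),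
          ∃ (W : Finset (Fin n)) (t : ℕ),
            M.Runs (encGraph G) (encSet W) t ∧ P.IsMaximumInduced G W ∧
              (t : ℝ) ≤ ((q.eval n : ℕ) : ℝ) * (2 : ℝ) ^ (lam * (n : ℝ)) := by
  obtain ⟨a, D, r, z, q, b, d, lam, hlam, hb, hab, ha, hD, hr, h⟩ := exists_parameters k
  -- A nonnegative exponent makes `2^(λn) ≥ 1`, which absorbs additive constants.
  refine ⟨max 0 lam, max_lt one_pos hlam, fun P hP _ hk hR hG => ?_⟩
  obtain ⟨T, p, hT, hsound, hsep⟩ := hG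
  obtain ⟨c, hc, hcomp⟩ := h P T p hP hk hR hT
  obtain ⟨R, f, hrun⟩ := hcomp.result hR
  obtain ⟨g, hg⟩ := (hc.mono (le_max_right 0 lam)).succ (le_max_left 0 lam)
  -- `R` expects the graph paired with an argument; the trivial argument is encoded as `nil`.
  refine ⟨.seq (.cons .skip .nil) R, f * g + 4, fun n G => ?_⟩
  obtain ⟨t, ht, hrun⟩ := RunsIn.seq ((RunsIn.skip (encGraph G)).cons (RunsIn.nil _))
    (hrun ⟨n, G⟩ ())
  refine ⟨_, t, hrun, result_isMaximumInduced (x := ⟨n, G⟩) hP hk hsound hsep hb hab ha hD hr, ?_⟩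
  have h1 := hg ⟨n, G⟩
  have h2 : (t : ℝ) ≤ f.eval n * (c ⟨n, G⟩ + 1 : ℕ) + 4 := by
    have h3 : t ≤ 1 + 1 + 1 + f.eval n * (c ⟨n, G⟩ + 1) + 1 := ht
    have : t ≤ f.eval n * (c ⟨n, G⟩ + 1) + 4 := by linarith
    exact_mod_cast this
  have h3 := mul_le_mul_of_nonneg_left h1 (Nat.cast_nonneg (α := ℝ) (f.eval n))
  have h4 : (1 : ℝ) ≤ 2 ^ (max 0 lam * n) :=
    Real.one_le_rpow (by norm_num) (mul_nonneg (le_max_left _ _) (by positivity))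
  rw [Polynomial.eval_add, Polynomial.eval_mul, Polynomial.eval_ofNat]
  push_cast at h2 h3 ⊢
  linarith
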